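/- **Setting.** Let $D$ be a (smooth, real) $2n$-dimensional Lie group whose Lie algebra $\mathcal D$ carries a non-degenerate symmetric invariant bilinear form $\langle\cdot|\cdot\rangle$ (invariance: $\langle[X,Y]|Z\rangle+\langle Y|[X,Z]\rangle=0$) and two subalgebras $\mathcal G,\hat{\mathcal G}$ with $\mathcal D=\mathcal G\oplus\hat{\mathcal G}$ and $\langle\mathcal G|\mathcal G\rangle=\langle\hat{\mathcal G}|\hat{\mathcal G}\rangle=0$. Let $J$ (resp. $\hat J$) be the projector onto $\mathcal G$ along $\hat{\mathcal G}$ (resp. onto $\hat{\mathcal G}$ along $\mathcal G$). Let $R:\hat{\mathcal G}\to\mathcal G$ be linear and let $R^*:\hat{\mathcal G}\to\mathcal G$ be its adjoint, $\langle R\gamma|\delta\rangle=\langle\gamma|R^*\delta\rangle$. Put $$\mathcal R=\{\gamma+R\gamma:\gamma\in\hat{\mathcal G}\},\qquad \mathcal R^\perp=\{\gamma-R^*\gamma:\gamma\in\hat{\mathcal G}\},\qquad \mathcal F=\{\gamma+R\gamma:\gamma\in\mathrm{Ker}(R+R^*)\},$$ and let $\mathcal F^\perp$ be the orthogonal complement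 of $\mathcal F$ in $\mathcal D$. There are linear maps $\alpha_\pm:\mathcal F^\perp\to\hat{\mathcal G}$ with $X=\alpha_+(X)+\alpha_-(X)+R\alpha_+(X)-R^*\alpha_-(X)$ for all $X\in\mathcal F^\perp$, and $$K(X)=2\langle\alpha_+(X)|R\alpha_+(X)\rangle+2\langle\alpha_-(X)|R\alpha_-(X)\rangle\qquad(X\in\mathcal F^\perp)$$ does not depend on their choice. The world-sheet is $\mathbb R^2$ with coordinates $(\sigma,\tau)$. The fields are smooth maps $l:\mathbb R^2\to D$ and $\Lambda:\mathbb R^2\to\mathcal F$; the constraint imposed by the Lagrange multiplier $\Lambda$ is $\partial_\sigma l\,l^{-1}\in\mathcal F^\perp$ everywhere. Let $b=d^{-1}\langle\theta\wedge[\theta\wedge\theta]\rangle$ be any smooth 2-form on $D$ with $db=\langle\theta\wedge[\theta\wedge\theta]\rangle$, where $\theta$ is the right-invariant Maurer–Cartan form and $[\theta\wedge\theta](X,Y)=2[\theta(X),\theta(Y)]$. On a measurable region $W\subseteq\mathbb R^2$, oriented by $d\sigma\wedge d\tau$, the first-order action of fields satisfying the constraint is $$\mathcal S_W(l,\Lambda)=\frac12\int_W\Big(\langle\partial_\tau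 l\,l^{-1}|\partial_\sigma l\,l^{-1}\rangle+\tfrac16\,d^{-1}\langle dl\,l^{-1}\wedge[dl\,l^{-1}\wedge dl\,l^{-1}]\rangle+K(\partial_\sigma l\,l^{-1})+\langle\Lambda|\partial_\sigma l\,l^{-1}\rangle\Big).$$ **Theorem 3 (standard dressing cosets, gauge symmetry).** Assume that $\mathrm{Ker}R=\mathrm{Ker}R^*=0$, that $\mathcal F$ is a Lie subalgebra of $\mathcal D$, that $F$ is a connected Lie subgroup of $D$ with Lie algebra $\mathcal F$, and that, as operators on $\mathcal D$ ($R$ being extended by $0$ on $\mathcal G$), $$J\,\mathrm{Ad}_f\hat J+J[\mathrm{Ad}_f,R]\hat J=R\,\mathrm{Ad}_fR\qquad\text{for all }f\in F.$$ Then: 1. $\mathrm{Ad}_f\mathcal R=\mathcal R$ and $\mathrm{Ad}_f\mathcal R^\perp=\mathcal R^\perp$ for all $f\in F$. 2. For all $f\in F$ and $X\in\mathcal F^\perp$ one has $\mathrm{Ad}_fX\in\mathcal F^\perp$ and $K(\mathrm{Ad}_fX)=K(X)$. 3. The first-order action is gauge invariant with gauge group $F$. For every smooth $f:\mathbb R^2\to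 F$, the transformation $$l\mapsto fl,\qquad \Lambda\mapsto f\Lambda f^{-1}-\partial_\tau f\,f^{-1}$$ maps smooth fields ($l$ in $D$, $\Lambda$ in $\mathcal F$) to smooth fields and preserves the constraint. If moreover $f=1$ outside a compact set, then for every choice of $b$ as above, every measurable $W\subseteq\mathbb R^2$ containing the (closed) support of $f$, and all fields satisfying the constraint for which the integral $\mathcal S_W(l,\Lambda)$ converges, the integral $\mathcal S_W(fl,f\Lambda f^{-1}-\partial_\tau f\,f^{-1})$ converges and equals $\mathcal S_W(l,\Lambda)$. For the same $f$, $b$ and $W$, the functional $$\int_W\Big(\tfrac12\langle\partial_\tau l\,l^{-1}|\partial_\sigma l\,l^{-1}\rangle+\tfrac1{12}\,d^{-1}\langle dl\,l^{-1}\wedge[dl\,l^{-1}\wedge dl\,l^{-1}]\rangle+\langle\Lambda|\partial_\sigma l\,l^{-1}\rangle\Big)$$ is invariant in the same sense even for fields that do not satisfy the constraint. -/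

import Mathlib

open scoped Manifold ContDiff
open MeasureTheory

noncomputable section

/-! ### The algebra of a Drinfeld double -/

/-- The structure of the Lie algebra of a Drinfeld double: a non-degenerate symmetric invariant
bilinear form and two complementary isotropic subalgebras (which are then automatically of
half dimension). -/
structure DoubleAlgebra (𝔡 : Type*) [LieRing 𝔡] [LieAlgebra ℝ 𝔡] where
  /-- the bilinear form `⟨·|·⟩` -/
  form : LinearMap.BilinForm ℝ 𝔡
  symm : form.IsSymm
  nondeg : form.Nondegenerate
  invariant : ∀ X Y Z : 𝔡, form ⁅X, Y⁆ Z + form Y ⁅X, Z⁆ = 0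
  /-- the subalgebra `𝒢` -/
  g : LieSubalgebra ℝ 𝔡
  /-- the subalgebra `𝒢̂` -/
  gHat : LieSubalgebra ℝ 𝔡
  isCompl : IsCompl g.toSubmodule gHat.toSubmodule
  isotropic_g : ∀ X ∈ g, ∀ Y ∈ g, form X Y = 0
  isotropic_gHat : ∀ X ∈ gHat, ∀ Y ∈ gHat, form X Y = 0

namespace DoubleAlgebra

section Algebra

variable {𝔡 : Type*} [LieRing 𝔡] [LieAlgebra ℝ 𝔡] (S : DoubleAlgebra 𝔡)

/-- `𝒢` as a linear subspace. -/
abbrev G : Submodule ℝ 𝔡 := S.g.toSubmodule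

/-- `𝒢̂` as a linear subspace. -/
abbrev GHat : Submodule ℝ 𝔡 := S.gHat.toSubmodule

/-- The projector `J` onto `𝒢` with kernel `𝒢̂`. -/
def J : 𝔡 →ₗ[ℝ] 𝔡 := S.G.projection S.GHat S.isCompl

/-- The projector `Ĵ` onto `𝒢̂` with kernel `𝒢`. -/
def JHat : 𝔡 →ₗ[ℝ] 𝔡 := S.GHat.projection S.G S.isCompl.symm

/-- An operator `R : 𝒢̂ → 𝒢`, regarded as the operator `R Ĵ` on the whole algebra. -/
def extend (R : S.GHat →ₗ[ℝ] S.G) : 𝔡 →ₗ[ℝ] 𝔡 :=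
  S.G.subtype ∘ₗ R ∘ₗ S.GHat.projectionOnto S.G S.isCompl.symm

theorem exists_add (X : 𝔡) : ∃ (x : S.G) (a : S.GHat), X = (a : 𝔡) + (x : 𝔡) := by
  obtain ⟨u, v, h, -⟩ := Submodule.existsUnique_add_of_isCompl S.isCompl X
  exact ⟨u, v, by rw [← h, add_comm]⟩

/-- The map `𝒢 → 𝒢̂*`, `y ↦ ⟨·|y⟩`. -/
def toDual : S.G →ₗ[ℝ] Module.Dual ℝ S.GHat where
  toFun y := (S.form (y : 𝔡)).domRestrict S.GHat
  map_add' _ _ := by ext; simp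
  map_smul' _ _ := by ext; simp

/-- The map `𝒢̂ → 𝒢*`, `a ↦ ⟨·|a⟩`. -/
def toDualHat : S.GHat →ₗ[ℝ] Module.Dual ℝ S.G where
  toFun y := (S.form (y : 𝔡)).domRestrict S.G
  map_add' _ _ := by ext; simp
  map_smul' _ _ := by ext; simp

theorem toDual_injective : Function.Injective S.toDual := by
  rw [injective_iff_map_eq_zero]
  intro y hy
  apply Subtype.ext
  apply S.nondeg.1 (y : 𝔡)
  intro X
  obtain ⟨x, a, rfl⟩ := S.exists_add X
  have h1 : S.form y a = 0 := congrArg (fun φ => φ a) hy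
  rw [map_add, h1, S.isotropic_g _ y.2 _ x.2, add_zero]

theorem toDualHat_injective : Function.Injective S.toDualHat := by
  rw [injective_iff_map_eq_zero]
  intro y hy
  apply Subtype.ext
  apply S.nondeg.1 (y : 𝔡)
  intro X
  obtain ⟨x, a, rfl⟩ := S.exists_add X
  have h1 : S.form y x = 0 := congrArg (fun φ => φ x) hy
  rw [map_add, h1, S.isotropic_gHat _ y.2 _ a.2, add_zero]

variable [FiniteDimensional ℝ 𝔡]

theorem toDual_bijective : Function.Bijective S.toDual := by
  refine ⟨S.toDual_injective, ?_⟩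
  have h1 := LinearMap.finrank_le_finrank_of_injective S.toDual_injective
  have h2 := LinearMap.finrank_le_finrank_of_injective S.toDualHat_injective
  rw [Subspace.dual_finrank_eq] at h1 h2
  exact (LinearMap.injective_iff_surjective_of_finrank_eq_finrank
    (by rw [Subspace.dual_finrank_eq]; omega)).1 S.toDual_injective

/-- The adjoint `R* : 𝒢̂ → 𝒢` of `R : 𝒢̂ → 𝒢` with respect to the bilinear form. -/
def adjoint (R : S.GHat →ₗ[ℝ] S.G) : S.GHat →ₗ[ℝ] S.G :=
  (LinearEquiv.ofBijective S.toDual S.toDual_bijective).symm.toLinearMap ∘ₗ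
    { toFun := fun a => ((S.form (a : 𝔡)).domRestrict S.G) ∘ₗ R
      map_add' := fun _ _ => by ext; simp
      map_smul' := fun _ _ => by ext; simp }

theorem form_adjoint (R : S.GHat →ₗ[ℝ] S.G) (a c : S.GHat) :
    S.form (R c : 𝔡) (a : 𝔡) = S.form (c : 𝔡) (S.adjoint R a : 𝔡) := by
  have h : S.toDual (S.adjoint R a) = ((S.form (a : 𝔡)).domRestrict S.G) ∘ₗ R :=
    (LinearEquiv.ofBijective S.toDual S.toDual_bijective).apply_symm_apply _
  have h2 : S.form (S.adjoint R a : 𝔡) c = S.form a (R c) := congrArg (fun φ => φ c) h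
  rw [S.symm.eq, ← h2, S.symm.eq]

/-- The subspace `ℛ = {γ + Rγ : γ ∈ 𝒢̂}`. -/
def rSpace (R : S.GHat →ₗ[ℝ] S.G) : Submodule ℝ 𝔡 :=
  LinearMap.range (S.GHat.subtype + S.G.subtype ∘ₗ R)

/-- The subspace `ℛ^⊥ = {γ - R*γ : γ ∈ 𝒢̂}`. -/
def rPerp (R : S.GHat →ₗ[ℝ] S.G) : Submodule ℝ 𝔡 :=
  LinearMap.range (S.GHat.subtype - S.G.subtype ∘ₗ S.adjoint R)

/-- The subspace `ℱ = {γ + Rγ : γ ∈ Ker (R + R*)}`. -/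
def fSpace (R : S.GHat →ₗ[ℝ] S.G) : Submodule ℝ 𝔡 :=
  (LinearMap.ker (R + S.adjoint R)).map (S.GHat.subtype + S.G.subtype ∘ₗ R)

/-- The orthogonal complement `ℱ^⊥`. -/
def fPerp (R : S.GHat →ₗ[ℝ] S.G) : Submodule ℝ 𝔡 :=
  LinearMap.BilinForm.orthogonal S.form (S.fSpace R)

/-- The map `(α, β) ↦ α + β + Rα - R*β`. -/
def combine (R : S.GHat →ₗ[ℝ] S.G) : S.GHat × S.GHat →ₗ[ℝ] 𝔡 :=
  (S.GHat.subtype + S.G.subtype ∘ₗ R).coprod (S.GHat.subtype - S.G.subtype ∘ₗ S.adjoint R)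

theorem combine_apply (R : S.GHat →ₗ[ℝ] S.G) (a c : S.GHat) :
    S.combine R (a, c) = (a : 𝔡) + c + R a - S.adjoint R c := by
  simp [combine]; abel

theorem range_combine (R : S.GHat →ₗ[ℝ] S.G) : LinearMap.range (S.combine R) = S.fPerp R := by
  have hrefl : S.form.IsRefl := S.symm.isRefl
  apply le_antisymm
  · rintro _ ⟨⟨a, c⟩, rfl⟩
    rintro _ ⟨γ, hγ, rfl⟩
    have hk : (R γ : 𝔡) + S.adjoint R γ = 0 := by
      have := congrArg (Subtype.val) (LinearMap.mem_ker.1 hγ)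
      simpa using this
    have e1 := S.form_adjoint R γ a
    have e2 := S.form_adjoint R c γ
    have e3 : S.form (a : 𝔡) (R γ : 𝔡) + S.form (a : 𝔡) (S.adjoint R γ : 𝔡) = 0 := by
      rw [← map_add, hk, map_zero]
    have i1 := S.isotropic_gHat _ γ.2 _ a.2
    have i2 := S.isotropic_gHat _ γ.2 _ c.2
    have i3 := S.isotropic_g _ (R γ).2 _ (R a).2
    have i4 := S.isotropic_g _ (R γ).2 _ (S.adjoint R c).2
    have s1 := S.symm.eq (γ : 𝔡) (R a : 𝔡)
    have s2 := S.symm.eq (R γ : 𝔡) (a : 𝔡)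
    rw [combine_apply]
    change S.form ((γ : 𝔡) + R γ) ((a : 𝔡) + c + R a - S.adjoint R c) = 0
    simp only [LinearMap.add_apply, map_add, map_sub, i1, i2, i3, i4]
    linarith
  · rw [← LinearMap.BilinForm.orthogonal_orthogonal S.nondeg hrefl (LinearMap.range (S.combine R))]
    apply LinearMap.BilinForm.orthogonal_le
    intro Y hY
    obtain ⟨y, w, rfl⟩ := S.exists_add Y
    have hY' : ∀ a c : S.GHat, S.form (S.combine R (a, c)) ((w : 𝔡) + y) = 0 :=
      fun a c => hY _ ⟨(a, c), rfl⟩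
    have key : ∀ z : S.G, (∀ a : S.GHat, S.form (a : 𝔡) (z : 𝔡) = 0) → z = 0 := by
      intro z hz
      apply S.toDual_injective
      rw [map_zero]
      ext a
      change S.form (z : 𝔡) a = 0
      rw [S.symm.eq]
      exact hz a
    have h1 : y + S.adjoint R w = 0 := by
      apply key
      intro a
      have := hY' a 0
      rw [combine_apply] at this
      have i1 := S.isotropic_gHat _ a.2 _ w.2
      have i2 := S.isotropic_g _ (R a).2 _ y.2
      have e := S.form_adjoint R w a
      simp only [map_zero, ZeroMemClass.coe_zero, add_zero, sub_zero, map_add,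
        LinearMap.add_apply, i1, i2] at this
      rw [Submodule.coe_add, map_add]
      linarith
    have h2 : y - R w = 0 := by
      apply key
      intro c
      have := hY' 0 c
      rw [combine_apply] at this
      have i1 := S.isotropic_gHat _ c.2 _ w.2
      have i2 := S.isotropic_g _ (S.adjoint R c).2 _ y.2
      have e := S.form_adjoint R c w
      have s1 := S.symm.eq (S.adjoint R c : 𝔡) (w : 𝔡)
      have s2 := S.symm.eq (R w : 𝔡) (c : 𝔡)
      simp only [map_zero, ZeroMemClass.coe_zero, add_zero, zero_add, map_add, map_sub,
        LinearMap.sub_apply, i1, i2] at this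
      rw [Submodule.coe_sub, map_sub]
      linarith
    have h3 : y = R w := sub_eq_zero.1 h2
    refine ⟨w, ?_, ?_⟩
    · change (R + S.adjoint R) w = 0
      rw [LinearMap.add_apply, ← h3, h1]
    · simp [h3]

/-- There are linear operators `α₊, α₋ : ℱ^⊥ → 𝒢̂` with
`X = α₊(X) + α₋(X) + Rα₊(X) - R*α₋(X)` for all `X ∈ ℱ^⊥`. -/
theorem exists_alpha (R : S.GHat →ₗ[ℝ] S.G) :
    ∃ α : (S.fPerp R →ₗ[ℝ] S.GHat) × (S.fPerp R →ₗ[ℝ] S.GHat), ∀ X : S.fPerp R,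
      (X : 𝔡) = (α.1 X : 𝔡) + α.2 X + R (α.1 X) - S.adjoint R (α.2 X) := by
  have hmem : ∀ p, S.combine R p ∈ S.fPerp R := fun p => by
    rw [← range_combine]; exact ⟨p, rfl⟩
  obtain ⟨s, hs⟩ := LinearMap.exists_rightInverse_of_surjective
    ((S.combine R).codRestrict (S.fPerp R) hmem) (by
      rw [LinearMap.range_eq_top]
      rintro ⟨X, hX⟩
      rw [← range_combine] at hX
      obtain ⟨p, hp⟩ := hX
      exact ⟨p, Subtype.ext hp⟩)
  refine ⟨(LinearMap.fst ℝ _ _ ∘ₗ s, LinearMap.snd ℝ _ _ ∘ₗ s), fun X => ?_⟩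
  have h := congrArg Subtype.val (LinearMap.congr_fun hs X)
  rw [← combine_apply]
  exact h.symm

/-- A choice of `α₊ : ℱ^⊥ → 𝒢̂`. -/
def alphaPlus (R : S.GHat →ₗ[ℝ] S.G) : S.fPerp R →ₗ[ℝ] S.GHat :=
  (Classical.choose (S.exists_alpha R)).1

/-- A choice of `α₋ : ℱ^⊥ → 𝒢̂`. -/
def alphaMinus (R : S.GHat →ₗ[ℝ] S.G) : S.fPerp R →ₗ[ℝ] S.GHat :=
  (Classical.choose (S.exists_alpha R)).2

theorem alpha_spec (R : S.GHat →ₗ[ℝ] S.G) (X : S.fPerp R) :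
    (X : 𝔡) = (S.alphaPlus R X : 𝔡) + S.alphaMinus R X + R (S.alphaPlus R X)
      - S.adjoint R (S.alphaMinus R X) :=
  Classical.choose_spec (S.exists_alpha R) X

open Classical in
/-- The quadratic form `K(X) = 2⟨α₊(X)|Rα₊(X)⟩ + 2⟨α₋(X)|Rα₋(X)⟩` on `ℱ^⊥`
(with the irrelevant value `0` outside `ℱ^⊥`). -/
def K (R : S.GHat →ₗ[ℝ] S.G) (X : 𝔡) : ℝ :=
  if h : X ∈ S.fPerp R then
    2 * S.form (S.alphaPlus R ⟨X, h⟩ : 𝔡) (R (S.alphaPlus R ⟨X, h⟩) : 𝔡)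
      + 2 * S.form (S.alphaMinus R ⟨X, h⟩ : 𝔡) (R (S.alphaMinus R ⟨X, h⟩) : 𝔡)
  else 0

/-- The value of `K` does not depend on the choice of the decomposition. -/
theorem K_eq (R : S.GHat →ₗ[ℝ] S.G) (a c : S.GHat) :
    S.K R ((a : 𝔡) + c + R a - S.adjoint R c)
      = 2 * S.form (a : 𝔡) (R a : 𝔡) + 2 * S.form (c : 𝔡) (R c : 𝔡) := by
  have hX : (a : 𝔡) + c + R a - S.adjoint R c ∈ S.fPerp R := by
    rw [← range_combine, ← combine_apply]; exact ⟨_, rfl⟩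
  rw [K, dif_pos hX]
  have hs := S.alpha_spec R ⟨_, hX⟩
  set p := S.alphaPlus R ⟨_, hX⟩
  set q := S.alphaMinus R ⟨_, hX⟩
  clear_value p q
  simp only at hs
  have h1 : ((a + c - p - q : S.GHat) : 𝔡)
      = ((R p - S.adjoint R q - R a + S.adjoint R c : S.G) : 𝔡) := by
    simp only [Submodule.coe_sub, Submodule.coe_add]
    rw [← sub_eq_zero] at hs ⊢
    rw [← hs]; abel
  have h2 : ((a + c - p - q : S.GHat) : 𝔡) = 0 :=
    Submodule.disjoint_def.1 S.isCompl.disjoint _ (by rw [h1]; exact Subtype.prop _)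
      (Subtype.prop _)
  rw [h2] at h1
  have h3 : R p - S.adjoint R q - R a + S.adjoint R c = 0 := Subtype.ext h1.symm
  have h4 : a + c - p - q = 0 := Subtype.ext h2
  obtain ⟨d, rfl⟩ : ∃ d, p = a + d := ⟨p - a, by abel⟩
  obtain rfl : q = c - d := by
    rw [← sub_eq_zero] at h4 ⊢
    rw [sub_zero] at h4
    rw [← neg_eq_zero, ← h4]; abel
  have h5 : (R d : 𝔡) + S.adjoint R d = 0 := by
    have : R d + S.adjoint R d = 0 := by
      rw [map_add, map_sub] at h3
      rw [← h3]; abel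
    simpa using congrArg Subtype.val this
  have t : ∀ z : S.GHat, S.form (z : 𝔡) (R d : 𝔡) + S.form (d : 𝔡) (R z : 𝔡) = 0 := by
    intro z
    rw [S.symm.eq (d : 𝔡), S.form_adjoint, ← map_add, h5, map_zero]
  have ta := t a
  have tc := t c
  have td := t d
  simp only [map_add, map_sub, Submodule.coe_add, Submodule.coe_sub, LinearMap.add_apply,
    LinearMap.sub_apply]
  linarith

/-- The condition `J Ad Ĵ + J [Ad, R] Ĵ = R Ad R` on an operator `A` (`= Ad_f`), an identity
of operators on the whole algebra, with `R` extended by zero on `𝒢`. -/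
def DressingCondition (R : S.GHat →ₗ[ℝ] S.G) (A : 𝔡 →ₗ[ℝ] 𝔡) : Prop :=
  S.J ∘ₗ A ∘ₗ S.JHat + S.J ∘ₗ (A ∘ₗ S.extend R - S.extend R ∘ₗ A) ∘ₗ S.JHat
    = S.extend R ∘ₗ A ∘ₗ S.extend R

end Algebra
end DoubleAlgebra

/-! ### Lie groups -/

section LieGroups

instance instLEInftyMinSmoothnessThree : ENat.LEInfty (minSmoothness ℝ 3) :=
  ⟨by rw [minSmoothness_of_isRCLikeNormedField]; exact ENat.LEInfty.out⟩

variable {m : ℕ} {D : Type*} [TopologicalSpace D] [ChartedSpace (EuclideanSpace ℝ (Fin m)) D]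

instance instFiniteDimensionalGroupLieAlgebra [Group D] :
    FiniteDimensional ℝ (GroupLieAlgebra (𝓡 m) D) :=
  inferInstanceAs (FiniteDimensional ℝ (EuclideanSpace ℝ (Fin m)))

variable [Group D]

/-- The adjoint action `Ad_d` on the Lie algebra: the derivative at `1` of `x ↦ d x d⁻¹`. -/
def Ad (d : D) : GroupLieAlgebra (𝓡 m) D →ₗ[ℝ] GroupLieAlgebra (𝓡 m) D :=
  (mfderiv (𝓡 m) (𝓡 m) (fun x : D => d * x * d⁻¹) 1).toLinearMap

/-- The differential at `1` of a homomorphism of Lie groups. -/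
def lieDifferential {k : ℕ} {F : Type*} [TopologicalSpace F]
    [ChartedSpace (EuclideanSpace ℝ (Fin k)) F] [Group F] (ι : F →* D) :
    GroupLieAlgebra (𝓡 k) F →ₗ[ℝ] GroupLieAlgebra (𝓡 m) D :=
  (mfderiv (𝓡 k) (𝓡 m) ι 1).toLinearMap

/-- `ι : F → D` exhibits the Lie group `F` as an (immersed) Lie subgroup of `D` whose Lie algebra
is the subspace `𝔣` of the Lie algebra of `D`. -/
structure IsLieSubgroup {k : ℕ} {F : Type*} [TopologicalSpace F]
    [ChartedSpace (EuclideanSpace ℝ (Fin k)) F] [Group F] (ι : F →* D)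
    (𝔣 : Submodule ℝ (GroupLieAlgebra (𝓡 m) D)) : Prop where
  smooth : ContMDiff (𝓡 k) (𝓡 m) ∞ ι
  injective : Function.Injective ι
  immersion : Function.Injective (lieDifferential (m := m) (k := k) ι)
  range_eq : LinearMap.range (lieDifferential (m := m) (k := k) ι) = 𝔣

/-- For a map `l` from the world-sheet `ℝ²` to `D`, the value `(∂_v l) l⁻¹` at `x` of the pulled
back right-invariant Maurer-Cartan form on the vector `v`. -/
def maurerCartan (l : ℝ × ℝ → D) (x v : ℝ × ℝ) : GroupLieAlgebra (𝓡 m) D :=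
  (mfderiv 𝓘(ℝ, ℝ × ℝ) (𝓡 m) (fun y => l y * (l x)⁻¹) x : ℝ × ℝ →L[ℝ] _) v

/-- `∂_σ l l⁻¹`; a point of the world-sheet is a pair `(σ, τ)`. -/
def dSigma (l : ℝ × ℝ → D) (x : ℝ × ℝ) : GroupLieAlgebra (𝓡 m) D := maurerCartan l x (1, 0)

/-- `∂_τ l l⁻¹`. -/
def dTau (l : ℝ × ℝ → D) (x : ℝ × ℝ) : GroupLieAlgebra (𝓡 m) D := maurerCartan l x (0, 1)

/-- The derivative at `d` of a function on `D` along the right-invariant vector field with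
value `X` at `1`. -/
def rightDeriv (φ : D → ℝ) (X : GroupLieAlgebra (𝓡 m) D) (d : D) : ℝ :=
  (mfderiv (𝓡 m) 𝓘(ℝ, ℝ) (fun x : D => φ (x * d)) 1 : GroupLieAlgebra (𝓡 m) D →L[ℝ] ℝ) X

variable [LieGroup (𝓡 m) ∞ D]

/-- The value `[θ ∧ θ](X, Y) = [X, Y] - [Y, X]` for the right-invariant Maurer-Cartan form `θ`,
on right-invariant vector fields. -/
def bracketWedge (X Y : GroupLieAlgebra (𝓡 m) D) : GroupLieAlgebra (𝓡 m) D := ⁅X, Y⁆ - ⁅Y, X⁆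

/-- The right-invariant 3-form `⟨θ ∧ [θ ∧ θ]⟩` on `D`, on the right-invariant vector fields
given by `X`, `Y`, `Z`. -/
def wzForm (S : DoubleAlgebra (GroupLieAlgebra (𝓡 m) D)) (X Y Z : GroupLieAlgebra (𝓡 m) D) : ℝ :=
  S.form X (bracketWedge Y Z) + S.form Y (bracketWedge Z X) + S.form Z (bracketWedge X Y)

/-- `b` is a smooth 2-form on `D` with `d b = ⟨θ ∧ [θ ∧ θ]⟩`, i.e. `b = d⁻¹⟨θ ∧ [θ ∧ θ]⟩`. A 2-form
is described in the right-invariant frame: `b d X Y` is its value on the tangent vectors at `d`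
that are the right translates of `X` and `Y`. The exterior derivative is the usual invariant
formula, in which the bracket of the right-invariant vector fields of `X` and `Y` is the
right-invariant vector field of `-[X, Y]`. -/
structure IsPotential (S : DoubleAlgebra (GroupLieAlgebra (𝓡 m) D))
    (b : D → LinearMap.BilinForm ℝ (GroupLieAlgebra (𝓡 m) D)) : Prop where
  smooth : ∀ X Y, ContMDiff (𝓡 m) 𝓘(ℝ, ℝ) ∞ (fun d => b d X Y)
  alt : ∀ d X, b d X X = 0
  deriv_eq : ∀ d X Y Z,
    rightDeriv (fun d' => b d' Y Z) X d + rightDeriv (fun d' => b d' Z X) Y d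
      + rightDeriv (fun d' => b d' X Y) Z d
      + b d ⁅X, Y⁆ Z + b d ⁅Y, Z⁆ X + b d ⁅Z, X⁆ Y = wzForm S X Y Z

/-- The density `⟨∂_τ l l⁻¹|∂_σ l l⁻¹⟩ + (1/6) d⁻¹⟨dl l⁻¹ ∧ [dl l⁻¹ ∧ dl l⁻¹]⟩`; a 2-form on the
world-sheet is identified with its value on `(∂_σ, ∂_τ)`. -/
def wzwDensity (S : DoubleAlgebra (GroupLieAlgebra (𝓡 m) D))
    (b : D → LinearMap.BilinForm ℝ (GroupLieAlgebra (𝓡 m) D)) (l : ℝ × ℝ → D) (x : ℝ × ℝ) : ℝ :=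
  S.form (dTau l x) (dSigma l x) + (1 / 6) * b (l x) (dSigma l x) (dTau l x)

/-- The Lagrangian density of the first-order action. -/
def lagrangian (S : DoubleAlgebra (GroupLieAlgebra (𝓡 m) D)) (R : S.GHat →ₗ[ℝ] S.G)
    (b : D → LinearMap.BilinForm ℝ (GroupLieAlgebra (𝓡 m) D))
    (l : ℝ × ℝ → D) (Λ : ℝ × ℝ → GroupLieAlgebra (𝓡 m) D) (x : ℝ × ℝ) : ℝ :=
  (1 / 2) * (wzwDensity S b l x + S.K R (dSigma l x) + S.form (Λ x) (dSigma l x))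

/-- Smooth fields: `l` is `D`-valued and `Λ` is `ℱ`-valued. -/
structure IsWorldSheetField (S : DoubleAlgebra (GroupLieAlgebra (𝓡 m) D)) (R : S.GHat →ₗ[ℝ] S.G)
    (l : ℝ × ℝ → D) (Λ : ℝ × ℝ → GroupLieAlgebra (𝓡 m) D) : Prop where
  smooth_l : ContMDiff 𝓘(ℝ, ℝ × ℝ) (𝓡 m) ∞ l
  smooth_Λ : ContDiff ℝ ∞ (F := EuclideanSpace ℝ (Fin m)) Λ
  mem : ∀ x, Λ x ∈ S.fSpace R

/-- The constraint `∂_σ l l⁻¹ ∈ ℱ^⊥` imposed by the Lagrange multiplier. -/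
def IsConstrained (S : DoubleAlgebra (GroupLieAlgebra (𝓡 m) D)) (R : S.GHat →ₗ[ℝ] S.G)
    (l : ℝ × ℝ → D) : Prop :=
  ∀ x, dSigma l x ∈ S.fPerp R

/-- The gauge transform `f l` of `l`. -/
def gaugeField (f l : ℝ × ℝ → D) : ℝ × ℝ → D := fun x => f x * l x

/-- The gauge transform `f Λ f⁻¹ - ∂_τ f f⁻¹` of the Lagrange multiplier. -/
def gaugeMultiplier (f : ℝ × ℝ → D) (Λ : ℝ × ℝ → GroupLieAlgebra (𝓡 m) D) (x : ℝ × ℝ) :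
    GroupLieAlgebra (𝓡 m) D :=
  Ad (f x) (Λ x) - dTau f x

/-- The density `½ (⟨∂_τ l l⁻¹|∂_σ l l⁻¹⟩ + (1/6) d⁻¹⟨dl l⁻¹ ∧ [dl l⁻¹ ∧ dl l⁻¹]⟩) + ⟨Λ|∂_σ l l⁻¹⟩`,
which makes sense without the constraint. -/
def unconstrainedDensity (S : DoubleAlgebra (GroupLieAlgebra (𝓡 m) D))
    (b : D → LinearMap.BilinForm ℝ (GroupLieAlgebra (𝓡 m) D))
    (l : ℝ × ℝ → D) (Λ : ℝ × ℝ → GroupLieAlgebra (𝓡 m) D) (x : ℝ × ℝ) : ℝ :=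
  (1 / 2) * wzwDensity S b l x + S.form (Λ x) (dSigma l x)

end LieGroups

/-- The action over the region `W` of the world-sheet with density `L`. -/
def action (W : Set (ℝ × ℝ)) (L : ℝ × ℝ → ℝ) : ℝ := ∫ x in W, L x

/-- If the action over `W` with density `L` converges, then so does the one with density `L'`, and
the two are equal. -/
def SameAction (W : Set (ℝ × ℝ)) (L L' : ℝ × ℝ → ℝ) : Prop :=
  IntegrableOn L W → IntegrableOn L' W ∧ action W L' = action W L

end

/-!
A gauge transformation `l ↦ h l` changes the density by `1/12` of the 2-form
`(h l)^* b - l^* b + 6 ⟨dh h⁻¹ ∧ Ad_h (dl l⁻¹)⟩`, because `ℱ` is isotropic and the dressing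
condition says that `Ad_f` preserves the graph `ℛ` of `R`; being an isometry, `Ad_f` then preserves
`ℛ^⊥`, `ℱ = ℛ ∩ ℛ^⊥`, `ℱ^⊥ = ℛ + ℛ^⊥` and `K`. Isotropy of `ℱ` makes the 2-form closed, so the
homotopy `l(t x)` reduces its integral over the plane to that of the pullback of `b` by `h l(0)`.

That pullback is closed on any manifold mapped to `D` through the gauge group. With `f` moved into
the unit square and extended periodically, take it along the product
`f(x₁) ⋯ f(x_N) : 𝕋^{2N} → F`. Each of the `N` coordinate planes contributes the same integral `c`,
and Poincaré duality gives a nonzero multiple of `c^N` for the integral of the top exterior power.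
Since the 2-form has rank at most `dim D`, that power vanishes as soon as `2N > dim D`, and
therefore `c = 0`.
-/

noncomputable section

open scoped Topology

/-- The model space of an `m`-dimensional Lie group, underlying its Lie algebra. The type
`GroupLieAlgebra` is a tangent space and carries no norm, so calculus with Lie algebra valued
functions is done in `Vec m`. -/
abbrev Vec (m : ℕ) := EuclideanSpace ℝ (Fin m)

section ChartMul

variable {m : ℕ} (D : Type*) [TopologicalSpace D] [ChartedSpace (EuclideanSpace ℝ (Fin m)) D]
  [Group D]

/-- The preferred chart of a Lie group at the identity. -/
abbrev oneChart : PartialEquiv D (Vec m) := extChartAt (𝓡 m) (1 : D)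

/-- The coordinates of the identity in the chart at the identity. -/
def chartOne : Vec m := oneChart D 1

/-- The multiplication of a Lie group, read in the chart at the identity. -/
def chartMul (p : Vec m × Vec m) : Vec m :=
  oneChart D ((oneChart D).symm p.1 * (oneChart D).symm p.2)

/-- The left-invariant vector field with value `v` at the identity, read in the chart at the
identity. -/
def chartLeftInvariant (v a : Vec m) : Vec m :=
  fderiv ℝ (fun b => chartMul D (a, b)) (chartOne D) v

@[simp]
theorem oneChart_symm_chartOne : (oneChart D).symm (chartOne (m := m) D) = 1 := by
  simp [chartOne]

theorem eventually_mem_oneChart_target :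
    ∀ᶠ a : Vec m in 𝓝 (chartOne D), a ∈ (oneChart D).target :=
  (isOpen_extChartAt_target (I := 𝓡 m) (1 : D)).mem_nhds (mem_extChartAt_target 1)

theorem chartMul_chartOne_right :
    ∀ᶠ a : Vec m in 𝓝 (chartOne D), chartMul D (a, chartOne D) = a := by
  filter_upwards [eventually_mem_oneChart_target D] with a ha
  simp only [chartMul, oneChart_symm_chartOne, mul_one]
  exact (oneChart D).right_inv ha

theorem chartMul_chartOne_left :
    ∀ᶠ a : Vec m in 𝓝 (chartOne D), chartMul D (chartOne D, a) = a := by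
  filter_upwards [eventually_mem_oneChart_target D] with a ha
  simp only [chartMul, oneChart_symm_chartOne, one_mul]
  exact (oneChart D).right_inv ha

@[simp]
theorem chartLeftInvariant_chartOne (w : Vec m) : chartLeftInvariant D w (chartOne D) = w := by
  rw [chartLeftInvariant, Filter.EventuallyEq.fderiv_eq
    (f₁ := fun b => chartMul D (chartOne D, b)) (f := id) (chartMul_chartOne_left D)]
  simp

variable [LieGroup (𝓡 m) ∞ D]

/-- The Lie bracket of the Lie algebra of a Lie group, as a continuous bilinear map. -/
def bracketCLM : Vec m →L[ℝ] Vec m →L[ℝ] Vec m :=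
  let L := GroupLieAlgebra (𝓡 m) D
  let bracket : L →ₗ[ℝ] L →ₗ[ℝ] L :=
    LinearMap.mk₂ ℝ (fun X Y => ⁅X, Y⁆) add_lie smul_lie lie_add lie_smul
  LinearMap.toContinuousBilinearMap (bracket : Vec m →ₗ[ℝ] Vec m →ₗ[ℝ] Vec m)

variable {D} in
theorem contMDiffAt_oneChart {d : D} (hd : d ∈ (oneChart (m := m) D).source) :
    ContMDiffAt (𝓡 m) 𝓘(ℝ, Vec m) ∞ (oneChart (m := m) D) d :=
  contMDiffAt_extChartAt' (by simpa using hd)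

theorem contDiffAt_chartMul : ContDiffAt ℝ ∞ (chartMul (m := m) D) (chartOne D, chartOne D) := by
  have hsymm : ContMDiffAt 𝓘(ℝ, Vec m) (𝓡 m) ∞ (oneChart D).symm (chartOne D) :=
    (contMDiffOn_extChartAt_symm (1 : D)).contMDiffAt (eventually_mem_oneChart_target D)
  rw [← contMDiffAt_iff_contDiffAt]
  have hmem : (oneChart D).symm (chartOne (m := m) D) * (oneChart D).symm (chartOne (m := m) D) ∈
      (oneChart (m := m) D).source := by
    rw [oneChart_symm_chartOne, mul_one]
    exact mem_extChartAt_source 1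
  refine (contMDiffAt_oneChart hmem).comp (chartOne D, chartOne D) (ContMDiffAt.mul ?_ ?_)
  · exact ContMDiffAt.comp (g := (oneChart D).symm) _ hsymm contDiff_fst.contMDiff.contMDiffAt
  · exact ContMDiffAt.comp (g := (oneChart D).symm) _ hsymm contDiff_snd.contMDiff.contMDiffAt

theorem eventually_differentiableAt_chartMul :
    ∀ᶠ p in 𝓝 (chartOne (m := m) D, chartOne D), DifferentiableAt ℝ (chartMul D) p :=
  ((contDiffAt_chartMul D).of_le (m := 1) (by simp)).eventually (by simp) |>.mono
    fun _ hp => hp.differentiableAt (by simp)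

theorem hasFDerivAt_chartMul :
    HasFDerivAt (chartMul D) (fderiv ℝ (chartMul (m := m) D) (chartOne D, chartOne D))
      (chartOne D, chartOne D) :=
  ((contDiffAt_chartMul D).differentiableAt (by simp)).hasFDerivAt

theorem hasFDerivAt_fderiv_chartMul :
    HasFDerivAt (fderiv ℝ (chartMul D))
      (fderiv ℝ (fderiv ℝ (chartMul (m := m) D)) (chartOne D, chartOne D))
      (chartOne D, chartOne D) :=
  (((contDiffAt_chartMul D).fderiv_right (m := ∞) (by simp)).differentiableAt
    (by simp)).hasFDerivAt

theorem fderiv_chartMul_inl (w : Vec m) :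
    fderiv ℝ (chartMul D) (chartOne D, chartOne D) (w, 0) = w := by
  have hcomp := (hasFDerivAt_chartMul D).comp (f := fun a => (a, chartOne (m := m) D))
    (chartOne D) (hasFDerivAt_prodMk_left _ _)
  have hid := (hasFDerivAt_id (𝕜 := ℝ) (chartOne D)).congr_of_eventuallyEq
    (chartMul_chartOne_right (m := m) D)
  simpa using DFunLike.congr_fun (hcomp.unique hid) w

theorem fderiv_chartMul_inr (w : Vec m) :
    fderiv ℝ (chartMul D) (chartOne D, chartOne D) (0, w) = w := by
  have hcomp := (hasFDerivAt_chartMul D).comp (f := fun a => (chartOne (m := m) D, a))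
    (chartOne D) (hasFDerivAt_prodMk_right _ _)
  have hid := (hasFDerivAt_id (𝕜 := ℝ) (chartOne D)).congr_of_eventuallyEq
    (chartMul_chartOne_left (m := m) D)
  simpa using DFunLike.congr_fun (hcomp.unique hid) w

theorem isSymmSndFDerivAt_chartMul :
    IsSymmSndFDerivAt ℝ (chartMul (m := m) D) (chartOne D, chartOne D) :=
  (contDiffAt_chartMul D).isSymmSndFDerivAt
    (by rw [minSmoothness_of_isRCLikeNormedField]; exact ENat.LEInfty.out)

theorem chartLeftInvariant_eventuallyEq (w : Vec m) :
    chartLeftInvariant D w =ᶠ[𝓝 (chartOne D)]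
      fun a => fderiv ℝ (chartMul D) (a, chartOne D) (0, w) := by
  have htendsto : Filter.Tendsto (fun a => (a, chartOne (m := m) D)) (𝓝 (chartOne D))
      (𝓝 (chartOne (m := m) D, chartOne (m := m) D)) := Continuous.tendsto (by fun_prop) _
  filter_upwards [htendsto.eventually (eventually_differentiableAt_chartMul D)] with a ha
  have hcomp := ha.hasFDerivAt.comp (f := fun b => (a, b)) (chartOne D)
    (hasFDerivAt_prodMk_right a (chartOne (m := m) D))
  simpa [Function.comp_def, chartLeftInvariant] using DFunLike.congr_fun hcomp.fderiv w

theorem fderiv_chartLeftInvariant (w v : Vec m) :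
    fderiv ℝ (chartLeftInvariant D w) (chartOne D) v =
      fderiv ℝ (fderiv ℝ (chartMul D)) (chartOne D, chartOne D) (v, 0) (0, w) := by
  rw [(chartLeftInvariant_eventuallyEq D w).fderiv_eq]
  have hcomp := (hasFDerivAt_fderiv_chartMul D).comp (f := fun a => (a, chartOne (m := m) D))
    (chartOne D) (hasFDerivAt_prodMk_left _ _)
  simpa [Function.comp_def] using DFunLike.congr_fun
    (hcomp.clm_apply (hasFDerivAt_const ((0, w) : Vec m × Vec m) (chartOne D))).fderiv v

theorem mpullbackWithin_mulInvariantVectorField_eventuallyEq (v : Vec m) :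
    VectorField.mpullbackWithin 𝓘(ℝ, Vec m) (𝓡 m) (oneChart D).symm
        (mulInvariantVectorField (v : GroupLieAlgebra (𝓡 m) D)) (Set.range (𝓡 m))
      =ᶠ[𝓝 (chartOne D)] chartLeftInvariant D v := by
  filter_upwards [eventually_mem_oneChart_target D] with a ha
  rw [VectorField.mpullbackWithin_apply, ContinuousLinearMap.inverse_eq
    (mfderivWithin_extChartAt_symm_comp_mfderiv_extChartAt (I := 𝓡 m) ha)
    (mfderiv_extChartAt_comp_mfderivWithin_extChartAt_symm (I := 𝓡 m) ha)]
  have hchart : MDifferentiableAt (𝓡 m) 𝓘(ℝ, Vec m) (oneChart D) ((oneChart D).symm a * 1) :=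
    (contMDiffAt_oneChart (by simpa using (oneChart D).map_target ha)).mdifferentiableAt (by simp)
  have hmul : MDifferentiableAt (𝓡 m) (𝓡 m) (fun b : D => (oneChart D).symm a * b) 1 :=
    (contMDiff_mul_left (n := ∞)).mdifferentiableAt (by simp)
  have hcomp := (hchart.hasMFDerivAt.comp (1 : D) hmul.hasMFDerivAt).2
  simp only [writtenInExtChartAt, modelWithCornersSelf_coe, Set.range_id,
    extChartAt_model_space_eq_id, PartialEquiv.refl_coe, id, Function.comp_def] at hcomp
  have hfderiv : fderiv ℝ (fun b => chartMul D (a, b)) (chartOne D) =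
      (show Vec m →L[ℝ] Vec m from
        (mfderiv (𝓡 m) 𝓘(ℝ, Vec m) (oneChart D) ((oneChart D).symm a * 1)).comp
          (mfderiv (𝓡 m) (𝓡 m) (fun b : D => (oneChart D).symm a * b) 1)) :=
    HasFDerivAt.fderiv (hasFDerivWithinAt_univ.1 hcomp)
  rw [chartLeftInvariant, hfderiv, mul_one]
  rfl

theorem lie_eq_lieBracket_chartLeftInvariant (v w : GroupLieAlgebra (𝓡 m) D) :
    (⁅v, w⁆ : GroupLieAlgebra (𝓡 m) D) =
      VectorField.lieBracket ℝ (chartLeftInvariant D v) (chartLeftInvariant D w) (chartOne D) := by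
  rw [GroupLieAlgebra.bracket_def, ← VectorField.mlieBracketWithin_univ,
    VectorField.mlieBracketWithin_apply,
    congrArg ContinuousLinearMap.inverse (mfderiv_extChartAt_self (I := 𝓡 m) (x := (1 : D))),
    show (oneChart D).symm ⁻¹' Set.univ ∩ Set.range (𝓡 m) = Set.univ by simp]
  refine (DFunLike.congr_fun (ContinuousLinearMap.inverse_id (R := ℝ) (M := Vec m)) _).trans ?_
  refine Eq.trans ?_ (Filter.EventuallyEq.lieBracket_vectorField_eq
    (mpullbackWithin_mulInvariantVectorField_eventuallyEq D v)
    (mpullbackWithin_mulInvariantVectorField_eventuallyEq D w))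
  exact congrFun (VectorField.lieBracketWithin_univ (𝕜 := ℝ) (E := Vec m)) (chartOne D)

theorem bracketCLM_eq_fderiv (v w : Vec m) :
    bracketCLM D v w = fderiv ℝ (fderiv ℝ (chartMul D)) (chartOne D, chartOne D) (v, 0) (0, w)
      - fderiv ℝ (fderiv ℝ (chartMul D)) (chartOne D, chartOne D) (w, 0) (0, v) := by
  refine (lie_eq_lieBracket_chartLeftInvariant D v w).trans ?_
  simp only [VectorField.lieBracket, chartLeftInvariant_chartOne, fderiv_chartLeftInvariant]
  rfl

end ChartMul

section MaurerCartanForm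

variable {m : ℕ} {D : Type*} [TopologicalSpace D] [ChartedSpace (EuclideanSpace ℝ (Fin m)) D]
  [Group D] {E E' : Type*} [NormedAddCommGroup E] [NormedSpace ℝ E] [NormedAddCommGroup E']
  [NormedSpace ℝ E'] {Φ Ψ : E → D} {x : E}

/-- The pullback `dΦ Φ⁻¹` of the right-invariant Maurer-Cartan form along a map `Φ` from a normed
space to a Lie group. -/
def mcForm (Φ : E → D) (x : E) : E →L[ℝ] Vec m :=
  mfderiv 𝓘(ℝ, E) (𝓡 m) (fun y => Φ y * (Φ x)⁻¹) x

theorem mcForm_mul_const (Φ : E → D) (d : D) (x : E) :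
    mcForm (m := m) (fun y => Φ y * d) x = mcForm Φ x := by
  have hquot : (fun y => Φ y * d * (Φ x * d)⁻¹) = fun y => Φ y * (Φ x)⁻¹ := by
    simp only [mul_inv_rev, mul_assoc, mul_inv_cancel_left]
  exact congrArg (fun f : E → D => show E →L[ℝ] Vec m from mfderiv 𝓘(ℝ, E) (𝓡 m) f x) hquot

variable [LieGroup (𝓡 m) ∞ D]

theorem hasFDerivAt_mcForm (hΦ : MDifferentiableAt 𝓘(ℝ, E) (𝓡 m) Φ x) :
    HasFDerivAt (fun y => oneChart D (Φ y * (Φ x)⁻¹)) (mcForm (m := m) Φ x) x := by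
  have hmul : MDifferentiableAt 𝓘(ℝ, E) (𝓡 m) (fun y => Φ y * (Φ x)⁻¹) x :=
    ((contMDiff_mul_right (I := 𝓡 m) (n := ∞)).mdifferentiableAt (by simp)).comp x hΦ
  have hwritten := hmul.hasMFDerivAt.2
  simp only [writtenInExtChartAt, mul_inv_cancel, modelWithCornersSelf_coe, Set.range_id,
    extChartAt_model_space_eq_id, PartialEquiv.refl_coe, PartialEquiv.refl_symm, id,
    Function.comp_def] at hwritten
  exact hasFDerivWithinAt_univ.1 hwritten

theorem mcForm_const (d : D) (x : E) : mcForm (m := m) (fun _ : E => d) x = 0 :=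
  (hasFDerivAt_mcForm mdifferentiableAt_const).unique (hasFDerivAt_const _ _)

theorem mcForm_congr (h : Φ =ᶠ[𝓝 x] Ψ) (hΦ : MDifferentiableAt 𝓘(ℝ, E) (𝓡 m) Φ x) :
    mcForm (m := m) Φ x = mcForm Ψ x := by
  refine (hasFDerivAt_mcForm hΦ).unique
    ((hasFDerivAt_mcForm (h.mdifferentiableAt_iff.1 hΦ)).congr_of_eventuallyEq ?_)
  rw [h.eq_of_nhds]
  filter_upwards [h] with y hy
  rw [hy]

theorem mcForm_comp {g : E' → E} {x : E'} (hΦ : MDifferentiableAt 𝓘(ℝ, E) (𝓡 m) Φ (g x))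
    (hg : DifferentiableAt ℝ g x) :
    mcForm (m := m) (fun y => Φ (g y)) x = (mcForm Φ (g x)).comp (fderiv ℝ g x) :=
  (hasFDerivAt_mcForm (hΦ.comp x hg.mdifferentiableAt)).unique
    ((hasFDerivAt_mcForm hΦ).comp x hg.hasFDerivAt)

theorem contDiffAt_oneChart_mul_inv (hΦ : ContMDiff 𝓘(ℝ, E) (𝓡 m) ∞ Φ) (x : E) :
    ContDiffAt ℝ ∞ (fun p : E × E => oneChart (m := m) D (Φ p.2 * (Φ p.1)⁻¹)) (x, x) := by
  have hdiv : ContMDiff 𝓘(ℝ, E × E) (𝓡 m) ∞ (fun p : E × E => Φ p.2 * (Φ p.1)⁻¹) :=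
    (hΦ.comp contDiff_snd.contMDiff).mul (hΦ.comp contDiff_fst.contMDiff).inv
  rw [← contMDiffAt_iff_contDiffAt]
  exact ContMDiffAt.comp (I' := 𝓡 m) (x, x) (contMDiffAt_oneChart (by simp)) hdiv.contMDiffAt

theorem contDiff_mcForm (hΦ : ContMDiff 𝓘(ℝ, E) (𝓡 m) ∞ Φ) :
    ContDiff ℝ ∞ (mcForm (m := m) Φ) := by
  let q (p : E × E) : Vec m := oneChart D (Φ p.2 * (Φ p.1)⁻¹)
  have hmcForm : mcForm Φ = fun x => (fderiv ℝ q (x, x)).comp (ContinuousLinearMap.inr ℝ E E) := by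
    ext1 x
    refine (hasFDerivAt_mcForm (hΦ.mdifferentiableAt (by simp))).unique ?_
    exact ((contDiffAt_oneChart_mul_inv hΦ x).differentiableAt (by simp)).hasFDerivAt.comp
      (f := fun y => (x, y)) x (hasFDerivAt_prodMk_right x x)
  rw [hmcForm, contDiff_iff_contDiffAt]
  intro x
  have hfderiv := (contDiffAt_oneChart_mul_inv hΦ x).fderiv_right (m := ∞) (by simp)
  exact (hfderiv.comp (f := fun y : E => (y, y)) x (by fun_prop)).clm_comp contDiffAt_const

theorem contDiffAt_oneChart_comp (hΦ : ContMDiff 𝓘(ℝ, E) (𝓡 m) ∞ Φ) (hx : Φ x = 1) :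
    ContDiffAt ℝ ∞ (fun y => oneChart (m := m) D (Φ y)) x := by
  simpa only [hx, inv_one, mul_one] using
    (contDiffAt_oneChart_mul_inv (m := m) hΦ x).fun_comp (f := fun y => (x, y)) x (by fun_prop)

theorem hasFDerivAt_oneChart_comp {y : E} (hΦ : MDifferentiableAt 𝓘(ℝ, E) (𝓡 m) Φ y)
    (hy : Φ y ∈ (oneChart (m := m) D).source)
    (hmul : DifferentiableAt ℝ (chartMul (m := m) D) (chartOne D, oneChart D (Φ y))) :
    HasFDerivAt (fun z => oneChart D (Φ z))
      ((fderiv ℝ (chartMul D) (chartOne D, oneChart D (Φ y))).comp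
        ((ContinuousLinearMap.inl ℝ (Vec m) (Vec m)).comp (mcForm Φ y))) y := by
  have hone : oneChart (m := m) D (Φ y * (Φ y)⁻¹) = chartOne D := by simp only [mul_inv_cancel]; rfl
  have hpair := (hasFDerivAt_mcForm hΦ).prodMk (hasFDerivAt_const (oneChart (m := m) D (Φ y)) y)
  have hcomp := HasFDerivAt.comp (g := chartMul (m := m) D) y (by rw [hone]; exact hmul.hasFDerivAt)
    hpair
  have hquot : ContinuousAt (fun z => Φ z * (Φ y)⁻¹) y :=
    ((contMDiff_mul_right (I := 𝓡 m) (n := ∞) (a := (Φ y)⁻¹)).continuous.continuousAt).comp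
      hΦ.continuousAt
  have hsource : ∀ᶠ z in 𝓝 y, Φ z * (Φ y)⁻¹ ∈ (oneChart (m := m) D).source :=
    hquot.eventually ((isOpen_extChartAt_source (I := 𝓡 m) (1 : D)).mem_nhds (by simp))
  have heq : (fun z => oneChart D (Φ z)) =ᶠ[𝓝 y]
      chartMul D ∘ fun z => (oneChart (m := m) D (Φ z * (Φ y)⁻¹), oneChart (m := m) D (Φ y)) := by
    filter_upwards [hsource] with z hz
    simp only [Function.comp_def, chartMul]
    rw [(oneChart (m := m) D).left_inv hz, (oneChart (m := m) D).left_inv hy, inv_mul_cancel_right]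
  exact (hcomp.congr_of_eventuallyEq heq).congr_fderiv rfl

theorem fderiv_oneChart_comp_eventuallyEq (hΦ : ContMDiff 𝓘(ℝ, E) (𝓡 m) ∞ Φ) (hx : Φ x = 1) :
    fderiv ℝ (fun y => oneChart (m := m) D (Φ y)) =ᶠ[𝓝 x] fun y =>
      (fderiv ℝ (chartMul D) (chartOne D, oneChart D (Φ y))).comp
        ((ContinuousLinearMap.inl ℝ (Vec m) (Vec m)).comp (mcForm Φ y)) := by
  have hsource : ∀ᶠ y in 𝓝 x, Φ y ∈ (oneChart (m := m) D).source :=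
    hΦ.continuous.continuousAt.eventually
      ((isOpen_extChartAt_source (I := 𝓡 m) (1 : D)).mem_nhds (by simp [hx]))
  have hpair : ContinuousAt (fun y => (chartOne (m := m) D, oneChart (m := m) D (Φ y))) x :=
    continuousAt_const.prodMk (contDiffAt_oneChart_comp hΦ hx).continuousAt
  have hmul := eventually_differentiableAt_chartMul (m := m) D
  have hone : chartOne (m := m) D = oneChart D (Φ x) := by rw [hx]; rfl
  nth_rewrite 2 [hone] at hmul
  filter_upwards [hsource, hpair.eventually hmul] with y hy hmuly
  exact (hasFDerivAt_oneChart_comp (hΦ.mdifferentiableAt (by simp)) hy hmuly).fderiv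

theorem fderiv_fderiv_oneChart_comp (hΦ : ContMDiff 𝓘(ℝ, E) (𝓡 m) ∞ Φ) (hx : Φ x = 1) (u v : E) :
    fderiv ℝ (fderiv ℝ (fun y => oneChart (m := m) D (Φ y))) x u v =
      fderiv ℝ (fderiv ℝ (chartMul D)) (chartOne D, chartOne D) (0, mcForm Φ x u) (mcForm Φ x v, 0)
        + fderiv ℝ (mcForm Φ) x u v := by
  have hone : oneChart (m := m) D (Φ x) = chartOne D := by rw [hx]; rfl
  have hcoord := hasFDerivAt_mcForm (m := m) (hΦ.mdifferentiableAt (x := x) (by simp))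
  simp only [hx, inv_one, mul_one] at hcoord
  have hmul := HasFDerivAt.comp (g := fderiv ℝ (chartMul D))
    (f := fun y => (chartOne (m := m) D, oneChart D (Φ y))) x
    (by rw [hone]; exact hasFDerivAt_fderiv_chartMul D)
    ((hasFDerivAt_const (chartOne D) x).prodMk hcoord)
  have hform := ((contDiff_mcForm hΦ).differentiable (by simp) x).hasFDerivAt
  have hprod := hmul.clm_comp
    ((hasFDerivAt_const (ContinuousLinearMap.inl ℝ (Vec m) (Vec m)) x).clm_comp hform)
  rw [(hprod.congr_of_eventuallyEq (fderiv_oneChart_comp_eventuallyEq hΦ hx)).fderiv]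
  simp only [Function.comp_def, hone]
  simp [fderiv_chartMul_inl, add_comm]

theorem fderiv_mcForm_sub_of_eq_one (hΦ : ContMDiff 𝓘(ℝ, E) (𝓡 m) ∞ Φ) (hx : Φ x = 1) (u v : E) :
    fderiv ℝ (mcForm (m := m) Φ) x u v - fderiv ℝ (mcForm (m := m) Φ) x v u =
      bracketCLM D (mcForm Φ x u) (mcForm Φ x v) := by
  have hcoord : IsSymmSndFDerivAt ℝ (fun y => oneChart (m := m) D (Φ y)) x :=
    (contDiffAt_oneChart_comp hΦ hx).isSymmSndFDerivAt
      (by rw [minSmoothness_of_isRCLikeNormedField]; exact ENat.LEInfty.out)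
  have hsymm := hcoord.eq u v
  have hmul := isSymmSndFDerivAt_chartMul (m := m) D
  rw [fderiv_fderiv_oneChart_comp hΦ hx, fderiv_fderiv_oneChart_comp hΦ hx] at hsymm
  rw [bracketCLM_eq_fderiv, hmul.eq (mcForm Φ x u, 0), hmul.eq (mcForm Φ x v, 0),
    sub_eq_sub_iff_add_eq_add, add_comm, hsymm, add_comm]

-- Right translation does not change `dΦ Φ⁻¹`, so one may assume `Φ x = 1`.
theorem fderiv_mcForm_sub (hΦ : ContMDiff 𝓘(ℝ, E) (𝓡 m) ∞ Φ) (x u v : E) :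
    fderiv ℝ (mcForm (m := m) Φ) x u v - fderiv ℝ (mcForm (m := m) Φ) x v u =
      bracketCLM D (mcForm Φ x u) (mcForm Φ x v) := by
  have htranslate : mcForm (m := m) (fun y => Φ y * (Φ x)⁻¹) = mcForm Φ :=
    funext (mcForm_mul_const Φ _)
  have htranslated := fderiv_mcForm_sub_of_eq_one (m := m) (x := x)
    (Φ := fun y => Φ y * (Φ x)⁻¹) (hΦ.mul contMDiff_const) (by simp) u v
  rwa [htranslate] at htranslated

end MaurerCartanForm

section LocalParametrization

theorem exists_contDiff_mem_ball_eventuallyEq_id {E : Type*} [NormedAddCommGroup E]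
    [NormedSpace ℝ E] [HasContDiffBump E] {r : ℝ} (hr : 0 < r) :
    ∃ g : E → E, ContDiff ℝ ∞ g ∧ (∀ y, g y ∈ Metric.ball 0 r) ∧ g =ᶠ[𝓝 0] id := by
  let χ : ContDiffBump (0 : E) := ⟨r / 4, r / 2, by positivity, by linarith⟩
  refine ⟨fun y => χ y • y, χ.contDiff.smul contDiff_id, fun y => ?_, ?_⟩
  · rw [mem_ball_zero_iff, norm_smul, Real.norm_of_nonneg χ.nonneg]
    by_cases hy : ‖y‖ < r / 2
    · calc χ y * ‖y‖ ≤ 1 * ‖y‖ := by gcongr; exact χ.le_one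
        _ < r := by linarith
    · rwa [χ.zero_of_le_dist (by simpa [χ] using hy), zero_mul]
  · filter_upwards [χ.eventuallyEq_one] with y hy
    simp [hy]

theorem exists_contMDiff_mcForm_eq_id (m : ℕ) (D : Type*) [TopologicalSpace D]
    [ChartedSpace (EuclideanSpace ℝ (Fin m)) D] [Group D] [LieGroup (𝓡 m) ∞ D] :
    ∃ c : Vec m → D, ContMDiff 𝓘(ℝ, Vec m) (𝓡 m) ∞ c ∧
    c 0 = 1 ∧ mcForm c 0 = ContinuousLinearMap.id ℝ (Vec m) ∧ Set.range c ∈ 𝓝 (1 : D) := by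
  obtain ⟨r, hr, hball⟩ := Metric.isOpen_iff.1 (isOpen_extChartAt_target (I := 𝓡 m) (1 : D)) _
    (mem_extChartAt_target (I := 𝓡 m) (1 : D))
  obtain ⟨g, hg, hgball, hgid⟩ := exists_contDiff_mem_ball_eventuallyEq_id (E := Vec m) hr
  have htarget (y : Vec m) : chartOne D + g y ∈ (oneChart D).target :=
    hball (by simpa [chartOne] using hgball y)
  let c (y : Vec m) : D := (oneChart D).symm (chartOne D + g y)
  have hc : ContMDiff 𝓘(ℝ, Vec m) (𝓡 m) ∞ c := fun y =>
    ((contMDiffOn_extChartAt_symm (1 : D)).contMDiffAt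
      ((isOpen_extChartAt_target (I := 𝓡 m) (1 : D)).mem_nhds (htarget y))).comp y
        (contDiff_const.add hg).contMDiff.contMDiffAt
  have hc_zero : c 0 = 1 := by simp only [c, hgid.eq_of_nhds, id, add_zero, oneChart_symm_chartOne]
  refine ⟨c, hc, hc_zero, ?_, ?_⟩
  · refine (hasFDerivAt_mcForm (hc.mdifferentiableAt (by simp))).unique
      (((hasFDerivAt_id (0 : Vec m)).const_add (chartOne D)).congr_of_eventuallyEq ?_)
    filter_upwards [hgid] with y hy
    rw [hc_zero, inv_one, mul_one, (oneChart (m := m) D).right_inv (htarget y), hy]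
  · have hcoord : Filter.Tendsto (fun d : D => oneChart D d - chartOne (m := m) D) (𝓝 1) (𝓝 0) := by
      simpa [chartOne] using
        (continuousAt_extChartAt (I := 𝓡 m) (1 : D)).tendsto.sub_const (chartOne D)
    filter_upwards [hcoord.eventually hgid, extChartAt_source_mem_nhds (I := 𝓡 m) (1 : D)]
      with d hd hsource
    refine ⟨oneChart D d - chartOne D, ?_⟩
    simp only [c, hd, id, add_sub_cancel]
    exact (oneChart (m := m) D).left_inv hsource

end LocalParametrization

section LieDifferential

variable {k m : ℕ} {F D : Type*} [TopologicalSpace F]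
  [ChartedSpace (EuclideanSpace ℝ (Fin k)) F] [Group F] [TopologicalSpace D]
  [ChartedSpace (EuclideanSpace ℝ (Fin m)) D] [Group D]

/-- The differential at the identity of a homomorphism of Lie groups, as a continuous linear map
of the normed model spaces. -/
def lieDifferentialCLM (ι : F →* D) : Vec k →L[ℝ] Vec m := mfderiv (𝓡 k) (𝓡 m) ι 1

variable [LieGroup (𝓡 k) ∞ F] {ι : F →* D}

theorem mcForm_hom_comp {E : Type*} [NormedAddCommGroup E] [NormedSpace ℝ E] {f : E → F} {x : E}
    (hι : ContMDiff (𝓡 k) (𝓡 m) ∞ ι) (hf : MDifferentiableAt 𝓘(ℝ, E) (𝓡 k) f x) :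
    mcForm (m := m) (fun y => ι (f y)) x = (lieDifferentialCLM ι).comp (mcForm (m := k) f x) := by
  have hquot : MDifferentiableAt 𝓘(ℝ, E) (𝓡 k) (fun y => f y * (f x)⁻¹) x :=
    ((contMDiff_mul_right (I := 𝓡 k) (n := ∞)).mdifferentiableAt (by simp)).comp x hf
  have hcomp := mfderiv_comp_of_eq (g := ι) (hι.mdifferentiableAt (by simp)) hquot
    (mul_inv_cancel (f x))
  have hhom : ι ∘ (fun y => f y * (f x)⁻¹) = fun y => ι (f y) * (ι (f x))⁻¹ := by
    funext y
    simp
  rw [hhom, mul_inv_cancel] at hcomp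
  exact hcomp

variable [LieGroup (𝓡 m) ∞ D]

theorem lieDifferentialCLM_bracketCLM (hι : ContMDiff (𝓡 k) (𝓡 m) ∞ ι) (X Y : Vec k) :
    lieDifferentialCLM (m := m) ι (bracketCLM F X Y) =
      bracketCLM D (lieDifferentialCLM ι X) (lieDifferentialCLM ι Y) := by
  obtain ⟨c, hc, -, hc_id, -⟩ := exists_contMDiff_mcForm_eq_id k F
  have hform : mcForm (m := m) (fun y => ι (c y)) =
      fun y => (lieDifferentialCLM ι).comp (mcForm (m := k) c y) :=
    funext fun y => mcForm_hom_comp hι (hc.mdifferentiableAt (by simp))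
  have hderiv := (hasFDerivAt_const (lieDifferentialCLM (k := k) (m := m) ι) (0 : Vec k)).clm_comp
    ((contDiff_mcForm hc).differentiable (by simp) 0).hasFDerivAt
  have hMC := fderiv_mcForm_sub hc 0 X Y
  have hMC_comp := fderiv_mcForm_sub (m := m) (Φ := fun y => ι (c y)) (hι.comp hc) 0 X Y
  rw [hform, hderiv.fderiv] at hMC_comp
  simpa [hc_id, ← map_sub, hMC] using hMC_comp

end LieDifferential

section Adjoint

variable {m : ℕ} {D : Type*} [TopologicalSpace D] [ChartedSpace (EuclideanSpace ℝ (Fin m)) D]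
  [Group D] {E : Type*} [NormedAddCommGroup E] [NormedSpace ℝ E] {Φ Ψ h : E → D} {x : E}

/-- The adjoint action of an element of a Lie group on the Lie algebra, as a continuous linear map
of the normed model space. -/
def adCLM (d : D) : Vec m →L[ℝ] Vec m := lieDifferentialCLM (MulAut.conj d).toMonoidHom

theorem adCLM_one : adCLM (1 : D) = ContinuousLinearMap.id ℝ (Vec m) := by
  rw [adCLM, map_one]
  exact mfderiv_id

variable [LieGroup (𝓡 m) ∞ D]

theorem contMDiff_conj (d : D) :
    ContMDiff (𝓡 m) (𝓡 m) ∞ (MulAut.conj d).toMonoidHom :=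
  (contMDiff_mul_right (I := 𝓡 m)).comp contMDiff_mul_left

theorem adCLM_mul (d e : D) : adCLM (m := m) (d * e) = (adCLM d).comp (adCLM e) := by
  have hcomp := mfderiv_comp_of_eq (x := (1 : D))
    ((contMDiff_conj (m := m) d).mdifferentiableAt (by simp))
    ((contMDiff_conj (m := m) e).mdifferentiableAt (by simp)) (map_one _)
  rw [map_one] at hcomp
  rw [adCLM, map_mul]
  exact hcomp

theorem adCLM_inv_apply (d : D) (X : Vec m) : adCLM d⁻¹ (adCLM d X) = X := by
  rw [← ContinuousLinearMap.comp_apply, ← adCLM_mul, inv_mul_cancel, adCLM_one,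
    ContinuousLinearMap.id_apply]

theorem adCLM_apply_inv (d : D) (X : Vec m) : adCLM d (adCLM d⁻¹ X) = X := by
  simpa only [inv_inv] using adCLM_inv_apply d⁻¹ X

theorem adCLM_bracketCLM (d : D) (X Y : Vec m) :
    adCLM d (bracketCLM D X Y) = bracketCLM D (adCLM d X) (adCLM d Y) :=
  lieDifferentialCLM_bracketCLM (contMDiff_conj d) X Y

theorem mcForm_conj (hΦ : MDifferentiableAt 𝓘(ℝ, E) (𝓡 m) Φ x) (d : D) :
    mcForm (m := m) (fun y => d * Φ y * d⁻¹) x = (adCLM d).comp (mcForm Φ x) :=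
  mcForm_hom_comp (contMDiff_conj d) hΦ

theorem mcForm_mul_of_eq_one (hΦ : MDifferentiableAt 𝓘(ℝ, E) (𝓡 m) Φ x) (hΦx : Φ x = 1)
    (hΨ : MDifferentiableAt 𝓘(ℝ, E) (𝓡 m) Ψ x) (hΨx : Ψ x = 1) :
    mcForm (m := m) (fun y => Φ y * Ψ y) x = mcForm Φ x + mcForm Ψ x := by
  have hmul : MDifferentiableAt 𝓘(ℝ, E) (𝓡 m) (fun y => Φ y * Ψ y) x :=
    ((contMDiff_mul (𝓡 m) ∞ (G := D)).mdifferentiableAt (x := (Φ x, Ψ x)) (by simp)).comp x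
      (hΦ.prodMk hΨ)
  have hsource {f : E → D} (hf : MDifferentiableAt 𝓘(ℝ, E) (𝓡 m) f x) (hfx : f x = 1) :
      ∀ᶠ y in 𝓝 x, f y ∈ (oneChart (m := m) D).source :=
    hf.continuousAt.eventually
      ((isOpen_extChartAt_source (I := 𝓡 m) (1 : D)).mem_nhds (by simp [hfx]))
  have hread : (fun y => oneChart (m := m) D (Φ y * Ψ y)) =ᶠ[𝓝 x]
      chartMul D ∘ fun y => (oneChart (m := m) D (Φ y), oneChart (m := m) D (Ψ y)) := by
    filter_upwards [hsource hΦ hΦx, hsource hΨ hΨx] with y hy hy'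
    simp only [Function.comp_def, chartMul]
    rw [(oneChart (m := m) D).left_inv hy, (oneChart (m := m) D).left_inv hy']
  have hΦ' := hasFDerivAt_mcForm hΦ
  have hΨ' := hasFDerivAt_mcForm hΨ
  have hmul' := hasFDerivAt_mcForm hmul
  simp only [hΦx, hΨx, inv_one, mul_one] at hΦ' hΨ' hmul'
  have hcomp := HasFDerivAt.comp (g := chartMul (m := m) D) x
    (by rw [hΦx, hΨx]; exact hasFDerivAt_chartMul D) (hΦ'.prodMk hΨ')
  refine (hmul'.unique (hcomp.congr_of_eventuallyEq hread)).trans ?_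
  ext1 w
  have hsplit : (mcForm (m := m) Φ x w, mcForm (m := m) Ψ x w) =
      (mcForm Φ x w, 0) + (0, mcForm Ψ x w) := by simp
  simp only [add_apply, ContinuousLinearMap.comp_apply, ContinuousLinearMap.prod_apply]
  rw [hsplit, map_add, fderiv_chartMul_inl, fderiv_chartMul_inr]

theorem mcForm_mul (hΦ : MDifferentiableAt 𝓘(ℝ, E) (𝓡 m) Φ x)
    (hΨ : MDifferentiableAt 𝓘(ℝ, E) (𝓡 m) Ψ x) :
    mcForm (m := m) (fun y => Φ y * Ψ y) x = mcForm Φ x + (adCLM (Φ x)).comp (mcForm Ψ x) := by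
  have hmul_const (d : D) {f : E → D} (hf : MDifferentiableAt 𝓘(ℝ, E) (𝓡 m) f x) :
      MDifferentiableAt 𝓘(ℝ, E) (𝓡 m) (fun y => f y * d) x :=
    ((contMDiff_mul_right (I := 𝓡 m) (n := ∞)).mdifferentiableAt (by simp)).comp x hf
  have hconj : MDifferentiableAt 𝓘(ℝ, E) (𝓡 m) (fun y => Φ x * (Ψ y * (Ψ x)⁻¹) * (Φ x)⁻¹) x :=
    ((contMDiff_conj (m := m) (Φ x)).mdifferentiableAt (by simp)).comp x (hmul_const _ hΨ)
  have hsplit : (fun y => Φ y * Ψ y * (Φ x * Ψ x)⁻¹) =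
      fun y => (Φ y * (Φ x)⁻¹) * (Φ x * (Ψ y * (Ψ x)⁻¹) * (Φ x)⁻¹) := by
    funext y
    group
  rw [← mcForm_mul_const _ (Φ x * Ψ x)⁻¹, hsplit,
    mcForm_mul_of_eq_one (hmul_const _ hΦ) (by simp) hconj (by simp),
    mcForm_conj (hmul_const _ hΨ), mcForm_mul_const, mcForm_mul_const]

variable {c : Vec m → D}

theorem contMDiff_fst_mul_snd (hh : ContMDiff 𝓘(ℝ, E) (𝓡 m) ∞ h)
    (hc : ContMDiff 𝓘(ℝ, Vec m) (𝓡 m) ∞ c) :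
    ContMDiff 𝓘(ℝ, E × Vec m) (𝓡 m) ∞ fun p : E × Vec m => h p.1 * c p.2 :=
  (hh.comp contDiff_fst.contMDiff).mul (hc.comp contDiff_snd.contMDiff)

theorem mcForm_fst_mul_snd (hh : ContMDiff 𝓘(ℝ, E) (𝓡 m) ∞ h)
    (hc : ContMDiff 𝓘(ℝ, Vec m) (𝓡 m) ∞ c) (x : E) (y : Vec m) :
    mcForm (m := m) (fun p : E × Vec m => h p.1 * c p.2) (x, y) =
      (mcForm h x).comp (ContinuousLinearMap.fst ℝ E (Vec m)) +
        (adCLM (h x)).comp ((mcForm c y).comp (ContinuousLinearMap.snd ℝ E (Vec m))) := by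
  have hfst := mcForm_comp (g := fun p : E × Vec m => p.1) (x := (x, y))
    (hh.mdifferentiableAt (by simp)) differentiableAt_fst
  have hsnd := mcForm_comp (g := fun p : E × Vec m => p.2) (x := (x, y))
    (hc.mdifferentiableAt (by simp)) differentiableAt_snd
  rw [mcForm_mul (Φ := fun p : E × Vec m => h p.1) (Ψ := fun p : E × Vec m => c p.2)
    ((hh.comp contDiff_fst.contMDiff).mdifferentiableAt (by simp))
    ((hc.comp contDiff_snd.contMDiff).mdifferentiableAt (by simp)), hfst, hsnd, fderiv_fst,
    fderiv_snd]

theorem contDiff_adCLM (hh : ContMDiff 𝓘(ℝ, E) (𝓡 m) ∞ h) :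
    ContDiff ℝ ∞ (fun x => adCLM (m := m) (h x)) := by
  obtain ⟨c, hc, -, hc_id, -⟩ := exists_contMDiff_mcForm_eq_id m D
  have hpartial : (fun x => adCLM (m := m) (h x)) = fun x =>
      (mcForm (fun p : E × Vec m => h p.1 * c p.2) (x, 0)).comp
        (ContinuousLinearMap.inr ℝ E (Vec m)) := by
    ext x X
    simp [mcForm_fst_mul_snd hh hc, hc_id]
  rw [hpartial]
  exact ((contDiff_mcForm (contMDiff_fst_mul_snd hh hc)).comp
    (contDiff_prodMk_left (0 : Vec m))).clm_comp contDiff_const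

-- The Maurer-Cartan equation for `(x, y) ↦ h x * c y`, in the directions `(v, 0)` and `(0, X)`.
theorem fderiv_adCLM (hh : ContMDiff 𝓘(ℝ, E) (𝓡 m) ∞ h) (X : Vec m) (x v : E) :
    fderiv ℝ (fun x => adCLM (h x) X) x v = bracketCLM D (mcForm h x v) (adCLM (h x) X) := by
  obtain ⟨c, hc, -, hc_id, -⟩ := exists_contMDiff_mcForm_eq_id m D
  let Φ (p : E × Vec m) : D := h p.1 * c p.2
  have hΦ : ContMDiff 𝓘(ℝ, E × Vec m) (𝓡 m) ∞ Φ := contMDiff_fst_mul_snd hh hc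
  have hform (p : E × Vec m) : HasFDerivAt (mcForm (m := m) Φ) (fderiv ℝ (mcForm Φ) p) p :=
    ((contDiff_mcForm hΦ).differentiable (by simp) p).hasFDerivAt
  have hfst := (HasFDerivAt.comp (f := fun x : E => (x, (0 : Vec m))) x (hform _)
    (hasFDerivAt_prodMk_left x 0)).clm_apply (hasFDerivAt_const ((0, X) : E × Vec m) x)
  have hsnd := (HasFDerivAt.comp (f := fun y : Vec m => (x, y)) 0 (hform _)
    (hasFDerivAt_prodMk_right x 0)).clm_apply (hasFDerivAt_const ((v, 0) : E × Vec m) 0)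
  have hform_fst : (fun x => (mcForm (m := m) Φ ∘ fun x : E => (x, (0 : Vec m))) x (0, X)) =
      fun x => adCLM (h x) X := by
    funext x
    simp [Φ, mcForm_fst_mul_snd hh hc, hc_id]
  have hform_snd : (fun y => (mcForm (m := m) Φ ∘ fun y : Vec m => (x, y)) y (v, 0)) =
      fun _ => mcForm h x v := by
    funext y
    simp [Φ, mcForm_fst_mul_snd hh hc]
  rw [hform_fst] at hfst
  rw [hform_snd] at hsnd
  have hvanish : fderiv ℝ (mcForm (m := m) Φ) (x, 0) (0, X) (v, 0) = 0 := by
    simpa using DFunLike.congr_fun (hsnd.unique (hasFDerivAt_const _ _)) X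
  have hMC := fderiv_mcForm_sub hΦ (x, (0 : Vec m)) (v, 0) (0, X)
  rw [hvanish, sub_zero, mcForm_fst_mul_snd hh hc, hc_id] at hMC
  simpa [hfst.fderiv] using hMC

end Adjoint

theorem eq_of_forall_hasFDerivAt_comp_zero {k : ℕ} {F : Type*} [TopologicalSpace F]
    [ChartedSpace (EuclideanSpace ℝ (Fin k)) F] [Group F] [LieGroup (𝓡 k) ∞ F] [ConnectedSpace F]
    {V : Type*} [NormedAddCommGroup V] [NormedSpace ℝ V] {φ : F → V}
    (hφ : ∀ f : Vec k → F, ContMDiff 𝓘(ℝ, Vec k) (𝓡 k) ∞ f →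
      ∀ x, HasFDerivAt (fun y => φ (f y)) (0 : Vec k →L[ℝ] V) x) (a b : F) : φ a = φ b := by
  suffices hconst : IsLocallyConstant φ from hconst.apply_eq_of_preconnectedSpace a b
  rw [IsLocallyConstant.iff_eventually_eq]
  intro f₀
  obtain ⟨c, hc, hc_zero, -, hrange⟩ := exists_contMDiff_mcForm_eq_id k F
  have hderiv := hφ (fun y => c y * f₀) (hc.mul contMDiff_const)
  have hmul : Continuous fun z : F => z * f₀⁻¹ :=
    (contMDiff_mul_right (I := 𝓡 k) (n := ∞)).continuous
  have hmem : ∀ᶠ z in 𝓝 f₀, z * f₀⁻¹ ∈ Set.range c :=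
    (hmul.tendsto' f₀ 1 (mul_inv_cancel f₀)).eventually hrange
  filter_upwards [hmem] with z ⟨y, hy⟩
  have hconst := is_const_of_fderiv_eq_zero (fun x => (hderiv x).differentiableAt)
    (fun x => (hderiv x).fderiv) y 0
  simpa [hy, hc_zero] using hconst

section InvariantForm

variable {m : ℕ} {D : Type*} [TopologicalSpace D] [ChartedSpace (EuclideanSpace ℝ (Fin m)) D]
  [Group D]

/-- A bilinear form on the Lie algebra of a Lie group, as a continuous bilinear map on the normed
model space. -/
def bilinCLM (β : LinearMap.BilinForm ℝ (GroupLieAlgebra (𝓡 m) D)) : Vec m →L[ℝ] Vec m →L[ℝ] ℝ :=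
  LinearMap.toContinuousBilinearMap (β : Vec m →ₗ[ℝ] Vec m →ₗ[ℝ] ℝ)

variable [LieGroup (𝓡 m) ∞ D]

theorem bracketCLM_skew (X Y : Vec m) : -bracketCLM D Y X = bracketCLM D X Y :=
  lie_skew (L := GroupLieAlgebra (𝓡 m) D) X Y

variable (S : DoubleAlgebra (GroupLieAlgebra (𝓡 m) D))

/-- The invariant bilinear form of a double, as a continuous bilinear map on the normed model
space. -/
def formCLM : Vec m →L[ℝ] Vec m →L[ℝ] ℝ := bilinCLM S.form

theorem formCLM_symm (X Y : Vec m) : formCLM S X Y = formCLM S Y X := S.symm.eq X Y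

theorem formCLM_invariant (X Y Z : Vec m) :
    formCLM S (bracketCLM D X Y) Z + formCLM S Y (bracketCLM D X Z) = 0 :=
  S.invariant X Y Z

theorem formCLM_bracketCLM_swap (X Y Z : Vec m) :
    formCLM S X (bracketCLM D Z Y) = -formCLM S X (bracketCLM D Y Z) := by
  rw [← bracketCLM_skew, map_neg]

theorem formCLM_bracketCLM_rotate (X Y Z : Vec m) :
    formCLM S Y (bracketCLM D Z X) = formCLM S X (bracketCLM D Y Z) := by
  have hinv := formCLM_invariant S Z X Y
  rw [formCLM_symm, formCLM_bracketCLM_swap S X Y Z] at hinv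
  linarith

theorem wzForm_eq (X Y Z : Vec m) : wzForm S X Y Z = 6 * formCLM S X (bracketCLM D Y Z) := by
  have hwedge (X Y Z : Vec m) :
      S.form X (bracketWedge (D := D) Y Z) = 2 * formCLM S X (bracketCLM D Y Z) := by
    have hsub : S.form X (bracketWedge (D := D) Y Z) =
      formCLM S X (bracketCLM D Y Z - bracketCLM D Z Y) := rfl
    rw [hsub, map_sub, formCLM_bracketCLM_swap S X Y Z]
    ring
  unfold wzForm
  rw [hwedge, hwedge, hwedge, formCLM_bracketCLM_rotate S X Y Z,
    ← formCLM_bracketCLM_rotate S Z X Y]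
  ring

theorem formCLM_adCLM {k : ℕ} {F : Type*} [TopologicalSpace F]
    [ChartedSpace (EuclideanSpace ℝ (Fin k)) F] [Group F] [LieGroup (𝓡 k) ∞ F] [ConnectedSpace F]
    {ι : F →* D} (hι : ContMDiff (𝓡 k) (𝓡 m) ∞ ι) (f : F) (X Y : Vec m) :
    formCLM S (adCLM (ι f) X) (adCLM (ι f) Y) = formCLM S X Y := by
  suffices hconst : formCLM S (adCLM (ι f) X) (adCLM (ι f) Y) =
      formCLM S (adCLM (ι 1) X) (adCLM (ι 1) Y) by simpa [adCLM_one] using hconst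
  refine eq_of_forall_hasFDerivAt_comp_zero (k := k)
    (φ := fun f => formCLM S (adCLM (ι f) X) (adCLM (ι f) Y)) (fun g hg x => ?_) f 1
  have hιg : ContMDiff 𝓘(ℝ, Vec k) (𝓡 m) ∞ (fun y => ι (g y)) := hι.comp hg
  have had (Z : Vec m) : HasFDerivAt (fun y => adCLM (ι (g y)) Z)
      (fderiv ℝ (fun y => adCLM (ι (g y)) Z) x) x :=
    (((contDiff_adCLM hιg).clm_apply contDiff_const).differentiable (by simp) x).hasFDerivAt
  refine ((((formCLM S).hasFDerivAt.comp x (had X)).clm_apply (had Y))).congr_fderiv ?_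
  ext v
  have hinv := formCLM_invariant S (mcForm (m := m) (fun y => ι (g y)) x v) (adCLM (ι (g x)) X)
    (adCLM (ι (g x)) Y)
  simp only [ContinuousLinearMap.comp_apply, ContinuousLinearMap.flip_apply, add_apply,
    fderiv_adCLM hιg, Function.comp_apply, zero_apply]
  linarith

end InvariantForm

section TwoForms

theorem fderiv_clm_apply_apply {E V W G : Type*} [NormedAddCommGroup E] [NormedSpace ℝ E]
    [NormedAddCommGroup V] [NormedSpace ℝ V] [NormedAddCommGroup W] [NormedSpace ℝ W]
    [NormedAddCommGroup G] [NormedSpace ℝ G] {η : E → V →L[ℝ] W →L[ℝ] G} {x : E}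
    (hη : DifferentiableAt ℝ η x) (u : E) (v : V) (w : W) :
    fderiv ℝ (fun y => η y v w) x u = fderiv ℝ η x u v w := by
  rw [((hη.hasFDerivAt.clm_apply (hasFDerivAt_const v x)).clm_apply (hasFDerivAt_const w x)).fderiv]
  simp

variable {m : ℕ} {D : Type*} [TopologicalSpace D] [ChartedSpace (EuclideanSpace ℝ (Fin m)) D]
  [Group D] {E : Type*} [NormedAddCommGroup E] [NormedSpace ℝ E]

/-- A closed smooth differential 2-form on a normed space, in curried form. -/
structure IsClosedTwoForm (η : E → E →L[ℝ] E →L[ℝ] ℝ) : Prop where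
  contDiff : ContDiff ℝ ∞ η
  alternating : ∀ x u, η x u u = 0
  closed : ∀ x u v w, fderiv ℝ η x u v w + fderiv ℝ η x v w u + fderiv ℝ η x w u v = 0

/-- The pullback under `Φ` of a 2-form on a Lie group. As in `IsPotential`, the 2-form is given in
the frame of right-invariant vector fields. -/
def pullTwoForm (b : D → LinearMap.BilinForm ℝ (GroupLieAlgebra (𝓡 m) D)) (Φ : E → D) (x : E) :
    E →L[ℝ] E →L[ℝ] ℝ :=
  (bilinCLM (b (Φ x))).bilinearComp (mcForm Φ x) (mcForm Φ x)

variable [LieGroup (𝓡 m) ∞ D] {b : D → LinearMap.BilinForm ℝ (GroupLieAlgebra (𝓡 m) D)}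
  {S : DoubleAlgebra (GroupLieAlgebra (𝓡 m) D)} {Φ : E → D}

theorem fderiv_comp_eq_rightDeriv {φ : D → ℝ} (hφ : ContMDiff (𝓡 m) 𝓘(ℝ, ℝ) ∞ φ)
    (hΦ : ContMDiff 𝓘(ℝ, E) (𝓡 m) ∞ Φ) (x v : E) :
    fderiv ℝ (fun y => φ (Φ y)) x v = rightDeriv (m := m) φ (mcForm Φ x v) (Φ x) := by
  have htranslate : MDifferentiableAt (𝓡 m) 𝓘(ℝ, ℝ) (fun z : D => φ (z * Φ x)) 1 :=
    (hφ.comp (contMDiff_mul_right (I := 𝓡 m) (n := ∞))).mdifferentiableAt (by simp)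
  have hquot : MDifferentiableAt 𝓘(ℝ, E) (𝓡 m) (fun y => Φ y * (Φ x)⁻¹) x :=
    (hΦ.mul (contMDiff_const (c := (Φ x)⁻¹))).mdifferentiableAt (by simp)
  have hcomp := mfderiv_comp_of_eq htranslate hquot (mul_inv_cancel (Φ x))
  have hcancel : (fun z : D => φ (z * Φ x)) ∘ (fun y => Φ y * (Φ x)⁻¹) = fun y => φ (Φ y) := by
    funext y
    simp
  rw [hcancel, mfderiv_eq_fderiv, mul_inv_cancel] at hcomp
  exact DFunLike.congr_fun hcomp v

theorem IsPotential.bilinCLM_neg (hb : IsPotential S b) (d : D) (X Y : Vec m) :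
    -bilinCLM (b d) Y X = bilinCLM (b d) X Y :=
  LinearMap.IsAlt.neg (hb.alt d) Y X

theorem IsPotential.contDiff_bilinCLM_comp (hb : IsPotential S b)
    (hΦ : ContMDiff 𝓘(ℝ, E) (𝓡 m) ∞ Φ) : ContDiff ℝ ∞ (fun x => bilinCLM (b (Φ x))) :=
  contDiff_clm_apply_iff.2 fun X => contDiff_clm_apply_iff.2 fun Y =>
    ((hb.smooth X Y).comp hΦ).contDiff

theorem IsPotential.fderiv_bilinCLM_comp (hb : IsPotential S b)
    (hΦ : ContMDiff 𝓘(ℝ, E) (𝓡 m) ∞ Φ) (x u : E) (X Y : Vec m) :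
    fderiv ℝ (fun y => bilinCLM (b (Φ y))) x u X Y =
      rightDeriv (m := m) (fun d => b d X Y) (mcForm Φ x u) (Φ x) := by
  rw [← fderiv_comp_eq_rightDeriv (hb.smooth X Y) hΦ,
    ← fderiv_clm_apply_apply ((hb.contDiff_bilinCLM_comp hΦ).differentiable (by simp) x)]
  rfl

variable [FiniteDimensional ℝ E]

theorem IsPotential.contDiff_pullTwoForm (hb : IsPotential S b)
    (hΦ : ContMDiff 𝓘(ℝ, E) (𝓡 m) ∞ Φ) : ContDiff ℝ ∞ (pullTwoForm b Φ) :=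
  contDiff_clm_apply_iff.2 fun _ => contDiff_clm_apply_iff.2 fun _ =>
    ((hb.contDiff_bilinCLM_comp hΦ).clm_apply
      ((contDiff_mcForm hΦ).clm_apply contDiff_const)).clm_apply
        ((contDiff_mcForm hΦ).clm_apply contDiff_const)

theorem IsPotential.fderiv_pullTwoForm (hb : IsPotential S b) (hΦ : ContMDiff 𝓘(ℝ, E) (𝓡 m) ∞ Φ)
    (x u v w : E) :
    fderiv ℝ (pullTwoForm b Φ) x u v w =
      rightDeriv (m := m) (fun d => b d (mcForm (m := m) Φ x v) (mcForm (m := m) Φ x w))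
          (mcForm Φ x u) (Φ x)
        + bilinCLM (b (Φ x)) (fderiv ℝ (mcForm Φ) x u v) (mcForm Φ x w)
        + bilinCLM (b (Φ x)) (mcForm Φ x v) (fderiv ℝ (mcForm Φ) x u w) := by
  have hb' := ((hb.contDiff_bilinCLM_comp hΦ).differentiable (by simp) x).hasFDerivAt
  have hform := ((contDiff_mcForm hΦ).differentiable (by simp) x).hasFDerivAt
  have hprod := (hb'.clm_apply (hform.clm_apply (hasFDerivAt_const v x))).clm_apply
    (hform.clm_apply (hasFDerivAt_const w x))
  have heq : fderiv ℝ (fun y => pullTwoForm b Φ y v w) x = _ := hprod.fderiv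
  rw [← hb.fderiv_bilinCLM_comp hΦ,
    ← fderiv_clm_apply_apply ((hb.contDiff_pullTwoForm hΦ).differentiable (by simp) x)]
  simpa [add_comm, add_left_comm, add_assoc] using DFunLike.congr_fun heq u

theorem IsPotential.fderiv_pullTwoForm_cyclic (hb : IsPotential S b)
    (hΦ : ContMDiff 𝓘(ℝ, E) (𝓡 m) ∞ Φ) (x u v w : E) :
    fderiv ℝ (pullTwoForm b Φ) x u v w + fderiv ℝ (pullTwoForm b Φ) x v w u
      + fderiv ℝ (pullTwoForm b Φ) x w u v =
      6 * formCLM S (mcForm Φ x u) (bracketCLM D (mcForm Φ x v) (mcForm Φ x w)) := by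
  have hMC (u v : E) : fderiv ℝ (mcForm (m := m) Φ) x u v = fderiv ℝ (mcForm Φ) x v u +
      bracketCLM D (mcForm (m := m) Φ x u) (mcForm (m := m) Φ x v) := by
    rw [← fderiv_mcForm_sub hΦ, add_sub_cancel]
  have hbracket (X Y Z : Vec m) : b (Φ x) (⁅(show GroupLieAlgebra (𝓡 m) D from X),
      (show GroupLieAlgebra (𝓡 m) D from Y)⁆ : GroupLieAlgebra (𝓡 m) D) Z =
        bilinCLM (b (Φ x)) (bracketCLM D X Y) Z := rfl
  have hderiv := hb.deriv_eq (Φ x) (mcForm (m := m) Φ x u) (mcForm (m := m) Φ x v)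
    (mcForm (m := m) Φ x w)
  rw [wzForm_eq, hbracket, hbracket, hbracket] at hderiv
  rw [← hderiv, hb.fderiv_pullTwoForm hΦ, hb.fderiv_pullTwoForm hΦ, hb.fderiv_pullTwoForm hΦ,
    hMC u v, hMC v w, hMC w u, map_add, map_add, map_add, add_apply, add_apply, add_apply,
    ← hb.bilinCLM_neg _ (mcForm Φ x v),
    ← hb.bilinCLM_neg _ (mcForm Φ x w) (fderiv ℝ (mcForm Φ) x v u),
    ← hb.bilinCLM_neg _ (mcForm Φ x u) (fderiv ℝ (mcForm Φ) x w v)]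
  ring

end TwoForms

namespace DoubleAlgebra

variable {𝔡 : Type*} [LieRing 𝔡] [LieAlgebra ℝ 𝔡] (S : DoubleAlgebra 𝔡)

theorem form_coe_g (x y : S.G) : S.form (x : 𝔡) y = 0 :=
  S.isotropic_g _ x.2 _ y.2

theorem form_coe_gHat (γ δ : S.GHat) : S.form (γ : 𝔡) δ = 0 :=
  S.isotropic_gHat _ γ.2 _ δ.2

theorem JHat_add_J (X : 𝔡) : S.JHat X + S.J X = X := by
  obtain ⟨x, γ, rfl⟩ := S.exists_add X
  simp [J, JHat]

theorem mem_rSpace {R : S.GHat →ₗ[ℝ] S.G} {X : 𝔡} :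
    X ∈ S.rSpace R ↔ ∃ γ : S.GHat, (γ : 𝔡) + R γ = X := by
  simp [rSpace]

theorem DressingCondition.apply_mem_rSpace {R : S.GHat →ₗ[ℝ] S.G} {A : 𝔡 →ₗ[ℝ] 𝔡}
    (h : S.DressingCondition R A) {X : 𝔡} (hX : X ∈ S.rSpace R) : A X ∈ S.rSpace R := by
  obtain ⟨γ, rfl⟩ := S.mem_rSpace.1 hX
  have hJHat : S.JHat (γ : 𝔡) = γ := by simp [JHat]
  have hextend : S.extend R (γ : 𝔡) = R γ := by simp [extend]
  have hJ (Y : 𝔡) : S.J (S.extend R Y) = S.extend R Y := by simp [extend, J]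
  have hA := LinearMap.congr_fun h (γ : 𝔡)
  simp only [LinearMap.add_apply, LinearMap.comp_apply, LinearMap.sub_apply, hJHat, hextend,
    map_sub, hJ] at hA
  have hgraph : S.extend R (A (γ + R γ)) = S.J (A (γ + R γ)) := by
    rw [map_add, map_add, map_add, ← hA]
    abel
  refine S.mem_rSpace.2 ⟨S.GHat.projectionOnto S.G S.isCompl.symm (A (γ + R γ)), ?_⟩
  change S.JHat (A (γ + R γ)) + S.extend R (A (γ + R γ)) = A (γ + R γ)
  rw [hgraph, S.JHat_add_J]

/-- Two mutually inverse isometries that preserve `ℛ`: what the invariance of `ℱ^⊥` and `K` needs of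
`Ad_f` and `Ad_{f⁻¹}`. -/
structure IsDressingPair (R : S.GHat →ₗ[ℝ] S.G) (A A' : 𝔡 →ₗ[ℝ] 𝔡) : Prop where
  apply_mem_rSpace : ∀ X ∈ S.rSpace R, A X ∈ S.rSpace R
  inv_apply_mem_rSpace : ∀ X ∈ S.rSpace R, A' X ∈ S.rSpace R
  apply_inv : ∀ X, A (A' X) = X
  inv_apply : ∀ X, A' (A X) = X
  form_apply : ∀ X Y, S.form (A X) (A Y) = S.form X Y

variable {S} {R : S.GHat →ₗ[ℝ] S.G}

namespace IsDressingPair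

variable {A A' : 𝔡 →ₗ[ℝ] 𝔡} (h : S.IsDressingPair R A A')

include h

theorem symm : S.IsDressingPair R A' A where
  apply_mem_rSpace := h.inv_apply_mem_rSpace
  inv_apply_mem_rSpace := h.apply_mem_rSpace
  apply_inv := h.inv_apply
  inv_apply := h.apply_inv
  form_apply X Y := by rw [← h.form_apply, h.apply_inv, h.apply_inv]

theorem map_rSpace : (S.rSpace R).map A = S.rSpace R := by
  refine le_antisymm ?_ fun X hX => ⟨A' X, h.inv_apply_mem_rSpace X hX, h.apply_inv X⟩
  rintro _ ⟨X, hX, rfl⟩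
  exact h.apply_mem_rSpace X hX

end IsDressingPair

variable [FiniteDimensional ℝ 𝔡]

theorem mem_rPerp {X : 𝔡} : X ∈ S.rPerp R ↔ ∃ γ : S.GHat, (γ : 𝔡) - S.adjoint R γ = X := by
  simp [rPerp]

theorem form_rSpace_rPerp {X Y : 𝔡} (hX : X ∈ S.rSpace R) (hY : Y ∈ S.rPerp R) :
    S.form X Y = 0 := by
  obtain ⟨γ, rfl⟩ := S.mem_rSpace.1 hX
  obtain ⟨δ, rfl⟩ := mem_rPerp.1 hY
  have hadjoint := S.form_adjoint R δ γ
  simp only [map_add, map_sub, LinearMap.add_apply, form_coe_g, form_coe_gHat]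
  linarith

theorem mem_rPerp_iff_forall {X : 𝔡} : X ∈ S.rPerp R ↔ ∀ Y ∈ S.rSpace R, S.form Y X = 0 := by
  refine ⟨fun hX Y hY => form_rSpace_rPerp hY hX, fun horth => ?_⟩
  obtain ⟨x, δ, rfl⟩ := S.exists_add X
  have hx : x + S.adjoint R δ = 0 := by
    refine S.toDual_injective ((LinearMap.ext fun γ => ?_).trans (map_zero _).symm)
    change S.form ((x + S.adjoint R δ : S.G) : 𝔡) γ = 0
    have hγ := horth _ (S.mem_rSpace.2 ⟨γ, rfl⟩)
    have hadjoint := S.form_adjoint R δ γ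
    simp only [map_add, LinearMap.add_apply, form_coe_g, form_coe_gHat] at hγ
    rw [S.symm.eq, Submodule.coe_add, map_add]
    linarith
  refine mem_rPerp.2 ⟨δ, ?_⟩
  simp [eq_neg_of_add_eq_zero_left hx, sub_eq_add_neg]

theorem mem_fSpace_iff {X : 𝔡} : X ∈ S.fSpace R ↔ X ∈ S.rSpace R ∧ X ∈ S.rPerp R := by
  constructor
  · rintro ⟨γ, hγ, rfl⟩
    have hker : R γ + S.adjoint R γ = 0 := LinearMap.mem_ker.1 hγ
    refine ⟨⟨γ, rfl⟩, mem_rPerp.2 ⟨γ, ?_⟩⟩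
    simp [eq_neg_of_add_eq_zero_left hker, sub_eq_add_neg]
  · rintro ⟨hX, hX'⟩
    obtain ⟨γ, rfl⟩ := S.mem_rSpace.1 hX
    obtain ⟨δ, hδ⟩ := mem_rPerp.1 hX'
    have hsplit : ((δ - γ : S.GHat) : 𝔡) = ((R γ + S.adjoint R δ : S.G) : 𝔡) := by
      rw [Submodule.coe_add, Submodule.coe_sub, sub_eq_iff_eq_add.1 hδ]
      abel
    have hzero : ((δ - γ : S.GHat) : 𝔡) = 0 :=
      Submodule.disjoint_def.1 S.isCompl.disjoint _ (hsplit ▸ Subtype.prop _) (Subtype.prop _)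
    obtain rfl : δ = γ := sub_eq_zero.1 (Subtype.ext hzero)
    exact ⟨δ, LinearMap.mem_ker.2 (Subtype.ext (hsplit.symm.trans hzero)), rfl⟩

theorem form_fSpace_fSpace {X Y : 𝔡} (hX : X ∈ S.fSpace R) (hY : Y ∈ S.fSpace R) :
    S.form X Y = 0 :=
  form_rSpace_rPerp (mem_fSpace_iff.1 hX).1 (mem_fSpace_iff.1 hY).2

theorem exists_rSpace_add_rPerp {X : 𝔡} (hX : X ∈ S.fPerp R) :
    ∃ P ∈ S.rSpace R, ∃ M ∈ S.rPerp R, P + M = X := by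
  rw [← range_combine] at hX
  obtain ⟨⟨γ, δ⟩, rfl⟩ := hX
  refine ⟨_, S.mem_rSpace.2 ⟨γ, rfl⟩, _, mem_rPerp.2 ⟨δ, rfl⟩, ?_⟩
  rw [combine_apply]
  abel

theorem K_add {P M : 𝔡} (hP : P ∈ S.rSpace R) (hM : M ∈ S.rPerp R) :
    S.K R (P + M) = S.form P P - S.form M M := by
  obtain ⟨γ, rfl⟩ := S.mem_rSpace.1 hP
  obtain ⟨δ, rfl⟩ := mem_rPerp.1 hM
  have hregroup : (γ : 𝔡) + R γ + ((δ : 𝔡) - S.adjoint R δ) =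
      (γ : 𝔡) + δ + R γ - S.adjoint R δ := by abel
  rw [hregroup, K_eq]
  have hsymm := S.symm.eq (γ : 𝔡) (R γ : 𝔡)
  have hsymm' := S.symm.eq (δ : 𝔡) (R δ : 𝔡)
  have hsymm'' := S.symm.eq (δ : 𝔡) (S.adjoint R δ : 𝔡)
  have hadjoint := S.form_adjoint R δ δ
  simp only [map_add, map_sub, LinearMap.add_apply, LinearMap.sub_apply, form_coe_g, form_coe_gHat]
  linarith

theorem K_add_of_mem_fSpace {X Y : 𝔡} (hX : X ∈ S.fPerp R) (hY : Y ∈ S.fSpace R) :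
    S.K R (Y + X) = S.K R X := by
  obtain ⟨P, hP, M, hM, rfl⟩ := exists_rSpace_add_rPerp hX
  obtain ⟨hYr, hYp⟩ := mem_fSpace_iff.1 hY
  have hYY : S.form Y Y = 0 := form_rSpace_rPerp hYr hYp
  have hPY : S.form P Y = 0 := form_rSpace_rPerp hP hYp
  have hYP : S.form Y P = 0 := (S.symm.eq Y P).trans hPY
  rw [← add_assoc, K_add (add_mem hYr hP) hM, K_add hP hM]
  simp only [map_add, LinearMap.add_apply, hYY, hPY, hYP, zero_add]

namespace IsDressingPair

variable {A A' : 𝔡 →ₗ[ℝ] 𝔡} (h : S.IsDressingPair R A A')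

include h

theorem apply_mem_rPerp {X : 𝔡} (hX : X ∈ S.rPerp R) : A X ∈ S.rPerp R := by
  rw [mem_rPerp_iff_forall] at hX ⊢
  intro Y hY
  rw [← h.apply_inv Y, h.form_apply]
  exact hX _ (h.inv_apply_mem_rSpace Y hY)

theorem map_rPerp : (S.rPerp R).map A = S.rPerp R := by
  refine le_antisymm ?_ fun X hX => ⟨A' X, h.symm.apply_mem_rPerp hX, h.apply_inv X⟩
  rintro _ ⟨X, hX, rfl⟩
  exact h.apply_mem_rPerp hX

theorem apply_mem_fSpace {X : 𝔡} (hX : X ∈ S.fSpace R) : A X ∈ S.fSpace R := by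
  rw [mem_fSpace_iff] at hX ⊢
  exact ⟨h.apply_mem_rSpace X hX.1, h.apply_mem_rPerp hX.2⟩

theorem apply_mem_fPerp {X : 𝔡} (hX : X ∈ S.fPerp R) : A X ∈ S.fPerp R := by
  intro Y hY
  rw [← h.apply_inv Y]
  exact (h.form_apply _ _).trans (hX _ (h.symm.apply_mem_fSpace hY))

theorem K_apply {X : 𝔡} (hX : X ∈ S.fPerp R) : S.K R (A X) = S.K R X := by
  obtain ⟨P, hP, M, hM, rfl⟩ := exists_rSpace_add_rPerp hX
  rw [map_add, K_add (h.apply_mem_rSpace P hP) (h.apply_mem_rPerp hM), K_add hP hM, h.form_apply,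
    h.form_apply]

end IsDressingPair

end DoubleAlgebra

section GaugeTwoForm

/-- The 2-form `⟨α ∧ β⟩(u, v) = B(α(u), β(v)) - B(α(v), β(u))` of two vector-valued 1-forms. -/
def wedgeTwoForm {E V : Type*} [NormedAddCommGroup E] [NormedSpace ℝ E] [NormedAddCommGroup V]
    [NormedSpace ℝ V] (B : V →L[ℝ] V →L[ℝ] ℝ) (α β : E → E →L[ℝ] V) (x : E) : E →L[ℝ] E →L[ℝ] ℝ :=
  B.bilinearComp (α x) (β x) - (B.bilinearComp (α x) (β x)).flip

section Wedge

variable {E V : Type*} [NormedAddCommGroup E] [NormedSpace ℝ E] [NormedAddCommGroup V]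
  [NormedSpace ℝ V] (B : V →L[ℝ] V →L[ℝ] ℝ) {α β : E → E →L[ℝ] V}

variable [FiniteDimensional ℝ E]

theorem contDiff_wedgeTwoForm (hα : ContDiff ℝ ∞ α) (hβ : ContDiff ℝ ∞ β) :
    ContDiff ℝ ∞ (wedgeTwoForm B α β) := by
  refine contDiff_clm_apply_iff.2 fun u => contDiff_clm_apply_iff.2 fun v => ?_
  have hB (u v : E) : ContDiff ℝ ∞ fun x => B (α x u) (β x v) :=
    (B.contDiff.comp (hα.clm_apply contDiff_const)).clm_apply (hβ.clm_apply contDiff_const)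
  exact (hB u v).sub (hB v u)

theorem fderiv_wedgeTwoForm (hα : ContDiff ℝ ∞ α) (hβ : ContDiff ℝ ∞ β) (x u v w : E) :
    fderiv ℝ (wedgeTwoForm B α β) x u v w =
      B (fderiv ℝ α x u v) (β x w) + B (α x v) (fderiv ℝ β x u w)
        - B (fderiv ℝ α x u w) (β x v) - B (α x w) (fderiv ℝ β x u v) := by
  have hdα := (hα.differentiable (by simp) x).hasFDerivAt
  have hdβ := (hβ.differentiable (by simp) x).hasFDerivAt
  have hdB (v w : E) : HasFDerivAt (fun y => B (α y v) (β y w)) _ x :=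
    (B.hasFDerivAt.comp x (hdα.clm_apply (hasFDerivAt_const v x))).clm_apply
      (hdβ.clm_apply (hasFDerivAt_const w x))
  rw [← fderiv_clm_apply_apply ((contDiff_wedgeTwoForm B hα hβ).differentiable (by simp) x)]
  have heq := DFunLike.congr_fun ((hdB v w).sub (hdB w v)).fderiv u
  simp only [ContinuousLinearMap.comp_apply, ContinuousLinearMap.flip_apply, add_apply, sub_apply,
    zero_apply, map_zero, zero_add, Function.comp_apply] at heq
  refine heq.trans ?_
  ring

theorem fderiv_wedgeTwoForm_cyclic (hα : ContDiff ℝ ∞ α) (hβ : ContDiff ℝ ∞ β) (x u v w : E) :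
    fderiv ℝ (wedgeTwoForm B α β) x u v w + fderiv ℝ (wedgeTwoForm B α β) x v w u
      + fderiv ℝ (wedgeTwoForm B α β) x w u v =
      (B (fderiv ℝ α x u v - fderiv ℝ α x v u) (β x w)
          - B (α x w) (fderiv ℝ β x u v - fderiv ℝ β x v u))
        + (B (fderiv ℝ α x v w - fderiv ℝ α x w v) (β x u)
          - B (α x u) (fderiv ℝ β x v w - fderiv ℝ β x w v))
        + (B (fderiv ℝ α x w u - fderiv ℝ α x u w) (β x v)
          - B (α x v) (fderiv ℝ β x w u - fderiv ℝ β x u w)) := by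
  simp only [fderiv_wedgeTwoForm B hα hβ, map_sub, sub_apply]
  ring

end Wedge

variable {m : ℕ} {D : Type*} [TopologicalSpace D] [ChartedSpace (EuclideanSpace ℝ (Fin m)) D]
  [Group D] [LieGroup (𝓡 m) ∞ D] {E : Type*} [NormedAddCommGroup E] [NormedSpace ℝ E]
  (S : DoubleAlgebra (GroupLieAlgebra (𝓡 m) D))

/-- The 1-form `Ad_h (dl l⁻¹)`, defined as the difference of the Maurer–Cartan forms of `h l` and
`h`, so that the Maurer–Cartan equation applies to it. -/
def adMcForm (h l : E → D) : E → E →L[ℝ] Vec m :=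
  mcForm (fun y => h y * l y) - mcForm h

/-- The change of `b + 6 ⟨dl l⁻¹ ∧, dl l⁻¹⟩` under `l ↦ h l`, up to terms that cancel:
`(h l)^* b - l^* b + 6 ⟨dh h⁻¹ ∧ Ad_h (dl l⁻¹)⟩`. -/
def gaugeTwoForm (b : D → LinearMap.BilinForm ℝ (GroupLieAlgebra (𝓡 m) D)) (h l : E → D) :
    E → E →L[ℝ] E →L[ℝ] ℝ :=
  pullTwoForm b (fun y => h y * l y) - pullTwoForm b l
    + wedgeTwoForm ((6 : ℝ) • formCLM S) (mcForm h) (adMcForm h l)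

theorem formCLM_bracketCLM_left (X Y Z : Vec m) :
    formCLM S (bracketCLM D X Y) Z = formCLM S X (bracketCLM D Y Z) := by
  rw [formCLM_symm, formCLM_bracketCLM_rotate S Y Z X, formCLM_bracketCLM_rotate S X Y Z]

-- With `X = d(hl)(hl)⁻¹` and `Y = dh h⁻¹` this is the vanishing of the exterior derivative of
-- `gaugeTwoForm`.
theorem formCLM_bracketCLM_sub_cyclic {Y₁ Y₂ Y₃ : Vec m}
    (hY : formCLM S Y₁ (bracketCLM D Y₂ Y₃) = 0) (X₁ X₂ X₃ : Vec m) :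
    formCLM S X₁ (bracketCLM D X₂ X₃)
      - formCLM S (X₁ - Y₁) (bracketCLM D (X₂ - Y₂) (X₃ - Y₃))
      + ((formCLM S (bracketCLM D Y₁ Y₂) (X₃ - Y₃)
          - formCLM S Y₃ (bracketCLM D X₁ X₂ - bracketCLM D Y₁ Y₂))
        + (formCLM S (bracketCLM D Y₂ Y₃) (X₁ - Y₁)
          - formCLM S Y₁ (bracketCLM D X₂ X₃ - bracketCLM D Y₂ Y₃))
        + (formCLM S (bracketCLM D Y₃ Y₁) (X₂ - Y₂)
          - formCLM S Y₂ (bracketCLM D X₃ X₁ - bracketCLM D Y₃ Y₁))) = 0 := by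
  have hrotate (X Y Z : Vec m) : formCLM S Z (bracketCLM D X Y) = formCLM S X (bracketCLM D Y Z) :=
    (formCLM_symm S _ _).trans (formCLM_bracketCLM_left S X Y Z)
  rw [formCLM_symm S (bracketCLM D Y₂ Y₃), formCLM_bracketCLM_left, formCLM_bracketCLM_left,
    hrotate Y₁ (X₂ - Y₂) Y₃]
  simp only [map_sub, sub_apply]
  rw [hrotate X₁ X₂ Y₃, hrotate X₃ X₁ Y₂, hrotate X₁ Y₂ X₃, hrotate Y₃ Y₁ Y₂, hrotate Y₁ Y₂ Y₃, hY]
  ring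

variable {S} {b : D → LinearMap.BilinForm ℝ (GroupLieAlgebra (𝓡 m) D)} {h l : E → D}

theorem adMcForm_apply (hh : ContMDiff 𝓘(ℝ, E) (𝓡 m) ∞ h) (hl : ContMDiff 𝓘(ℝ, E) (𝓡 m) ∞ l)
    (x u : E) : adMcForm (m := m) h l x u = adCLM (h x) (mcForm l x u) := by
  have hmul := mcForm_mul (m := m) (hh.mdifferentiableAt (x := x) (by simp))
    (hl.mdifferentiableAt (by simp))
  exact sub_eq_of_eq_add' (DFunLike.congr_fun hmul u)

theorem formCLM_bracketCLM_adMcForm (hh : ContMDiff 𝓘(ℝ, E) (𝓡 m) ∞ h)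
    (hl : ContMDiff 𝓘(ℝ, E) (𝓡 m) ∞ l)
    (hAd : ∀ x X Y, formCLM S (adCLM (h x) X) (adCLM (h x) Y) = formCLM S X Y) (x u v w : E) :
    formCLM S (adMcForm h l x u) (bracketCLM D (adMcForm h l x v) (adMcForm h l x w)) =
      formCLM S (mcForm l x u) (bracketCLM D (mcForm l x v) (mcForm l x w)) := by
  simp only [adMcForm_apply hh hl]
  rw [← adCLM_bracketCLM, hAd]

theorem gaugeTwoForm_apply (hh : ContMDiff 𝓘(ℝ, E) (𝓡 m) ∞ h) (hl : ContMDiff 𝓘(ℝ, E) (𝓡 m) ∞ l)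
    (x u v : E) :
    gaugeTwoForm S b h l x u v = pullTwoForm b (fun y => h y * l y) x u v - pullTwoForm b l x u v +
      6 * (formCLM S (mcForm h x u) (adCLM (h x) (mcForm l x v)) -
        formCLM S (mcForm h x v) (adCLM (h x) (mcForm l x u))) := by
  rw [mul_sub, ← adMcForm_apply hh hl, ← adMcForm_apply hh hl]
  rfl

theorem IsPotential.pullTwoForm_self (hb : IsPotential S b) (Φ : E → D) (x u : E) :
    pullTwoForm b Φ x u u = 0 :=
  hb.alt _ _

theorem contDiff_adMcForm (hh : ContMDiff 𝓘(ℝ, E) (𝓡 m) ∞ h) (hl : ContMDiff 𝓘(ℝ, E) (𝓡 m) ∞ l) :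
    ContDiff ℝ ∞ (adMcForm (m := m) h l) :=
  (contDiff_mcForm (hh.mul hl)).sub (contDiff_mcForm hh)

theorem fderiv_adMcForm_sub (hh : ContMDiff 𝓘(ℝ, E) (𝓡 m) ∞ h)
    (hl : ContMDiff 𝓘(ℝ, E) (𝓡 m) ∞ l) (x u v : E) :
    fderiv ℝ (adMcForm (m := m) h l) x u v - fderiv ℝ (adMcForm (m := m) h l) x v u =
      bracketCLM D (mcForm (fun y => h y * l y) x u) (mcForm (fun y => h y * l y) x v)
        - bracketCLM D (mcForm h x u) (mcForm h x v) := by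
  have hhl : ContMDiff 𝓘(ℝ, E) (𝓡 m) ∞ (fun y => h y * l y) := hh.mul hl
  have hsub : fderiv ℝ (adMcForm (m := m) h l) x =
      fderiv ℝ (mcForm fun y => h y * l y) x - fderiv ℝ (mcForm h) x :=
    fderiv_sub ((contDiff_mcForm hhl).differentiable (by simp) x)
      ((contDiff_mcForm hh).differentiable (by simp) x)
  rw [hsub, ← fderiv_mcForm_sub hhl, ← fderiv_mcForm_sub hh]
  simp only [sub_apply]
  abel

variable [FiniteDimensional ℝ E]

theorem contDiff_gaugeTwoForm (hb : IsPotential S b) (hh : ContMDiff 𝓘(ℝ, E) (𝓡 m) ∞ h)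
    (hl : ContMDiff 𝓘(ℝ, E) (𝓡 m) ∞ l) : ContDiff ℝ ∞ (gaugeTwoForm S b h l) :=
  ((hb.contDiff_pullTwoForm (hh.mul hl)).sub (hb.contDiff_pullTwoForm hl)).add
    (contDiff_wedgeTwoForm _ (contDiff_mcForm hh) (contDiff_adMcForm hh hl))

theorem fderiv_gaugeTwoForm (hb : IsPotential S b) (hh : ContMDiff 𝓘(ℝ, E) (𝓡 m) ∞ h)
    (hl : ContMDiff 𝓘(ℝ, E) (𝓡 m) ∞ l) (x u v w : E) :
    fderiv ℝ (gaugeTwoForm S b h l) x u v w =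
      fderiv ℝ (pullTwoForm b fun y => h y * l y) x u v w - fderiv ℝ (pullTwoForm b l) x u v w
        + fderiv ℝ (wedgeTwoForm ((6 : ℝ) • formCLM S) (mcForm h) (adMcForm h l)) x u v w := by
  have hdhl := (hb.contDiff_pullTwoForm (hh.mul hl)).differentiable (by simp) x
  have hdl := (hb.contDiff_pullTwoForm hl).differentiable (by simp) x
  have hdwedge := (contDiff_wedgeTwoForm ((6 : ℝ) • formCLM S) (contDiff_mcForm hh)
    (contDiff_adMcForm hh hl)).differentiable (by simp) x
  have hsum := (hdhl.hasFDerivAt.sub hdl.hasFDerivAt).add hdwedge.hasFDerivAt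
  exact DFunLike.congr_fun (DFunLike.congr_fun (DFunLike.congr_fun hsum.fderiv u) v) w

theorem isClosedTwoForm_gaugeTwoForm (hb : IsPotential S b) (hh : ContMDiff 𝓘(ℝ, E) (𝓡 m) ∞ h)
    (hl : ContMDiff 𝓘(ℝ, E) (𝓡 m) ∞ l)
    (hcubic : ∀ x u v w,
      formCLM S (mcForm h x u) (bracketCLM D (mcForm h x v) (mcForm h x w)) = 0)
    (hAd : ∀ x X Y, formCLM S (adCLM (h x) X) (adCLM (h x) Y) = formCLM S X Y) :
    IsClosedTwoForm (gaugeTwoForm S b h l) where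
  contDiff := contDiff_gaugeTwoForm hb hh hl
  alternating x u := by
    rw [gaugeTwoForm_apply hh hl, hb.pullTwoForm_self, hb.pullTwoForm_self]
    ring
  closed x u v w := by
    have hhl : ContMDiff 𝓘(ℝ, E) (𝓡 m) ∞ (fun y => h y * l y) := hh.mul hl
    have hdhl := hb.fderiv_pullTwoForm_cyclic hhl x u v w
    have hdl := hb.fderiv_pullTwoForm_cyclic hl x u v w
    have hdwedge := fderiv_wedgeTwoForm_cyclic ((6 : ℝ) • formCLM S) (contDiff_mcForm hh)
      (contDiff_adMcForm hh hl) x u v w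
    have halgebra := formCLM_bracketCLM_sub_cyclic S (hcubic x u v w)
      (mcForm (fun y => h y * l y) x u) (mcForm (fun y => h y * l y) x v)
      (mcForm (fun y => h y * l y) x w)
    have hsub (z : E) : adMcForm (m := m) h l x z =
        mcForm (fun y => h y * l y) x z - mcForm h x z := rfl
    rw [← formCLM_bracketCLM_adMcForm hh hl hAd] at hdl
    simp only [fderiv_adMcForm_sub hh hl, fderiv_mcForm_sub hh, hsub, smul_apply, smul_eq_mul]
      at hdl hdwedge
    simp only [fderiv_gaugeTwoForm hb hh hl]
    linarith

end GaugeTwoForm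

section Integrals

theorem setIntegral_swap_of_continuous {E₁ E₂ : Type*} [NormedAddCommGroup E₁] [NormedSpace ℝ E₁]
    [FiniteDimensional ℝ E₁] [MeasurableSpace E₁] [BorelSpace E₁]
    [NormedAddCommGroup E₂] [NormedSpace ℝ E₂] [FiniteDimensional ℝ E₂] [MeasurableSpace E₂]
    [BorelSpace E₂] (μ : Measure E₁) (ν : Measure E₂) [IsLocallyFiniteMeasure μ]
    [IsLocallyFiniteMeasure ν] {A : Set E₁} {B : Set E₂} (hA : Bornology.IsBounded A)
    (hB : Bornology.IsBounded B) {g : E₁ × E₂ → ℝ} (hg : Continuous g) :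
    ∫ x in A, ∫ y in B, g (x, y) ∂ν ∂μ = ∫ y in B, ∫ x in A, g (x, y) ∂μ ∂ν := by
  have := FiniteDimensional.proper ℝ E₁
  have := FiniteDimensional.proper ℝ E₂
  refine integral_integral_swap (f := fun x y => g (x, y)) ?_
  rw [Measure.prod_restrict]
  exact (hg.continuousOn.integrableOn_compact
    (hA.isCompact_closure.prod hB.isCompact_closure)).mono_set
      (Set.prod_mono subset_closure subset_closure)

variable {E : Type*} [NormedAddCommGroup E] [NormedSpace ℝ E]

theorem setIntegral_eq_of_setIntegral_deriv_eq_zero [FiniteDimensional ℝ E] [MeasurableSpace E]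
    [BorelSpace E] (μ : Measure E) [IsLocallyFiniteMeasure μ] {A : Set E}
    (hA : Bornology.IsBounded A) {g g' : E → ℝ → ℝ}
    (hderiv : ∀ x t, HasDerivAt (g x) (g' x t) t) (hg : Continuous fun p : E × ℝ => g p.1 p.2)
    (hg' : Continuous fun p : E × ℝ => g' p.1 p.2) (hzero : ∀ t, ∫ x in A, g' x t ∂μ = 0) :
    ∫ x in A, g x 1 ∂μ = ∫ x in A, g x 0 ∂μ := by
  have := FiniteDimensional.proper ℝ E
  have hint (t : ℝ) : IntegrableOn (fun x => g x t) A μ :=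
    ((hg.comp (Continuous.prodMk_left t)).continuousOn.integrableOn_compact
      hA.isCompact_closure).mono_set subset_closure
  have hline (x : E) : g x 1 - g x 0 = ∫ t in Set.Ioc (0 : ℝ) 1, g' x t := by
    rw [← intervalIntegral.integral_of_le zero_le_one,
      intervalIntegral.integral_eq_sub_of_hasDerivAt (fun t _ => hderiv x t)
        ((hg'.comp (Continuous.prodMk_right x)).intervalIntegrable _ _)]
  rw [← sub_eq_zero, ← integral_sub (hint 1) (hint 0)]
  simp only [hline]
  rw [setIntegral_swap_of_continuous μ volume hA (Metric.isBounded_Ioc 0 1) hg']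
  simp only [hzero, integral_zero]

theorem hasDerivAt_comp_add_smul {F : Type*} [NormedAddCommGroup F] [NormedSpace ℝ F] {g : E → F}
    {x v : E} {t : ℝ} (hg : DifferentiableAt ℝ g (x + t • v)) :
    HasDerivAt (fun t : ℝ => g (x + t • v)) (fderiv ℝ g (x + t • v) v) t := by
  have hline : HasDerivAt (fun t : ℝ => x + t • v) v t := by
    simpa using ((hasDerivAt_id t).smul_const v).const_add x
  exact hg.hasFDerivAt.comp_hasDerivAt t hline

theorem sub_eq_integral_fderiv {g : E → ℝ} (hg : ContDiff ℝ 1 g) (x v : E) :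
    g (x + v) - g x = ∫ t in Set.Ioc (0 : ℝ) 1, fderiv ℝ g (x + t • v) v := by
  have hcont : Continuous fun t : ℝ => fderiv ℝ g (x + t • v) v :=
    ((hg.continuous_fderiv one_ne_zero).comp
      (by fun_prop : Continuous fun t : ℝ => x + t • v)).clm_apply continuous_const
  rw [← intervalIntegral.integral_of_le zero_le_one,
    intervalIntegral.integral_eq_sub_of_hasDerivAt
      (fun t _ => hasDerivAt_comp_add_smul (hg.differentiable one_ne_zero _))
      (hcont.intervalIntegrable _ _)]
  simp

theorem integral_fderiv_eq_zero_of_hasCompactSupport [FiniteDimensional ℝ E] [MeasurableSpace E]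
    [BorelSpace E] (μ : Measure E) [μ.IsAddHaarMeasure] {g : E → ℝ} (hg : ContDiff ℝ 1 g)
    (hsupp : HasCompactSupport g) (v : E) : ∫ x, fderiv ℝ g x v ∂μ = 0 := by
  have hcont : Continuous fun x => fderiv ℝ g x v :=
    (hg.continuous_fderiv one_ne_zero).clm_apply continuous_const
  have hderiv : Integrable (fun x => fderiv ℝ g x v) μ :=
    hcont.integrable_of_hasCompactSupport (hsupp.fderiv_apply (𝕜 := ℝ) v)
  have hint : Integrable g μ := hg.continuous.integrable_of_hasCompactSupport hsupp
  have hparts := integral_smul_fderiv_eq_neg_fderiv_smul_of_integrable (𝕜 := ℝ) (μ := μ)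
    (f := fun _ => (1 : ℝ)) (g := g) (v := v) (by simp) (by simpa using hderiv)
    (by simpa using hint) (fun x _ => by fun_prop) (fun x _ => hg.differentiable one_ne_zero x)
  simpa using hparts

end Integrals

section Homotopy

namespace IsClosedTwoForm

variable {η : ℝ × (ℝ × ℝ) → ℝ × (ℝ × ℝ) →L[ℝ] ℝ × (ℝ × ℝ) →L[ℝ] ℝ}

theorem contDiff_slice (hη : IsClosedTwoForm η) (t : ℝ) (u v : ℝ × (ℝ × ℝ)) :
    ContDiff ℝ ∞ fun x : ℝ × ℝ => η (t, x) u v :=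
  ((hη.contDiff.clm_apply contDiff_const).clm_apply contDiff_const).comp
    (contDiff_const.prodMk contDiff_id)

theorem fderiv_slice (hη : IsClosedTwoForm η) (t : ℝ) (x w : ℝ × ℝ) (u v : ℝ × (ℝ × ℝ)) :
    fderiv ℝ (fun x : ℝ × ℝ => η (t, x) u v) x w = fderiv ℝ η (t, x) (0, w) u v := by
  rw [← fderiv_clm_apply_apply (hη.contDiff.differentiable (by simp) (t, x))]
  have happly : DifferentiableAt ℝ (fun p => η p u v) (t, x) :=
    ((hη.contDiff.clm_apply contDiff_const).clm_apply contDiff_const).differentiable (by simp) _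
  exact DFunLike.congr_fun (happly.hasFDerivAt.comp x (hasFDerivAt_prodMk_right t x)).fderiv w

theorem integral_fderiv_eq_zero (hη : IsClosedTwoForm η) {K : Set (ℝ × ℝ)} (hK : IsCompact K)
    (hzero : ∀ t, ∀ x ∉ K, η (t, x) = 0) (t : ℝ) :
    ∫ x, fderiv ℝ η (t, x) (1, 0) (0, (1, 0)) (0, (0, 1)) = 0 := by
  have hsupp (u v : ℝ × (ℝ × ℝ)) : HasCompactSupport fun x : ℝ × ℝ => η (t, x) u v :=
    HasCompactSupport.intro hK fun x hx => by simp [hzero t x hx]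
  have hdiv (x : ℝ × ℝ) : fderiv ℝ η (t, x) (1, 0) (0, (1, 0)) (0, (0, 1)) =
      -(fderiv ℝ (fun x => η (t, x) (0, (0, 1)) (1, 0)) x (1, 0)
        + fderiv ℝ (fun x => η (t, x) (1, 0) (0, (1, 0))) x (0, 1)) := by
    rw [hη.fderiv_slice, hη.fderiv_slice]
    linarith [hη.closed (t, x) (1, 0) (0, (1, 0)) (0, (0, 1))]
  have hint (u v : ℝ × (ℝ × ℝ)) (w : ℝ × ℝ) :
      Integrable fun x : ℝ × ℝ => fderiv ℝ (fun x => η (t, x) u v) x w :=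
    (((hη.contDiff_slice t u v).continuous_fderiv (by simp)).clm_apply
      continuous_const).integrable_of_hasCompactSupport ((hsupp u v).fderiv_apply (𝕜 := ℝ) w)
  have hvanish (u v : ℝ × (ℝ × ℝ)) (w : ℝ × ℝ) :
      ∫ x, fderiv ℝ (fun x => η (t, x) u v) x w = 0 :=
    integral_fderiv_eq_zero_of_hasCompactSupport volume ((hη.contDiff_slice t u v).of_le (by simp))
      (hsupp u v) w
  simp only [hdiv]
  rw [integral_neg, integral_add (hint _ _ _) (hint _ _ _), hvanish, hvanish, add_zero, neg_zero]

theorem integral_one_eq_integral_zero (hη : IsClosedTwoForm η) {K : Set (ℝ × ℝ)}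
    (hK : IsCompact K) (hzero : ∀ t, ∀ x ∉ K, η (t, x) = 0) :
    ∫ x, η (1, x) (0, (1, 0)) (0, (0, 1)) = ∫ x, η (0, x) (0, (1, 0)) (0, (0, 1)) := by
  have hint (t : ℝ) : Integrable fun x : ℝ × ℝ => η (t, x) (0, (1, 0)) (0, (0, 1)) :=
    (hη.contDiff_slice t _ _).continuous.integrable_of_hasCompactSupport
      (HasCompactSupport.intro hK fun x hx => by simp [hzero t x hx])
  have hfderiv_zero (t : ℝ) (x : ℝ × ℝ) (hx : x ∉ K) :
      fderiv ℝ η (t, x) (1, 0) (0, (1, 0)) (0, (0, 1)) = 0 := by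
    have hnhds : η =ᶠ[𝓝 (t, x)] fun _ => 0 := by
      filter_upwards [(hK.isClosed.isOpen_compl.preimage continuous_snd).mem_nhds hx] with p hp
      exact hzero p.1 p.2 hp
    rw [hnhds.fderiv_eq]
    simp
  have hline (x : ℝ × ℝ) : η (1, x) (0, (1, 0)) (0, (0, 1)) - η (0, x) (0, (1, 0)) (0, (0, 1)) =
      ∫ t in Set.Ioc (0 : ℝ) 1, fderiv ℝ η (t, x) (1, 0) (0, (1, 0)) (0, (0, 1)) := by
    have hsub := sub_eq_integral_fderiv
      (((hη.contDiff.clm_apply (contDiff_const (c := (0, (1, 0))))).clm_apply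
        (contDiff_const (c := (0, (0, 1))))).of_le (by simp)) (0, x) (1, 0)
    simpa [fderiv_clm_apply_apply (hη.contDiff.differentiable (by simp) _)] using hsub
  have hcont : Continuous fun p : (ℝ × ℝ) × ℝ =>
      fderiv ℝ η (p.2, p.1) (1, 0) (0, (1, 0)) (0, (0, 1)) :=
    ((((hη.contDiff.continuous_fderiv (by simp)).comp continuous_swap).clm_apply
      continuous_const).clm_apply continuous_const).clm_apply continuous_const
  rw [← sub_eq_zero, ← integral_sub (hint 1) (hint 0)]
  calc ∫ x, (η (1, x) (0, (1, 0)) (0, (0, 1)) - η (0, x) (0, (1, 0)) (0, (0, 1)))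
      = ∫ x in K, ∫ t in Set.Ioc (0 : ℝ) 1,
          fderiv ℝ η (t, x) (1, 0) (0, (1, 0)) (0, (0, 1)) := by
        rw [← setIntegral_eq_integral_of_forall_compl_eq_zero (s := K)
          fun x hx => by simp [hzero _ x hx]]
        simp only [hline]
    _ = ∫ t in Set.Ioc (0 : ℝ) 1, ∫ x in K,
          fderiv ℝ η (t, x) (1, 0) (0, (1, 0)) (0, (0, 1)) :=
        setIntegral_swap_of_continuous volume volume hK.isBounded (Metric.isBounded_Ioc 0 1) hcont
    _ = 0 := by
        simp only [setIntegral_eq_integral_of_forall_compl_eq_zero (hfderiv_zero _),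
          hη.integral_fderiv_eq_zero hK hzero, integral_zero]

end IsClosedTwoForm

end Homotopy

section UnitCube

/-- The fundamental domain `[0, 1)^ι` of the lattice `ℤ^ι`. -/
def unitCube (ι : Type*) : Set (ι → ℝ) := Set.univ.pi fun _ => Set.Ico 0 1

/-- Functions on `ℝ^ι` that are periodic with respect to the lattice `ℤ^ι`, that is, functions on
the torus. -/
def IsUnitPeriodic {ι β : Type*} [DecidableEq ι] (g : (ι → ℝ) → β) : Prop :=
  ∀ x i, g (x + Pi.single i 1) = g x

variable {ι : Type*}

theorem isBounded_unitCube : Bornology.IsBounded (unitCube ι) :=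
  Bornology.IsBounded.pi fun _ => Metric.isBounded_Ico 0 1

theorem IsUnitPeriodic.fderiv [Finite ι] [DecidableEq ι] {β : Type*} [NormedAddCommGroup β]
    [NormedSpace ℝ β] {g : (ι → ℝ) → β} (hg : IsUnitPeriodic g) :
    IsUnitPeriodic (fderiv ℝ g) := by
  have := Fintype.ofFinite ι
  intro x i
  rw [← fderiv_comp_add_right]
  exact congrArg (_root_.fderiv ℝ · x) (funext fun y => hg y i)

theorem IsUnitPeriodic.add_of_mem_span [Finite ι] [DecidableEq ι] {β : Type*}
    {g : (ι → ℝ) → β} (hg : IsUnitPeriodic g) {c : ι → ℝ}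
    (hc : c ∈ Submodule.span ℤ (Set.range (Pi.basisFun ℝ ι))) (x : ι → ℝ) :
    g (x + c) = g x := by
  induction hc using Submodule.span_induction generalizing x with
  | mem y hy =>
    obtain ⟨i, rfl⟩ := hy
    simpa using hg x i
  | zero => simp
  | add y z _ _ hy hz => rw [← add_assoc, hz, hy]
  | smul a y _ hy =>
    induction a using Int.induction_on generalizing x with
    | zero => simp
    | succ n ih => rw [add_smul, one_smul, ← add_assoc, hy, ih]
    | pred n ih => rw [sub_smul, one_smul, ← hy (x + _), add_assoc, sub_add_cancel, ih]

variable [Fintype ι]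

theorem volume_real_unitCube : (volume : Measure (ι → ℝ)).real (unitCube ι) = 1 := by
  simp [Measure.real, unitCube, volume_pi_pi]

theorem integrableOn_unitCube {g : (ι → ℝ) → ℝ} (hg : Continuous g) :
    IntegrableOn g (unitCube ι) :=
  (hg.continuousOn.integrableOn_compact isBounded_unitCube.isCompact_closure).mono_set
    subset_closure

variable [DecidableEq ι]

open scoped Pointwise in
theorem setIntegral_unitCube_add {g : (ι → ℝ) → ℝ} (hg : IsUnitPeriodic g) (v : ι → ℝ) :
    ∫ x in unitCube ι, g (x + v) = ∫ x in unitCube ι, g x := by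
  have hdomain : IsAddFundamentalDomain (Submodule.span ℤ (Set.range (Pi.basisFun ℝ ι)))
      (unitCube ι) (volume : Measure (ι → ℝ)) := by
    rw [unitCube, ← ZSpan.fundamentalDomain_pi_basisFun]
    exact ZSpan.isAddFundamentalDomain (Pi.basisFun ℝ ι) volume
  have hinvariant (c : Submodule.span ℤ (Set.range (Pi.basisFun ℝ ι))) (x : ι → ℝ) :
      g (c +ᵥ x) = g x :=
    (congrArg g (add_comm (c : ι → ℝ) x)).trans (hg.add_of_mem_span c.2 x)
  have : VAddInvariantMeasure (Submodule.span ℤ (Set.range (Pi.basisFun ℝ ι))) (ι → ℝ) volume :=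
    ⟨fun c s _ => measure_preimage_add volume (c : ι → ℝ) s⟩
  have himage : (fun x => x + v) '' unitCube ι = v +ᵥ unitCube ι :=
    congrArg (· '' unitCube ι) (funext fun x => add_comm x v)
  rw [← (hdomain.vadd_of_comm v).setIntegral_eq hdomain hinvariant, ← himage]
  exact ((measurePreserving_add_right volume v).setIntegral_image_emb
    (measurableEmbedding_addRight v) g (unitCube ι)).symm

theorem setIntegral_unitCube_fderiv {g : (ι → ℝ) → ℝ} (hg : IsUnitPeriodic g)
    (hsmooth : ContDiff ℝ 1 g) (v : ι → ℝ) : ∫ x in unitCube ι, fderiv ℝ g x v = 0 := by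
  have hperiodic : IsUnitPeriodic fun x => fderiv ℝ g x v := fun x i => by
    simp only [hg.fderiv x i]
  have hcont : Continuous fun p : (ι → ℝ) × ℝ => fderiv ℝ g (p.1 + p.2 • v) v :=
    ((hsmooth.continuous_fderiv one_ne_zero).comp (by fun_prop)).clm_apply continuous_const
  have hint : IntegrableOn (fun x => g (x + v)) (unitCube ι) :=
    integrableOn_unitCube (hsmooth.continuous.comp (continuous_add_const v))
  calc ∫ x in unitCube ι, fderiv ℝ g x v
      = ∫ t in Set.Ioc (0 : ℝ) 1, ∫ x in unitCube ι, fderiv ℝ g (x + t • v) v := by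
        simp only [fun t : ℝ => setIntegral_unitCube_add hperiodic (t • v)]
        simp
    _ = ∫ x in unitCube ι, (g (x + v) - g x) := by
        simp only [sub_eq_integral_fderiv hsmooth]
        exact (setIntegral_swap_of_continuous volume volume isBounded_unitCube
          (Metric.isBounded_Ioc 0 1) hcont).symm
    _ = 0 := by
        rw [integral_sub hint (integrableOn_unitCube hsmooth.continuous),
          setIntegral_unitCube_add hg, sub_self]

end UnitCube

section Pfaffian

/-- The standard basis vectors of `ℝ^ι`. -/
abbrev stdVec {ι : Type*} [DecidableEq ι] (a : ι) : ι → ℝ := Pi.single a 1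

/-- The bilinear forms on `ℝ^(κ × 2)`, the space in which the coordinates come in pairs. -/
abbrev BlockForm (κ : Type*) [Fintype κ] : Type _ :=
  (κ × Fin 2 → ℝ) →L[ℝ] (κ × Fin 2 → ℝ) →L[ℝ] ℝ

variable {κ : Type*} [Fintype κ] [DecidableEq κ]

/-- The polarized Pfaffian of a family of two-forms on `ℝ^(κ × 2)`, that is, the value of their
wedge product on the standard basis. It is normalized without the customary factor
`1 / (2 ^ |κ| * |κ|!)`. -/
def pfaffian (M : κ → BlockForm κ) : ℝ :=
  ∑ σ : Equiv.Perm (κ × Fin 2), (Equiv.Perm.sign σ : ℝ) *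
    ∏ j, M j (stdVec (σ (j, 0))) (stdVec (σ (j, 1)))

/-- The product of all the factors except the `j`-th in the term of the Pfaffian indexed by `σ`. -/
def pfaffianCofactor (M : κ → BlockForm κ) (j : κ) (σ : Equiv.Perm (κ × Fin 2)) : ℝ :=
  ∏ i ∈ Finset.univ.erase j, M i (stdVec (σ (i, 0))) (stdVec (σ (i, 1)))

/-- The Pfaffian as a linear function of its `j`-th argument, the others being fixed. -/
def pfaffianSlot (M : κ → BlockForm κ) (j : κ) : BlockForm κ →L[ℝ] ℝ :=
  ∑ σ : Equiv.Perm (κ × Fin 2), ((Equiv.Perm.sign σ : ℝ) * pfaffianCofactor M j σ) •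
    (ContinuousLinearMap.apply ℝ ℝ (stdVec (σ (j, 1)))).comp
      (ContinuousLinearMap.apply ℝ _ (stdVec (σ (j, 0))))

theorem pfaffianSlot_apply (M : κ → BlockForm κ) (j : κ) (A : BlockForm κ) :
    pfaffianSlot M j A = ∑ σ : Equiv.Perm (κ × Fin 2), (Equiv.Perm.sign σ : ℝ) *
      (A (stdVec (σ (j, 0))) (stdVec (σ (j, 1))) * pfaffianCofactor M j σ) := by
  simp only [pfaffianSlot, sum_apply]
  refine Finset.sum_congr rfl fun σ _ => ?_
  change _ * (A (stdVec (σ (j, 0))) (stdVec (σ (j, 1)))) = _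
  ring

theorem pfaffian_update (M : κ → BlockForm κ) (j : κ) (A : BlockForm κ) :
    pfaffian (Function.update M j A) = pfaffianSlot M j A := by
  rw [pfaffianSlot_apply, pfaffian]
  refine Finset.sum_congr rfl fun σ _ => ?_
  rw [← Finset.mul_prod_erase _ _ (Finset.mem_univ j), Function.update_self, pfaffianCofactor]
  congr 2
  refine Finset.prod_congr rfl fun i hi => ?_
  rw [Function.update_of_ne (Finset.ne_of_mem_erase hi)]

theorem pfaffianSlot_self (M : κ → BlockForm κ) (j : κ) : pfaffianSlot M j (M j) = pfaffian M := by
  rw [← pfaffian_update, Function.update_eq_self]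

theorem pfaffianSlot_flip (M : κ → BlockForm κ) (j : κ) (A : BlockForm κ) :
    pfaffianSlot M j A.flip = -pfaffianSlot M j A := by
  have hcofactor (σ : Equiv.Perm (κ × Fin 2)) :
      pfaffianCofactor M j (σ * Equiv.swap (j, 0) (j, 1)) = pfaffianCofactor M j σ := by
    refine Finset.prod_congr rfl fun i hi => ?_
    have hij := Finset.ne_of_mem_erase hi
    rw [Equiv.Perm.mul_apply, Equiv.Perm.mul_apply, Equiv.swap_apply_of_ne_of_ne,
      Equiv.swap_apply_of_ne_of_ne] <;> simp [hij]
  rw [pfaffianSlot_apply, pfaffianSlot_apply, ← Equiv.sum_comp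
    (Equiv.mulRight (Equiv.swap ((j, 0) : κ × Fin 2) (j, 1))), ← Finset.sum_neg_distrib]
  refine Finset.sum_congr rfl fun σ _ => ?_
  simp only [Equiv.coe_mulRight, hcofactor, Equiv.Perm.mul_apply, Equiv.swap_apply_left,
    Equiv.swap_apply_right, ContinuousLinearMap.flip_apply, Equiv.Perm.sign_mul]
  rw [Equiv.Perm.sign_swap (by simp)]
  push_cast
  ring

theorem sum_sign_mul_eq_zero_of_cycle {ι : Type*} [Fintype ι] [DecidableEq ι]
    (G : Equiv.Perm ι → ℝ) (c : Equiv.Perm ι) (hc : Equiv.Perm.sign c = 1)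
    (h : ∀ σ, G σ + G (σ * c) + G (σ * c * c) = 0) :
    ∑ σ, (Equiv.Perm.sign σ : ℝ) * G σ = 0 := by
  have hshift (H : Equiv.Perm ι → ℝ) : ∑ σ, (Equiv.Perm.sign σ : ℝ) * H (σ * c) =
      ∑ σ, (Equiv.Perm.sign σ : ℝ) * H σ := by
    rw [← Equiv.sum_comp (Equiv.mulRight c) fun σ => (Equiv.Perm.sign σ : ℝ) * H σ]
    simp [Equiv.Perm.sign_mul, hc]
  have hsum : ∑ σ, (Equiv.Perm.sign σ : ℝ) * (G σ + G (σ * c) + G (σ * c * c)) = 0 := by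
    simp [h]
  simp only [mul_add, Finset.sum_add_distrib] at hsum
  linarith [hshift G, hshift fun σ => G (σ * c)]

section Rank

variable {V : Type*} [AddCommGroup V] [Module ℝ V]

theorem prod_bilin_update (B : V →ₗ[ℝ] V →ₗ[ℝ] ℝ) (v : κ × Fin 2 → V) (j : κ) (s : Fin 2)
    (z : V) :
    ∏ i, B (Function.update v (j, s) z (i, 0)) (Function.update v (j, s) z (i, 1)) =
      B (Function.update v (j, s) z (j, 0)) (Function.update v (j, s) z (j, 1)) *
        ∏ i ∈ Finset.univ.erase j, B (v (i, 0)) (v (i, 1)) := by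
  rw [← Finset.mul_prod_erase _ _ (Finset.mem_univ j)]
  congr 1
  refine Finset.prod_congr rfl fun i hi => ?_
  have hij := Finset.ne_of_mem_erase hi
  rw [Function.update_of_ne (by simp [hij]), Function.update_of_ne (by simp [hij])]

/-- The multilinear map `v ↦ ∏ⱼ B (v (j, 0)) (v (j, 1))`, whose alternatization is a power of the
two-form `B`. -/
def prodBilin (B : V →ₗ[ℝ] V →ₗ[ℝ] ℝ) : MultilinearMap ℝ (fun _ : κ × Fin 2 => V) ℝ where
  toFun v := ∏ j, B (v (j, 0)) (v (j, 1))
  map_update_add' {inst} v a x y := by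
    obtain rfl := Subsingleton.elim inst instDecidableEqProd
    obtain ⟨j, s⟩ := a
    simp only [prod_bilin_update, ← add_mul]
    congr 1
    fin_cases s <;> simp
  map_update_smul' {inst} v a c x := by
    obtain rfl := Subsingleton.elim inst instDecidableEqProd
    obtain ⟨j, s⟩ := a
    simp only [prod_bilin_update, smul_eq_mul, ← mul_assoc]
    congr 1
    fin_cases s <;> simp

theorem pfaffian_eq_zero_of_finrank_lt [FiniteDimensional ℝ V] (B : V →ₗ[ℝ] V →ₗ[ℝ] ℝ)
    (L : (κ × Fin 2 → ℝ) →ₗ[ℝ] V) (hV : Module.finrank ℝ V < Fintype.card κ * 2)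
    (M : BlockForm κ) (hM : ∀ u v, M u v = B (L u) (L v)) : pfaffian (fun _ : κ => M) = 0 := by
  have hdependent : ¬LinearIndependent ℝ fun a : κ × Fin 2 => L (stdVec a) := fun hli =>
    hV.not_ge (by simpa using hli.fintype_card_le_finrank)
  have halt := (MultilinearMap.alternatization (prodBilin (κ := κ) B)).map_linearDependent
    (fun a => L (stdVec a)) hdependent
  rw [MultilinearMap.alternatization_apply] at halt
  rw [← halt, pfaffian]
  refine Finset.sum_congr rfl fun σ _ => ?_
  simp only [hM]
  rw [Units.smul_def, zsmul_eq_mul]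
  rfl

end Rank

theorem sign_perm_fin_two (ε : Equiv.Perm (Fin 2)) :
    (Equiv.Perm.sign ε : ℝ) = ((ε 1 : ℕ) : ℝ) - ((ε 0 : ℕ) : ℝ) := by
  have hint : ∀ ε : Equiv.Perm (Fin 2),
      (Equiv.Perm.sign ε : ℤ) = ((ε 1 : ℕ) : ℤ) - ((ε 0 : ℕ) : ℤ) := by
    decide
  exact_mod_cast congrArg (Int.cast : ℤ → ℝ) (hint ε)

theorem exists_eq_prodCongrLeft_mul_prodCongrRight {ι γ : Type*} [Finite ι] [Finite γ] [Nonempty γ]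
    (σ : Equiv.Perm (ι × γ)) (hσ : ∀ j s t, (σ (j, s)).1 = (σ (j, t)).1) :
    ∃ (π : Equiv.Perm ι) (ε : ι → Equiv.Perm γ),
      σ = Equiv.prodCongrLeft (fun _ => π) * Equiv.prodCongrRight ε := by
  obtain ⟨s₀⟩ := ‹Nonempty γ›
  have hsnd (j : ι) : Function.Injective fun s => (σ (j, s)).2 := fun s t hst => by
    simpa using σ.injective (Prod.ext (hσ j s t) hst)
  let ε (j : ι) : Equiv.Perm γ := Equiv.ofBijective _ (Finite.injective_iff_bijective.1 (hsnd j))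
  have hfst : Function.Injective fun j => (σ (j, s₀)).1 := fun i j hij => by
    obtain ⟨s, hs⟩ := (ε i).surjective (σ (j, s₀)).2
    exact congrArg Prod.fst (σ.injective (Prod.ext ((hσ i s s₀).trans hij) hs))
  refine ⟨Equiv.ofBijective _ (Finite.injective_iff_bijective.1 hfst), ε, ?_⟩
  ext ⟨j, s⟩
  · exact hσ j s s₀
  · rfl

/-- The matrix of the standard symplectic form on `ℝ^(κ × 2)`. -/
def blockSymplectic {κ : Type*} [DecidableEq κ] (a b : κ × Fin 2) : ℝ :=
  if a.1 = b.1 then ((b.2 : ℕ) : ℝ) - ((a.2 : ℕ) : ℝ) else 0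

theorem sign_mul_prod_blockSymplectic_nonneg (σ : Equiv.Perm (κ × Fin 2)) :
    0 ≤ (Equiv.Perm.sign σ : ℝ) * ∏ j, blockSymplectic (σ (j, 0)) (σ (j, 1)) := by
  by_cases hblocks : ∀ j, (σ (j, 0)).1 = (σ (j, 1)).1
  · obtain ⟨π, ε, hσ⟩ := exists_eq_prodCongrLeft_mul_prodCongrRight σ fun j s t => by
      fin_cases s <;> fin_cases t <;> simp [hblocks]
    have hfactor (j : κ) :
        blockSymplectic (σ (j, 0)) (σ (j, 1)) = (Equiv.Perm.sign (ε j) : ℝ) := by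
      simp [hσ, blockSymplectic, sign_perm_fin_two]
    have hsign : Equiv.Perm.sign (Equiv.prodCongrLeft (fun _ : Fin 2 => π)) = 1 := by
      simp [Equiv.Perm.sign_prodCongrLeft, Int.units_sq]
    rw [Finset.prod_congr rfl fun j _ => hfactor j, hσ, Equiv.Perm.sign_mul, hsign, one_mul,
      Equiv.Perm.sign_prodCongrRight]
    push_cast
    exact mul_self_nonneg _
  · obtain ⟨j, hj⟩ := not_forall.1 hblocks
    rw [Finset.prod_eq_zero (Finset.mem_univ j) (by simp [blockSymplectic, hj]), mul_zero]

theorem eq_zero_of_pfaffian_eq_zero (M : BlockForm κ) (c : ℝ)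
    (hM : ∀ a b, M (stdVec a) (stdVec b) = c * blockSymplectic a b)
    (hpfaffian : pfaffian (fun _ : κ => M) = 0) : c = 0 := by
  simp only [pfaffian, hM, Finset.prod_mul_distrib, mul_left_comm _ (∏ _ : κ, c),
    ← Finset.mul_sum] at hpfaffian
  rcases mul_eq_zero.1 hpfaffian with hc | hsum
  · obtain ⟨j, -, hj⟩ := Finset.prod_eq_zero_iff.1 hc
    exact hj
  · have hone := (Finset.sum_eq_zero_iff_of_nonneg fun σ _ =>
      sign_mul_prod_blockSymplectic_nonneg σ).1 hsum 1 (Finset.mem_univ _)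
    simp [blockSymplectic] at hone

end Pfaffian

section TorusPeriods

-- The general lemma does not unify its instances with those of the space of bilinear forms.
theorem fderiv_bilin_comp_add_right {E : Type*} [NormedAddCommGroup E] [NormedSpace ℝ E]
    (η : E → E →L[ℝ] E →L[ℝ] ℝ) (c x : E) :
    fderiv ℝ (fun x => η (x + c)) x = fderiv ℝ η (x + c) :=
  fderiv_comp_add_right (𝕜 := ℝ) (f := η) (x := x) c

namespace IsClosedTwoForm

variable {E : Type*} [NormedAddCommGroup E] [NormedSpace ℝ E] {η : E → E →L[ℝ] E →L[ℝ] ℝ}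

theorem fderiv_apply (hη : IsClosedTwoForm η) (x u v w : E) :
    fderiv ℝ (fun y => η y v w) x u = fderiv ℝ η x u v w :=
  fderiv_clm_apply_apply (hη.contDiff.differentiable (by simp) x) u v w

theorem contDiff_apply (hη : IsClosedTwoForm η) (u v : E) : ContDiff ℝ ∞ fun x => η x u v :=
  (hη.contDiff.clm_apply contDiff_const).clm_apply contDiff_const

theorem swap (hη : IsClosedTwoForm η) (x v w : E) : η x v w = -η x w v := by
  have hadd := hη.alternating x (v + w)
  simp only [map_add, add_apply, hη.alternating] at hadd
  linarith

theorem fderiv_swap (hη : IsClosedTwoForm η) (x u v w : E) :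
    fderiv ℝ η x u v w = -fderiv ℝ η x u w v := by
  have heq : (fun y => η y v w) = fun y => -η y w v := funext fun y => hη.swap y v w
  rw [← hη.fderiv_apply, ← hη.fderiv_apply, heq, fderiv_fun_neg]
  rfl

-- Cartan's formula: a directional derivative of a closed form is exact.
theorem fderiv_eq (hη : IsClosedTwoForm η) (x v u w : E) :
    fderiv ℝ η x v u w = fderiv ℝ η x u v w - fderiv ℝ η x w v u := by
  linarith [hη.closed x v u w, hη.fderiv_swap x u w v]

theorem comp_add_right (hη : IsClosedTwoForm η) (c : E) : IsClosedTwoForm fun x => η (x + c) where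
  contDiff := hη.contDiff.comp (contDiff_id.add contDiff_const)
  alternating x u := hη.alternating _ u
  closed x u v w := by
    rw [fderiv_bilin_comp_add_right]
    exact hη.closed (x + c) u v w

end IsClosedTwoForm

theorem isClosedTwoForm_const {E : Type*} [NormedAddCommGroup E] [NormedSpace ℝ E]
    (A : E →L[ℝ] E →L[ℝ] ℝ) (hA : ∀ u, A u u = 0) : IsClosedTwoForm fun _ : E => A where
  contDiff := contDiff_const
  alternating _ u := hA u
  closed x u v w := by simp

theorem IsUnitPeriodic.comp {ι β γ : Type*} [DecidableEq ι] {g : (ι → ℝ) → β}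
    (hg : IsUnitPeriodic g) (F : β → γ) : IsUnitPeriodic fun x => F (g x) := fun x i => by
  simp only [hg x i]

theorem IsUnitPeriodic.comp_add_right {ι β : Type*} [DecidableEq ι] {g : (ι → ℝ) → β}
    (hg : IsUnitPeriodic g) (c : ι → ℝ) : IsUnitPeriodic fun x => g (x + c) := fun x i => by
  simp only [add_right_comm x, hg (x + c) i]

/-- The linear parametrization of the coordinate plane spanned by the `a`-th and the `b`-th basis
vectors of `ℝ^ι`; modulo the lattice `ℤ^ι` it is a coordinate two-torus. -/
def coordinatePlane {ι : Type*} [DecidableEq ι] (a b : ι) : (Fin 2 → ℝ) →L[ℝ] (ι → ℝ) :=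
  (ContinuousLinearMap.proj (R := ℝ) (φ := fun _ : Fin 2 => ℝ) 0).smulRight (stdVec a) +
    (ContinuousLinearMap.proj (R := ℝ) (φ := fun _ : Fin 2 => ℝ) 1).smulRight (stdVec b)

theorem coordinatePlane_apply {ι : Type*} [DecidableEq ι] (a b : ι) (y : Fin 2 → ℝ) :
    coordinatePlane a b y = y 0 • stdVec a + y 1 • stdVec b := rfl

theorem IsUnitPeriodic.comp_coordinatePlane {ι β : Type*} [DecidableEq ι] {g : (ι → ℝ) → β}
    (hg : IsUnitPeriodic g) (a b : ι) : IsUnitPeriodic fun y => g (coordinatePlane a b y) := by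
  intro y i
  fin_cases i
  · simpa [coordinatePlane_apply, add_smul, add_right_comm] using
      hg (y 0 • stdVec a + y 1 • stdVec b) a
  · simpa [coordinatePlane_apply, add_smul, add_assoc] using
      hg (y 0 • stdVec a + y 1 • stdVec b) b

namespace IsClosedTwoForm

variable {ι : Type*} [Fintype ι] [DecidableEq ι]
  {η : (ι → ℝ) → (ι → ℝ) →L[ℝ] (ι → ℝ) →L[ℝ] ℝ}

theorem setIntegral_fderiv_coordinatePlane (hη : IsClosedTwoForm η) (hperiodic : IsUnitPeriodic η)
    (a b : ι) (v : ι → ℝ) :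
    ∫ y in unitCube (Fin 2), fderiv ℝ η (coordinatePlane a b y) v (stdVec a) (stdVec b) = 0 := by
  have hsmooth (w : ι → ℝ) : ContDiff ℝ 1 fun y => η (coordinatePlane a b y) v w :=
    ((hη.contDiff_apply v w).comp (coordinatePlane a b).contDiff).of_le (by simp)
  have hslice (w : ι → ℝ) : IsUnitPeriodic fun y => η (coordinatePlane a b y) v w :=
    (hperiodic.comp_coordinatePlane a b).comp fun A => A v w
  have hchain (w : ι → ℝ) (y z : Fin 2 → ℝ) :
      fderiv ℝ (fun y => η (coordinatePlane a b y) v w) y z =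
        fderiv ℝ η (coordinatePlane a b y) (coordinatePlane a b z) v w := by
    have hcomp : fderiv ℝ (fun y => η (coordinatePlane a b y) v w) y = _ :=
      fderiv_comp y ((hη.contDiff_apply v w).differentiable (by simp) _)
        (coordinatePlane a b).differentiableAt
    rw [hcomp, ← hη.fderiv_apply, ContinuousLinearMap.fderiv]
    rfl
  have hexact (y : Fin 2 → ℝ) :
      fderiv ℝ η (coordinatePlane a b y) v (stdVec a) (stdVec b) =
        fderiv ℝ (fun y => η (coordinatePlane a b y) v (stdVec b)) y (stdVec 0) -
          fderiv ℝ (fun y => η (coordinatePlane a b y) v (stdVec a)) y (stdVec 1) := by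
    rw [hη.fderiv_eq, hchain, hchain]
    simp [coordinatePlane_apply]
  have hint (w : ι → ℝ) (z : Fin 2 → ℝ) : IntegrableOn
      (fun y => fderiv ℝ (fun y => η (coordinatePlane a b y) v w) y z) (unitCube (Fin 2)) :=
    integrableOn_unitCube (((hsmooth w).continuous_fderiv one_ne_zero).clm_apply continuous_const)
  simp only [hexact]
  rw [integral_sub (hint _ _) (hint _ _), setIntegral_unitCube_fderiv (hslice _) (hsmooth _),
    setIntegral_unitCube_fderiv (hslice _) (hsmooth _), sub_zero]

theorem setIntegral_coordinatePlane_add (hη : IsClosedTwoForm η) (hperiodic : IsUnitPeriodic η)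
    (a b : ι) (c : ι → ℝ) :
    ∫ y in unitCube (Fin 2), η (coordinatePlane a b y + c) (stdVec a) (stdVec b) =
      ∫ y in unitCube (Fin 2), η (coordinatePlane a b y) (stdVec a) (stdVec b) := by
  have hsmooth := hη.contDiff_apply (stdVec a) (stdVec b)
  have hderiv (y : Fin 2 → ℝ) (t : ℝ) : HasDerivAt
      (fun t : ℝ => η (coordinatePlane a b y + t • c) (stdVec a) (stdVec b))
      (fderiv ℝ η (coordinatePlane a b y + t • c) c (stdVec a) (stdVec b)) t := by
    rw [← hη.fderiv_apply]
    exact hasDerivAt_comp_add_smul (hsmooth.differentiable (by simp) _)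
  have hzero (t : ℝ) : ∫ y in unitCube (Fin 2),
      fderiv ℝ η (coordinatePlane a b y + t • c) c (stdVec a) (stdVec b) = 0 := by
    have hshift := (hη.comp_add_right (t • c)).setIntegral_fderiv_coordinatePlane
      (hperiodic.comp_add_right (t • c)) a b c
    simpa only [fderiv_bilin_comp_add_right η] using hshift
  have heq := setIntegral_eq_of_setIntegral_deriv_eq_zero volume isBounded_unitCube hderiv
    (hsmooth.continuous.comp (by fun_prop))
    (((((hη.contDiff.continuous_fderiv (by simp)).comp (by fun_prop)).clm_apply
      continuous_const).clm_apply continuous_const).clm_apply continuous_const) hzero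
  simpa using heq

theorem setIntegral_unitCube_eq_coordinatePlane (hη : IsClosedTwoForm η)
    (hperiodic : IsUnitPeriodic η) (a b : ι) :
    ∫ x in unitCube ι, η x (stdVec a) (stdVec b) =
      ∫ y in unitCube (Fin 2), η (coordinatePlane a b y) (stdVec a) (stdVec b) := by
  have htranslate (y : Fin 2 → ℝ) :
      ∫ x in unitCube ι, η (x + coordinatePlane a b y) (stdVec a) (stdVec b) =
        ∫ x in unitCube ι, η x (stdVec a) (stdVec b) :=
    setIntegral_unitCube_add (hperiodic.comp fun A => A (stdVec a) (stdVec b)) _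
  have hswap := setIntegral_swap_of_continuous (volume : Measure (ι → ℝ))
    (volume : Measure (Fin 2 → ℝ)) isBounded_unitCube isBounded_unitCube
    (g := fun p => η (p.1 + coordinatePlane a b p.2) (stdVec a) (stdVec b))
    ((hη.contDiff_apply _ _).continuous.comp (by fun_prop))
  simp only [htranslate] at hswap
  simp only [add_comm _ (coordinatePlane a b _), hη.setIntegral_coordinatePlane_add hperiodic]
    at hswap
  simpa [volume_real_unitCube] using hswap.symm

end IsClosedTwoForm

end TorusPeriods

section PfaffianIntegral

variable {κ : Type*} [Fintype κ] [DecidableEq κ]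

theorem pfaffianSlot_sub (M : κ → BlockForm κ) (j : κ) (A B : BlockForm κ) :
    pfaffianSlot M j (A - B) = pfaffianSlot M j A - pfaffianSlot M j B :=
  (pfaffianSlot M j).map_sub A B

theorem continuous_pfaffianSlot {X : Type*} [TopologicalSpace X] {M : κ → X → BlockForm κ}
    {A : X → BlockForm κ} (hM : ∀ i, Continuous (M i)) (hA : Continuous A) (j : κ) :
    Continuous fun x => pfaffianSlot (fun i => M i x) j (A x) := by
  simp only [pfaffianSlot_apply]
  refine continuous_finsetSum _ fun σ _ => continuous_const.mul (.mul ?_ ?_)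
  · exact (hA.clm_apply continuous_const).clm_apply continuous_const
  · exact continuous_finsetProd _ fun i _ =>
      ((hM i).clm_apply continuous_const).clm_apply continuous_const

-- The summand is cyclically summed by the three-cycle of `(j, 0)`, `(i, 0)` and `(i, 1)`.
theorem sum_sign_mul_cyclic_eq_zero (M : κ → BlockForm κ) {i j : κ} (hij : i ≠ j)
    (w : κ × Fin 2 → ℝ) (T : κ × Fin 2 → κ × Fin 2 → κ × Fin 2 → ℝ)
    (hT : ∀ a b c, T a b c + T b c a + T c a b = 0) :
    ∑ σ : Equiv.Perm (κ × Fin 2), (Equiv.Perm.sign σ : ℝ) *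
      (w (σ (j, 1)) * (T (σ (j, 0)) (σ (i, 0)) (σ (i, 1)) *
        ∏ k ∈ (Finset.univ.erase j).erase i, M k (stdVec (σ (k, 0))) (stdVec (σ (k, 1))))) =
      0 := by
  set c : Equiv.Perm (κ × Fin 2) :=
    Equiv.swap (j, 0) (i, 0) * Equiv.swap (i, 0) (i, 1) with hc
  have hsign : Equiv.Perm.sign c = 1 := by
    rw [hc, Equiv.Perm.sign_mul, Equiv.Perm.sign_swap (by simp [hij.symm]),
      Equiv.Perm.sign_swap (by simp), neg_mul_neg, one_mul]
  have hj₀ : c (j, 0) = (i, 0) := by simp [hc, Equiv.swap_apply_def, hij.symm]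
  have hi₀ : c (i, 0) = (i, 1) := by simp [hc, Equiv.swap_apply_def, hij]
  have hi₁ : c (i, 1) = (j, 0) := by simp [hc]
  have hj₁ : c (j, 1) = (j, 1) := by simp [hc, Equiv.swap_apply_def, hij.symm]
  have hfixed : ∀ k ∈ (Finset.univ.erase j).erase i, ∀ s, c (k, s) = (k, s) := fun k hk s => by
    simp only [Finset.mem_erase, Finset.mem_univ, and_true] at hk
    simp [hc, Equiv.swap_apply_def, hk]
  have hprod (τ : Equiv.Perm (κ × Fin 2)) :
      ∏ k ∈ (Finset.univ.erase j).erase i,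
          M k (stdVec ((τ * c) (k, 0))) (stdVec ((τ * c) (k, 1))) =
        ∏ k ∈ (Finset.univ.erase j).erase i, M k (stdVec (τ (k, 0))) (stdVec (τ (k, 1))) :=
    Finset.prod_congr rfl fun k hk => by simp only [Equiv.Perm.mul_apply, hfixed k hk]
  refine sum_sign_mul_eq_zero_of_cycle _ c hsign fun σ => ?_
  simp only [hprod]
  simp only [Equiv.Perm.mul_apply, hj₀, hi₀, hi₁, hj₁]
  rw [← mul_add, ← mul_add, ← add_mul, ← add_mul, hT, zero_mul, mul_zero]

variable {η : κ → (κ × Fin 2 → ℝ) → BlockForm κ}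

theorem contDiff_pfaffianCofactor (hη : ∀ i, IsClosedTwoForm (η i)) (j : κ)
    (σ : Equiv.Perm (κ × Fin 2)) : ContDiff ℝ ∞ fun x => pfaffianCofactor (fun i => η i x) j σ :=
  contDiff_prod fun i _ => (hη i).contDiff_apply _ _

theorem fderiv_pfaffianCofactor (hη : ∀ i, IsClosedTwoForm (η i)) (j : κ)
    (σ : Equiv.Perm (κ × Fin 2)) (x u : κ × Fin 2 → ℝ) :
    fderiv ℝ (fun x => pfaffianCofactor (fun i => η i x) j σ) x u =
      ∑ i ∈ Finset.univ.erase j, fderiv ℝ (η i) x u (stdVec (σ (i, 0))) (stdVec (σ (i, 1))) *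
        ∏ k ∈ (Finset.univ.erase j).erase i, η k x (stdVec (σ (k, 0))) (stdVec (σ (k, 1))) := by
  have hprod : fderiv ℝ (fun x => pfaffianCofactor (fun i => η i x) j σ) x = _ :=
    (HasFDerivAt.finsetProd fun i _ => (((hη i).contDiff_apply (stdVec (σ (i, 0)))
      (stdVec (σ (i, 1)))).differentiable (by simp) x).hasFDerivAt).fderiv
  simp only [hprod, sum_apply, smul_apply, smul_eq_mul, (hη _).fderiv_apply, mul_comm]

variable {w : (κ × Fin 2 → ℝ) → (κ × Fin 2 → ℝ) →L[ℝ] ℝ}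

theorem pfaffianSlot_fderiv (hη : ∀ i, IsClosedTwoForm (η i)) (hw : ContDiff ℝ ∞ w) (j : κ)
    (x : κ × Fin 2 → ℝ) :
    pfaffianSlot (fun i => η i x) j (fderiv ℝ w x) =
      ∑ σ : Equiv.Perm (κ × Fin 2), (Equiv.Perm.sign σ : ℝ) *
        fderiv ℝ (fun y => w y (stdVec (σ (j, 1))) * pfaffianCofactor (fun i => η i y) j σ) x
          (stdVec (σ (j, 0))) := by
  have hleibniz (σ : Equiv.Perm (κ × Fin 2)) (u : κ × Fin 2 → ℝ) :
      fderiv ℝ (fun y => w y (stdVec (σ (j, 1))) * pfaffianCofactor (fun i => η i y) j σ) x u =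
        fderiv ℝ w x u (stdVec (σ (j, 1))) * pfaffianCofactor (fun i => η i x) j σ +
          ∑ i ∈ Finset.univ.erase j, w x (stdVec (σ (j, 1))) *
            (fderiv ℝ (η i) x u (stdVec (σ (i, 0))) (stdVec (σ (i, 1))) *
              ∏ k ∈ (Finset.univ.erase j).erase i,
                η k x (stdVec (σ (k, 0))) (stdVec (σ (k, 1)))) := by
    have hwσ := ((hw.differentiable (by simp) x).hasFDerivAt).clm_apply
      (hasFDerivAt_const (stdVec (σ (j, 1))) x)
    have hmul : fderiv ℝ (fun y => w y (stdVec (σ (j, 1))) *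
        pfaffianCofactor (fun i => η i y) j σ) x = _ :=
      (hwσ.mul ((contDiff_pfaffianCofactor hη j σ).differentiable (by simp) x).hasFDerivAt).fderiv
    rw [hmul, ← Finset.mul_sum, ← fderiv_pfaffianCofactor hη]
    simp [add_comm, mul_comm]
  simp only [hleibniz, mul_add, Finset.sum_add_distrib, pfaffianSlot_apply, Finset.mul_sum]
  rw [left_eq_add, Finset.sum_comm]
  exact Finset.sum_eq_zero fun i hi => sum_sign_mul_cyclic_eq_zero (fun k => η k x)
    (Finset.ne_of_mem_erase hi) (fun a => w x (stdVec a))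
    (fun a b c => fderiv ℝ (η i) x (stdVec a) (stdVec b) (stdVec c))
    fun a b c => (hη i).closed x _ _ _

theorem setIntegral_pfaffianSlot_fderiv (hη : ∀ i, IsClosedTwoForm (η i))
    (hperiodic : ∀ i, IsUnitPeriodic (η i)) (hw : ContDiff ℝ ∞ w) (hwperiodic : IsUnitPeriodic w)
    (j : κ) : ∫ x in unitCube (κ × Fin 2), pfaffianSlot (fun i => η i x) j (fderiv ℝ w x) = 0 := by
  have hsmooth (σ : Equiv.Perm (κ × Fin 2)) : ContDiff ℝ 1 fun y =>
      w y (stdVec (σ (j, 1))) * pfaffianCofactor (fun i => η i y) j σ :=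
    ((hw.clm_apply contDiff_const).mul (contDiff_pfaffianCofactor hη j σ)).of_le (by simp)
  have hterm (σ : Equiv.Perm (κ × Fin 2)) : IsUnitPeriodic fun y =>
      w y (stdVec (σ (j, 1))) * pfaffianCofactor (fun i => η i y) j σ := fun x a => by
    simp only [hwperiodic x a, hperiodic _ x a]
  simp only [pfaffianSlot_fderiv hη hw]
  rw [integral_finsetSum _ fun σ _ => (integrableOn_unitCube
    (((hsmooth σ).continuous_fderiv one_ne_zero).clm_apply continuous_const)).const_mul _]
  refine Finset.sum_eq_zero fun σ _ => ?_
  rw [integral_const_mul, setIntegral_unitCube_fderiv (hterm σ) (hsmooth σ), mul_zero]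

variable {ζ : (κ × Fin 2 → ℝ) → BlockForm κ}

theorem setIntegral_pfaffianSlot_fderiv_apply (hη : ∀ i, IsClosedTwoForm (η i))
    (hperiodic : ∀ i, IsUnitPeriodic (η i)) (hζ : IsClosedTwoForm ζ)
    (hζperiodic : IsUnitPeriodic ζ) (j : κ) (v : κ × Fin 2 → ℝ) :
    ∫ x in unitCube (κ × Fin 2), pfaffianSlot (fun i => η i x) j (fderiv ℝ ζ x v) = 0 := by
  have hcontraction : ContDiff ℝ ∞ fun x => ζ x v := hζ.contDiff.clm_apply contDiff_const
  have happly (x a b : κ × Fin 2 → ℝ) :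
      fderiv ℝ (fun x => ζ x v) x a b = fderiv ℝ ζ x a v b := by
    have heq : fderiv ℝ (fun y => ζ y v b) x = _ :=
      ((hcontraction.differentiable (by simp) x).hasFDerivAt.clm_apply
        (hasFDerivAt_const b x)).fderiv
    rw [← hζ.fderiv_apply, heq]
    simp
  have hcartan (x : κ × Fin 2 → ℝ) : fderiv ℝ ζ x v =
      fderiv ℝ (fun x => ζ x v) x - (fderiv ℝ (fun x => ζ x v) x).flip := by
    ext1 a
    ext1 b
    change _ = fderiv ℝ (fun x => ζ x v) x a b - fderiv ℝ (fun x => ζ x v) x b a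
    rw [happly, happly, hζ.fderiv_eq]
  simp only [hcartan, pfaffianSlot_sub, pfaffianSlot_flip, sub_neg_eq_add, ← two_mul]
  rw [integral_const_mul, setIntegral_pfaffianSlot_fderiv hη hperiodic hcontraction
    (hζperiodic.comp fun A => A v), mul_zero]

theorem setIntegral_pfaffianSlot_comp_add (hη : ∀ i, IsClosedTwoForm (η i))
    (hperiodic : ∀ i, IsUnitPeriodic (η i)) (hζ : IsClosedTwoForm ζ)
    (hζperiodic : IsUnitPeriodic ζ) (j : κ) (v : κ × Fin 2 → ℝ) :
    ∫ x in unitCube (κ × Fin 2), pfaffianSlot (fun i => η i x) j (ζ (x + v)) =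
      ∫ x in unitCube (κ × Fin 2), pfaffianSlot (fun i => η i x) j (ζ x) := by
  have hcont (i : κ) : Continuous (η i) := (hη i).contDiff.continuous
  have hderiv (x : κ × Fin 2 → ℝ) (t : ℝ) :
      HasDerivAt (fun t : ℝ => pfaffianSlot (fun i => η i x) j (ζ (x + t • v)))
        (pfaffianSlot (fun i => η i x) j (fderiv ℝ ζ (x + t • v) v)) t := by
    have hline := hasDerivAt_comp_add_smul (hζ.contDiff.differentiable (by simp) (x + t • v))
    exact (pfaffianSlot (fun i => η i x) j).hasFDerivAt.comp_hasDerivAt t hline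
  have hzero (t : ℝ) : ∫ x in unitCube (κ × Fin 2),
      pfaffianSlot (fun i => η i x) j (fderiv ℝ ζ (x + t • v) v) = 0 := by
    have hshift := setIntegral_pfaffianSlot_fderiv_apply hη hperiodic
      (hζ.comp_add_right (t • v)) (hζperiodic.comp_add_right (t • v)) j v
    simpa only [fderiv_bilin_comp_add_right ζ] using hshift
  have heq := setIntegral_eq_of_setIntegral_deriv_eq_zero volume isBounded_unitCube hderiv
    (continuous_pfaffianSlot (fun i => (hcont i).comp continuous_fst)
      (hζ.contDiff.continuous.comp (by fun_prop)) j)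
    (continuous_pfaffianSlot (fun i => (hcont i).comp continuous_fst)
      (((hζ.contDiff.continuous_fderiv (by simp)).comp (by fun_prop)).clm_apply
        continuous_const) j) hzero
  simpa using heq

/-- The mean over the unit cube of a continuous field of bilinear forms. The continuity is an
argument because bilinearity of the mean rests on integrability. -/
def meanForm {ι : Type*} [Fintype ι] (η : (ι → ℝ) → (ι → ℝ) →L[ℝ] (ι → ℝ) →L[ℝ] ℝ)
    (hη : Continuous η) : (ι → ℝ) →L[ℝ] (ι → ℝ) →L[ℝ] ℝ :=
  have hint (u v : ι → ℝ) : IntegrableOn (fun x => η x u v) (unitCube ι) :=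
    integrableOn_unitCube ((hη.clm_apply continuous_const).clm_apply continuous_const)
  (LinearMap.mk₂ ℝ (fun u v => ∫ x in unitCube ι, η x u v)
    (fun u u' v => by
      rw [← integral_add (hint _ _) (hint _ _)]
      simp only [map_add, add_apply])
    (fun c u v => by
      rw [← integral_smul]
      simp only [map_smul, smul_apply])
    (fun u v v' => by
      rw [← integral_add (hint _ _) (hint _ _)]
      simp only [map_add])
    (fun c u v => by
      rw [← integral_smul]
      simp only [map_smul])).toContinuousBilinearMap

theorem meanForm_apply {ι : Type*} [Fintype ι] {η : (ι → ℝ) → (ι → ℝ) →L[ℝ] (ι → ℝ) →L[ℝ] ℝ}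
    (hη : Continuous η) (u v : ι → ℝ) :
    meanForm η hη u v = ∫ x in unitCube ι, η x u v := rfl

theorem pfaffianSlot_meanForm (M : κ → BlockForm κ) (j : κ)
    {ζ : (κ × Fin 2 → ℝ) → BlockForm κ} (hζ : Continuous ζ) :
    pfaffianSlot M j (meanForm ζ hζ) = ∫ x in unitCube (κ × Fin 2), pfaffianSlot M j (ζ x) := by
  simp only [pfaffianSlot_apply, meanForm_apply]
  rw [integral_finsetSum _ fun σ _ => ((integrableOn_unitCube
    ((hζ.clm_apply continuous_const).clm_apply continuous_const)).mul_const _).const_mul _]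
  simp only [integral_const_mul, integral_mul_const]

theorem setIntegral_pfaffian_eq_meanForm (hη : ∀ i, IsClosedTwoForm (η i))
    (hperiodic : ∀ i, IsUnitPeriodic (η i)) (j : κ) :
    ∫ x in unitCube (κ × Fin 2), pfaffian (fun i => η i x) =
      ∫ x in unitCube (κ × Fin 2),
        pfaffianSlot (fun i => η i x) j (meanForm (η j) (hη j).contDiff.continuous) := by
  have hcont (i : κ) : Continuous (η i) := (hη i).contDiff.continuous
  have hmean (x : κ × Fin 2 → ℝ) :
      ∫ y in unitCube (κ × Fin 2), pfaffianSlot (fun i => η i x) j (η j (x + y)) =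
        pfaffianSlot (fun i => η i x) j (meanForm (η j) (hcont j)) := by
    simp only [add_comm x, pfaffianSlot_meanForm]
    exact setIntegral_unitCube_add ((hperiodic j).comp _) x
  have hswap := setIntegral_swap_of_continuous (volume : Measure (κ × Fin 2 → ℝ))
    (volume : Measure (κ × Fin 2 → ℝ)) isBounded_unitCube isBounded_unitCube
    (g := fun p => pfaffianSlot (fun i => η i p.1) j (η j (p.1 + p.2)))
    (continuous_pfaffianSlot (fun i => (hcont i).comp continuous_fst)
      ((hcont j).comp (continuous_fst.add continuous_snd)) j)
  simp only [hmean, setIntegral_pfaffianSlot_comp_add hη hperiodic (hη j) (hperiodic j),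
    pfaffianSlot_self] at hswap
  rw [hswap]
  simp [volume_real_unitCube]

theorem setIntegral_pfaffian (hη : ∀ i, IsClosedTwoForm (η i))
    (hperiodic : ∀ i, IsUnitPeriodic (η i)) :
    ∫ x in unitCube (κ × Fin 2), pfaffian (fun i => η i x) =
      pfaffian fun i => meanForm (η i) (hη i).contDiff.continuous := by
  let mixed (s : Finset κ) (i : κ) (x : κ × Fin 2 → ℝ) : BlockForm κ :=
    if i ∈ s then meanForm (η i) (hη i).contDiff.continuous else η i x
  have hclosed (s : Finset κ) (i : κ) : IsClosedTwoForm (mixed s i) := by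
    by_cases hi : i ∈ s
    · simp only [mixed, hi, if_true]
      exact isClosedTwoForm_const _ fun u => by simp [meanForm_apply, (hη i).alternating]
    · simpa only [mixed, hi, if_false] using hη i
  have hmixed (s : Finset κ) (i : κ) : IsUnitPeriodic (mixed s i) := fun x a => by
    simp only [mixed, hperiodic i x a]
  have hreplace (s : Finset κ) : ∫ x in unitCube (κ × Fin 2), pfaffian (fun i => η i x) =
      ∫ x in unitCube (κ × Fin 2), pfaffian fun i => mixed s i x := by
    induction s using Finset.induction_on with
    | empty => simp [mixed]
    | insert j s hj ih =>
      rw [ih, setIntegral_pfaffian_eq_meanForm (hclosed s) (hmixed s) j]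
      congr 1
      funext x
      rw [← pfaffian_update]
      congr 1
      funext i
      obtain rfl | hij := eq_or_ne i j
      · simp [mixed, hj]
      · simp [mixed, hij]
  rw [hreplace Finset.univ]
  simp [mixed, volume_real_unitCube]

end PfaffianIntegral

section PullTwoForm

variable {m : ℕ} {D : Type*} [TopologicalSpace D] [ChartedSpace (EuclideanSpace ℝ (Fin m)) D]
  [Group D] {b : D → LinearMap.BilinForm ℝ (GroupLieAlgebra (𝓡 m) D)}

theorem pfaffian_pullTwoForm {κ : Type*} [Fintype κ] [DecidableEq κ] (hκ : m < Fintype.card κ * 2)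
    (Φ : (κ × Fin 2 → ℝ) → D) (x : κ × Fin 2 → ℝ) :
    pfaffian (fun _ : κ => pullTwoForm b Φ x) = 0 := by
  let B : Vec m →ₗ[ℝ] Vec m →ₗ[ℝ] ℝ := b (Φ x)
  exact pfaffian_eq_zero_of_finrank_lt B (mcForm (m := m) Φ x).toLinearMap (by simpa using hκ) _
    fun _ _ => rfl

variable [LieGroup (𝓡 m) ∞ D] {S : DoubleAlgebra (GroupLieAlgebra (𝓡 m) D)}
  {E E' : Type*} [NormedAddCommGroup E] [NormedSpace ℝ E] [NormedAddCommGroup E'] [NormedSpace ℝ E']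

theorem pullTwoForm_comp {Φ : E → D} {g : E' → E} {x : E'}
    (hΦ : MDifferentiableAt 𝓘(ℝ, E) (𝓡 m) Φ (g x)) (hg : DifferentiableAt ℝ g x) (u v : E') :
    pullTwoForm b (fun y => Φ (g y)) x u v =
      pullTwoForm b Φ (g x) (fderiv ℝ g x u) (fderiv ℝ g x v) := by
  rw [pullTwoForm, mcForm_comp hΦ hg]
  rfl

theorem pullTwoForm_congr {Φ Ψ : E → D} {x : E} (h : Φ =ᶠ[𝓝 x] Ψ)
    (hΦ : MDifferentiableAt 𝓘(ℝ, E) (𝓡 m) Φ x) : pullTwoForm b Φ x = pullTwoForm b Ψ x := by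
  rw [pullTwoForm, pullTwoForm, mcForm_congr h hΦ, h.eq_of_nhds]

theorem pullTwoForm_const (d : D) (x : E) : pullTwoForm b (fun _ : E => d) x = 0 := by
  rw [pullTwoForm, mcForm_const]
  ext u _
  exact map_zero (bilinCLM (b d) 0)

theorem pullTwoForm_eq_zero_of_const_nhds {Φ : E → D} {d : D} {x : E}
    (h : Φ =ᶠ[𝓝 x] fun _ => d) : pullTwoForm b Φ x = 0 :=
  (pullTwoForm_congr h.symm mdifferentiableAt_const).symm.trans (pullTwoForm_const d x)

theorem IsUnitPeriodic.pullTwoForm {ι : Type*} [Fintype ι] [DecidableEq ι] {Φ : (ι → ℝ) → D}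
    (hperiodic : IsUnitPeriodic Φ) (hΦ : ContMDiff 𝓘(ℝ, ι → ℝ) (𝓡 m) ∞ Φ) :
    IsUnitPeriodic (pullTwoForm b Φ) := fun x i => by
  ext1 u
  ext1 v
  have hshift := pullTwoForm_comp (b := b) (g := fun y => y + Pi.single i 1) (x := x)
    (hΦ.mdifferentiableAt (by simp)) (by fun_prop) u v
  rw [funext fun y => hperiodic y i] at hshift
  simpa [fderiv_add_const] using hshift.symm

theorem IsPotential.isClosedTwoForm_pullTwoForm [FiniteDimensional ℝ E] (hb : IsPotential S b)
    {Φ : E → D} (hΦ : ContMDiff 𝓘(ℝ, E) (𝓡 m) ∞ Φ)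
    (hcubic : ∀ x u v w,
      formCLM S (mcForm Φ x u) (bracketCLM D (mcForm Φ x v) (mcForm Φ x w)) = 0) :
    IsClosedTwoForm (pullTwoForm b Φ) where
  contDiff := hb.contDiff_pullTwoForm hΦ
  alternating := hb.pullTwoForm_self Φ
  closed x u v w := by rw [hb.fderiv_pullTwoForm_cyclic hΦ, hcubic, mul_zero]

theorem pullTwoForm_comp_coordinatePlane {ι : Type*} [Fintype ι] [DecidableEq ι]
    {Φ : (ι → ℝ) → D} (hΦ : ContMDiff 𝓘(ℝ, ι → ℝ) (𝓡 m) ∞ Φ) (i j : ι) (y : Fin 2 → ℝ) :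
    pullTwoForm b (fun y => Φ (coordinatePlane i j y)) y (stdVec 0) (stdVec 1) =
      pullTwoForm b Φ (coordinatePlane i j y) (stdVec i) (stdVec j) := by
  rw [pullTwoForm_comp (hΦ.mdifferentiableAt (by simp)) (coordinatePlane i j).differentiableAt,
    (coordinatePlane i j).fderiv]
  simp [coordinatePlane_apply, stdVec]

end PullTwoForm

section TorusProduct

variable {F : Type*} [Group F]

/-- The product `g(x₁) ⋯ g(x_N)` of `N` copies of a map of two variables, as a map of `2N`
variables. For a periodic `g` equal to `1` on the axes it restricts to `g` on the `j`-th coordinate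
two-torus, and is constant on the other coordinate two-tori. -/
def torusProd (g : (Fin 2 → ℝ) → F) (N : ℕ) (x : Fin N × Fin 2 → ℝ) : F :=
  ((List.finRange N).map fun j => g fun s => x (j, s)).prod

variable {g : (Fin 2 → ℝ) → F} {N : ℕ}

theorem IsUnitPeriodic.torusProd (hg : IsUnitPeriodic g) (N : ℕ) :
    IsUnitPeriodic (torusProd g N) := by
  rintro x ⟨i, s⟩
  refine congrArg List.prod (List.map_congr_left fun j _ => ?_)
  by_cases hij : j = i
  · subst hij
    rw [← hg (fun s => x (j, s)) s]
    congr 1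
    funext t
    simp [Pi.single_apply]
  · congr 1
    funext t
    simp [hij]

theorem torusProd_coordinatePlane_self (hg : ∀ y i, y i = 0 → g y = 1) (j : Fin N)
    (y : Fin 2 → ℝ) : torusProd g N (coordinatePlane (j, 0) (j, 1) y) = g y := by
  rw [torusProd, List.prod_map_eq_pow_single j]
  · rw [List.count_eq_one_of_mem (List.nodup_finRange N) (List.mem_finRange j), pow_one]
    congr 1
    funext s
    fin_cases s <;> simp [coordinatePlane_apply, stdVec]
  · exact fun i hij _ => hg _ 0 (by simp [coordinatePlane_apply, stdVec, hij])

theorem torusProd_coordinatePlane_of_ne (hg : ∀ y i, y i = 0 → g y = 1) {a b : Fin N × Fin 2}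
    (hab : a.1 ≠ b.1) (y : Fin 2 → ℝ) : torusProd g N (coordinatePlane a b y) = 1 := by
  obtain ⟨i, s⟩ := a
  obtain ⟨j, t⟩ := b
  refine List.prod_eq_one fun z hz => ?_
  obtain ⟨r, -, rfl⟩ := List.mem_map.1 hz
  by_cases hri : r = i
  · subst hri
    have hrj : r ≠ j := hab
    refine hg _ (s + 1) ?_
    fin_cases s <;> simp [coordinatePlane_apply, stdVec, hrj]
  · refine hg _ (t + 1) ?_
    fin_cases t <;> simp [coordinatePlane_apply, stdVec, hri]

variable {k : ℕ} [TopologicalSpace F] [ChartedSpace (EuclideanSpace ℝ (Fin k)) F]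
  [LieGroup (𝓡 k) ∞ F]

theorem contMDiff_list_map_prod {E : Type*} [NormedAddCommGroup E] [NormedSpace ℝ E] {κ : Type*}
    (L : List κ) {G : κ → E → F} (hG : ∀ j, ContMDiff 𝓘(ℝ, E) (𝓡 k) ∞ (G j)) :
    ContMDiff 𝓘(ℝ, E) (𝓡 k) ∞ fun x => (L.map fun j => G j x).prod := by
  induction L with
  | nil => exact contMDiff_const
  | cons j L ih =>
    simp only [List.map_cons, List.prod_cons]
    exact (hG j).mul ih

theorem contMDiff_torusProd (hg : ContMDiff 𝓘(ℝ, Fin 2 → ℝ) (𝓡 k) ∞ g) (N : ℕ) :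
    ContMDiff 𝓘(ℝ, Fin N × Fin 2 → ℝ) (𝓡 k) ∞ (torusProd g N) :=
  contMDiff_list_map_prod _ fun j => hg.comp
    (show ContDiff ℝ ∞ fun (x : Fin N × Fin 2 → ℝ) (s : Fin 2) => x (j, s) by fun_prop).contMDiff

end TorusProduct

section SphericalPeriods

variable {k m : ℕ} {F D : Type*} [TopologicalSpace F]
  [ChartedSpace (EuclideanSpace ℝ (Fin k)) F] [Group F] [LieGroup (𝓡 k) ∞ F] [TopologicalSpace D]
  [ChartedSpace (EuclideanSpace ℝ (Fin m)) D] [Group D] [LieGroup (𝓡 m) ∞ D]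
  {b : D → LinearMap.BilinForm ℝ (GroupLieAlgebra (𝓡 m) D)}
  {S : DoubleAlgebra (GroupLieAlgebra (𝓡 m) D)} {ι : F →* D}

theorem formCLM_bracketCLM_mcForm_hom_mul_const {E : Type*} [NormedAddCommGroup E]
    [NormedSpace ℝ E] (hι : ContMDiff (𝓡 k) (𝓡 m) ∞ ι)
    (hcubic : ∀ X Y Z : Vec k, formCLM S (lieDifferentialCLM ι X)
      (bracketCLM D (lieDifferentialCLM ι Y) (lieDifferentialCLM ι Z)) = 0)
    {f : E → F} (hf : ContMDiff 𝓘(ℝ, E) (𝓡 k) ∞ f) (d : D) (x u v w : E) :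
    formCLM S (mcForm (fun y => ι (f y) * d) x u)
      (bracketCLM D (mcForm (fun y => ι (f y) * d) x v) (mcForm (fun y => ι (f y) * d) x w)) =
        0 := by
  rw [mcForm_mul_const (fun y => ι (f y)), mcForm_hom_comp hι (hf.mdifferentiableAt (by simp))]
  exact hcubic _ _ _

theorem BlockForm.eq_mul_blockSymplectic {κ : Type*} [Fintype κ] [DecidableEq κ]
    {M : BlockForm κ} {c : ℝ}
    (halt : ∀ a, M (stdVec a) (stdVec a) = 0)
    (hskew : ∀ a b, M (stdVec a) (stdVec b) = -M (stdVec b) (stdVec a))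
    (hblock : ∀ j, M (stdVec (j, 0)) (stdVec (j, 1)) = c)
    (hoff : ∀ a b : κ × Fin 2, a.1 ≠ b.1 → M (stdVec a) (stdVec b) = 0) (a b : κ × Fin 2) :
    M (stdVec a) (stdVec b) = c * blockSymplectic a b := by
  by_cases hab : a.1 = b.1
  · obtain ⟨j, s⟩ := a
    obtain ⟨j', t⟩ := b
    obtain rfl : j = j' := hab
    fin_cases s <;> fin_cases t
    · simpa [blockSymplectic] using halt (j, 0)
    · simpa [blockSymplectic] using hblock j
    · simpa [blockSymplectic, hblock] using hskew (j, 1) (j, 0)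
    · simpa [blockSymplectic] using halt (j, 1)
  · rw [hoff a b hab, blockSymplectic, if_neg hab, mul_zero]

-- The period over the `j`-th coordinate torus is the same for all `j`, and the top exterior power
-- of the closed form has integral a nonzero multiple of its `N`-th power; but that top power
-- vanishes, because it is pulled back from dimension `m < 2N`.
theorem IsPotential.setIntegral_unitCube_pullTwoForm (hb : IsPotential S b)
    (hι : ContMDiff (𝓡 k) (𝓡 m) ∞ ι)
    (hcubic : ∀ X Y Z : Vec k, formCLM S (lieDifferentialCLM ι X)
      (bracketCLM D (lieDifferentialCLM ι Y) (lieDifferentialCLM ι Z)) = 0)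
    {g : (Fin 2 → ℝ) → F} (hg : ContMDiff 𝓘(ℝ, Fin 2 → ℝ) (𝓡 k) ∞ g)
    (hperiodic : IsUnitPeriodic g) (haxes : ∀ y i, y i = 0 → g y = 1) (d : D) :
    ∫ y in unitCube (Fin 2), pullTwoForm b (fun y => ι (g y) * d) y (stdVec 0) (stdVec 1) = 0 := by
  let N := m + 1
  let Φ : (Fin N × Fin 2 → ℝ) → D := fun x => ι (torusProd g N x) * d
  have hΦ : ContMDiff 𝓘(ℝ, Fin N × Fin 2 → ℝ) (𝓡 m) ∞ Φ :=
    (hι.comp (contMDiff_torusProd hg N)).mul contMDiff_const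
  have hclosed : IsClosedTwoForm (pullTwoForm b Φ) := hb.isClosedTwoForm_pullTwoForm hΦ
    (formCLM_bracketCLM_mcForm_hom_mul_const hι hcubic (contMDiff_torusProd hg N) d)
  have hΦperiodic : IsUnitPeriodic (pullTwoForm b Φ) :=
    ((hperiodic.torusProd N).comp fun z => ι z * d).pullTwoForm hΦ
  let M := meanForm _ hclosed.contDiff.continuous
  have hM (i j : Fin N × Fin 2) : M (stdVec i) (stdVec j) = ∫ y in unitCube (Fin 2),
      pullTwoForm b (fun y => ι (torusProd g N (coordinatePlane i j y)) * d) y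
        (stdVec 0) (stdVec 1) := by
    simp only [M, meanForm_apply, hclosed.setIntegral_unitCube_eq_coordinatePlane hΦperiodic,
      ← pullTwoForm_comp_coordinatePlane hΦ, Φ]
  have hpfaffian : pfaffian (fun _ : Fin N => M) = 0 := by
    rw [← setIntegral_pfaffian (fun _ => hclosed) fun _ => hΦperiodic]
    simp only [pfaffian_pullTwoForm (show m < Fintype.card (Fin N) * 2 by simp [N]; lia),
      integral_zero]
  refine eq_zero_of_pfaffian_eq_zero M _ (BlockForm.eq_mul_blockSymplectic ?_ ?_ ?_ ?_) hpfaffian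
  · simp [M, meanForm_apply, hclosed.alternating]
  · intro i j
    simp only [M, meanForm_apply, ← integral_neg, ← hclosed.swap]
  · intro j
    simp only [hM, torusProd_coordinatePlane_self haxes]
  · intro i j hij
    simp only [hM, torusProd_coordinatePlane_of_ne haxes hij, pullTwoForm_const, zero_apply,
      integral_zero]

end SphericalPeriods

section PeriodicExtension

/-- The unit periodic extension of the restriction of a function to the unit cube. -/
def periodicExtension {ι β : Type*} (g : (ι → ℝ) → β) (y : ι → ℝ) : β := g fun i => Int.fract (y i)

theorem isUnitPeriodic_periodicExtension {ι β : Type*} [DecidableEq ι] (g : (ι → ℝ) → β) :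
    IsUnitPeriodic (periodicExtension g) := fun x i => by
  unfold periodicExtension
  congr 1
  funext j
  by_cases hji : j = i
  · subst hji
    simp
  · simp [hji]

theorem fract_notMem_Icc {t : ℝ} (hlower : -(1 / 4) < t) (hupper : t < 5 / 4)
    (ht : t ∉ Set.Ico (0 : ℝ) 1) : Int.fract t ∉ Set.Icc (1 / 4 : ℝ) (3 / 4) := by
  rintro ⟨hfract, hfract'⟩
  rcases lt_or_ge t 0 with hneg | hnonneg
  · have hshift : Int.fract t = t + 1 :=
      Int.fract_eq_iff.2 ⟨by linarith, by linarith, -1, by push_cast; ring⟩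
    linarith
  · have hone : 1 ≤ t := not_lt.1 fun hlt => ht ⟨hnonneg, hlt⟩
    have hshift : Int.fract t = t - 1 :=
      Int.fract_eq_iff.2 ⟨by linarith, by linarith, 1, by push_cast; ring⟩
    linarith

theorem periodicExtension_eventuallyEq {ι β : Type*} [Finite ι] {g : (ι → ℝ) → β} {o : β}
    (hg : ∀ y i, y i ∉ Set.Icc (1 / 4 : ℝ) (3 / 4) → g y = o) (y : ι → ℝ) :
    periodicExtension g =ᶠ[𝓝 y] fun z => g fun i => z i - ⌊y i⌋ := by
  have := Fintype.ofFinite ι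
  filter_upwards [Metric.ball_mem_nhds y (by norm_num : (0 : ℝ) < 1 / 4)] with z hz
  have hlower (i : ι) : -(1 / 4) < z i - ⌊y i⌋ := by
    linarith [(abs_lt.1 ((dist_pi_lt_iff (by norm_num)).1 hz i)).1, Int.floor_le (y i)]
  have hupper (i : ι) : z i - ⌊y i⌋ < 5 / 4 := by
    linarith [(abs_lt.1 ((dist_pi_lt_iff (by norm_num)).1 hz i)).2, Int.lt_floor_add_one (y i)]
  have hfract (i : ι) : Int.fract (z i) = Int.fract (z i - ⌊y i⌋) :=
    (Int.fract_sub_intCast (z i) ⌊y i⌋).symm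
  by_cases hcube : ∀ i, z i - ⌊y i⌋ ∈ Set.Ico (0 : ℝ) 1
  · exact congrArg g (funext fun i => (hfract i).trans (Int.fract_eq_self.2 (hcube i)))
  · obtain ⟨i, hi⟩ := not_forall.1 hcube
    rw [periodicExtension, hg _ i, hg _ i]
    · exact fun hmem => hi ⟨by linarith [hmem.1], by linarith [hmem.2]⟩
    · rw [hfract]
      exact fract_notMem_Icc (hlower i) (hupper i) hi

theorem periodicExtension_eventuallyEq_self {ι β : Type*} [Finite ι] {g : (ι → ℝ) → β} {o : β}
    (hg : ∀ y i, y i ∉ Set.Icc (1 / 4 : ℝ) (3 / 4) → g y = o) {y : ι → ℝ} (hy : y ∈ unitCube ι) :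
    periodicExtension g =ᶠ[𝓝 y] g := by
  have hfloor (i : ι) : ⌊y i⌋ = 0 := Int.floor_eq_zero_iff.2 (hy i trivial)
  simpa [hfloor] using periodicExtension_eventuallyEq hg y

theorem contMDiff_periodicExtension {k : ℕ} {F : Type*} [TopologicalSpace F]
    [ChartedSpace (EuclideanSpace ℝ (Fin k)) F] {g : (Fin 2 → ℝ) → F} {o : F}
    (hg : ContMDiff 𝓘(ℝ, Fin 2 → ℝ) (𝓡 k) ∞ g)
    (ho : ∀ y i, y i ∉ Set.Icc (1 / 4 : ℝ) (3 / 4) → g y = o) :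
    ContMDiff 𝓘(ℝ, Fin 2 → ℝ) (𝓡 k) ∞ (periodicExtension g) := fun y => by
  have hshift : ContDiff ℝ ∞ fun (z : Fin 2 → ℝ) (i : Fin 2) => z i - (⌊y i⌋ : ℝ) := by fun_prop
  exact ((hg.comp hshift.contMDiff) y).congr_of_eventuallyEq (periodicExtension_eventuallyEq ho y)

end PeriodicExtension

section SquareChart

/-- The affine map of the plane taking the unit square to the square of side `r` centred at the
origin. -/
def squareChart (r : ℝ) (y : Fin 2 → ℝ) : ℝ × ℝ := r • ((y 0, y 1) - (1 / 2, 1 / 2))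

theorem hasFDerivAt_squareChart (r : ℝ) (y : Fin 2 → ℝ) :
    HasFDerivAt (squareChart r) (r • (ContinuousLinearMap.proj (R := ℝ) (φ := fun _ => ℝ) 0).prod
      (ContinuousLinearMap.proj (R := ℝ) (φ := fun _ => ℝ) 1)) y :=
  (((hasFDerivAt_apply 0 y).prodMk (hasFDerivAt_apply 1 y)).sub_const _).const_smul r

theorem contDiff_squareChart (r : ℝ) : ContDiff ℝ ∞ (squareChart r) := by
  unfold squareChart
  fun_prop

theorem integral_comp_squareChart {r : ℝ} (G : ℝ × ℝ → ℝ) :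
    ∫ y, G (squareChart r y) = (r ^ 2)⁻¹ * ∫ x, G x := by
  have hflat : ∫ y, G (squareChart r y) = ∫ x : ℝ × ℝ, G (r • (x - (1 / 2, 1 / 2))) :=
    (volume_preserving_finTwoArrow ℝ).integral_comp' fun x => G (r • (x - (1 / 2, 1 / 2)))
  rw [hflat, integral_sub_right_eq_self (fun x => G (r • x)), Measure.integral_comp_smul]
  simp

theorem exists_squareChart_eq_one {β : Type*} [One β] {f : ℝ × ℝ → β}
    (hf : HasCompactMulSupport f) :
    ∃ r : ℝ, r ≠ 0 ∧ ∀ y i, y i ∉ Set.Icc (1 / 4 : ℝ) (3 / 4) → f (squareChart r y) = 1 := by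
  obtain ⟨L, hL, hsupport⟩ := hf.isCompact.isBounded.exists_pos_norm_le
  refine ⟨4 * L, by positivity, fun y i hy => ?_⟩
  by_contra hne
  have hbound := hsupport _ (subset_mulTSupport f hne)
  rw [squareChart, norm_smul, Real.norm_of_nonneg (by positivity)] at hbound
  have hnorm : ‖(y 0, y 1) - ((1 / 2, 1 / 2) : ℝ × ℝ)‖ ≤ 1 / 4 := by nlinarith
  have hcoord : |y i - 1 / 2| ≤ 1 / 4 := by
    fin_cases i
    · exact (norm_fst_le _).trans hnorm
    · exact (norm_snd_le _).trans hnorm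
  have habs := abs_le.1 hcoord
  exact hy ⟨by linarith, by linarith⟩

theorem integral_pullTwoForm_squareChart {m : ℕ} {D : Type*} [TopologicalSpace D]
    [ChartedSpace (EuclideanSpace ℝ (Fin m)) D] [Group D] [LieGroup (𝓡 m) ∞ D]
    {b : D → LinearMap.BilinForm ℝ (GroupLieAlgebra (𝓡 m) D)} {Φ : ℝ × ℝ → D} {r : ℝ}
    (hr : r ≠ 0) (hΦ : ContMDiff 𝓘(ℝ, ℝ × ℝ) (𝓡 m) ∞ Φ) :
    ∫ y, pullTwoForm b (fun y => Φ (squareChart r y)) y (stdVec 0) (stdVec 1) =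
      ∫ x, pullTwoForm b Φ x (1, 0) (0, 1) := by
  have hpull (y : Fin 2 → ℝ) :
      pullTwoForm b (fun y => Φ (squareChart r y)) y (stdVec 0) (stdVec 1) =
        r ^ 2 * pullTwoForm b Φ (squareChart r y) (1, 0) (0, 1) := by
    have hcomp := pullTwoForm_comp (b := b) (g := squareChart r) (x := y)
      (hΦ.mdifferentiableAt (by simp)) (hasFDerivAt_squareChart r y).differentiableAt
      (stdVec 0) (stdVec 1)
    have hfst : fderiv ℝ (squareChart r) y (stdVec 0) = r • (1, 0) := by
      simp [(hasFDerivAt_squareChart r y).fderiv, stdVec]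
    have hsnd : fderiv ℝ (squareChart r) y (stdVec 1) = r • (0, 1) := by
      simp [(hasFDerivAt_squareChart r y).fderiv, stdVec]
    rw [hcomp, hfst, hsnd, map_smul, map_smul, smul_apply, smul_eq_mul, smul_eq_mul]
    ring
  simp only [hpull]
  rw [integral_const_mul, integral_comp_squareChart fun x => pullTwoForm b Φ x (1, 0) (0, 1),
    mul_inv_cancel_left₀ (pow_ne_zero 2 hr)]

end SquareChart

section PlanePeriods

variable {k m : ℕ} {F D : Type*} [TopologicalSpace F]
  [ChartedSpace (EuclideanSpace ℝ (Fin k)) F] [Group F] [LieGroup (𝓡 k) ∞ F] [TopologicalSpace D]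
  [ChartedSpace (EuclideanSpace ℝ (Fin m)) D] [Group D] [LieGroup (𝓡 m) ∞ D]
  {b : D → LinearMap.BilinForm ℝ (GroupLieAlgebra (𝓡 m) D)}
  {S : DoubleAlgebra (GroupLieAlgebra (𝓡 m) D)} {ι : F →* D}

theorem IsPotential.integral_pullTwoForm_of_eq_one (hb : IsPotential S b)
    (hι : ContMDiff (𝓡 k) (𝓡 m) ∞ ι)
    (hcubic : ∀ X Y Z : Vec k, formCLM S (lieDifferentialCLM ι X)
      (bracketCLM D (lieDifferentialCLM ι Y) (lieDifferentialCLM ι Z)) = 0)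
    {g : (Fin 2 → ℝ) → F} (hg : ContMDiff 𝓘(ℝ, Fin 2 → ℝ) (𝓡 k) ∞ g)
    (hone : ∀ y i, y i ∉ Set.Icc (1 / 4 : ℝ) (3 / 4) → g y = 1) (d : D) :
    ∫ y, pullTwoForm b (fun y => ι (g y) * d) y (stdVec 0) (stdVec 1) = 0 := by
  have hperiodic := contMDiff_periodicExtension hg hone
  rw [← hb.setIntegral_unitCube_pullTwoForm hι hcubic hperiodic
      (isUnitPeriodic_periodicExtension g) (fun y i hy => hone _ i (by simp [hy])) d,
    ← setIntegral_eq_integral_of_forall_compl_eq_zero (s := unitCube (Fin 2))]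
  · refine setIntegral_congr_fun (MeasurableSet.univ_pi fun _ => measurableSet_Ico) fun y hy => ?_
    have heq : (fun y => ι (periodicExtension g y) * d) =ᶠ[𝓝 y] fun y => ι (g y) * d :=
      (periodicExtension_eventuallyEq_self hone hy).fun_comp fun z => ι z * d
    simp only [pullTwoForm_congr heq
      (((hι.comp hperiodic).mul contMDiff_const).mdifferentiableAt (by simp))]
  · intro y hy
    obtain ⟨i, hi⟩ : ∃ i, y i ∉ Set.Icc (1 / 4 : ℝ) (3 / 4) := by
      simp only [unitCube, Set.mem_univ_pi, not_forall] at hy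
      obtain ⟨i, hi⟩ := hy
      exact ⟨i, fun hmem => hi ⟨by linarith [hmem.1], by linarith [hmem.2]⟩⟩
    have hopen : IsOpen {z : Fin 2 → ℝ | z i ∉ Set.Icc (1 / 4 : ℝ) (3 / 4)} :=
      isClosed_Icc.isOpen_compl.preimage (continuous_apply i)
    have hconst : (fun y => ι (g y) * d) =ᶠ[𝓝 y] fun _ => d := by
      filter_upwards [hopen.mem_nhds hi] with z hz
      rw [hone z i hz, map_one, one_mul]
    rw [pullTwoForm_eq_zero_of_const_nhds hconst]
    rfl

theorem IsPotential.integral_pullTwoForm_eq_zero (hb : IsPotential S b)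
    (hι : ContMDiff (𝓡 k) (𝓡 m) ∞ ι)
    (hcubic : ∀ X Y Z : Vec k, formCLM S (lieDifferentialCLM ι X)
      (bracketCLM D (lieDifferentialCLM ι Y) (lieDifferentialCLM ι Z)) = 0)
    {f : ℝ × ℝ → F} (hf : ContMDiff 𝓘(ℝ, ℝ × ℝ) (𝓡 k) ∞ f) (hsupport : HasCompactMulSupport f)
    (d : D) : ∫ x, pullTwoForm b (fun x => ι (f x) * d) x (1, 0) (0, 1) = 0 := by
  obtain ⟨r, hr, hone⟩ := exists_squareChart_eq_one hsupport
  have hΦ : ContMDiff 𝓘(ℝ, ℝ × ℝ) (𝓡 m) ∞ fun x => ι (f x) * d :=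
    (hι.comp hf).mul contMDiff_const
  rw [← integral_pullTwoForm_squareChart hr hΦ]
  exact hb.integral_pullTwoForm_of_eq_one hι hcubic (hf.comp (contDiff_squareChart r).contMDiff)
    hone d

end PlanePeriods

namespace DoubleAlgebra.IsDressingPair

variable {𝔡 : Type*} [LieRing 𝔡] [LieAlgebra ℝ 𝔡] {S : DoubleAlgebra 𝔡} [FiniteDimensional ℝ 𝔡]
  {R : S.GHat →ₗ[ℝ] S.G} {A A' : 𝔡 →ₗ[ℝ] 𝔡} (h : S.IsDressingPair R A A')

include h

theorem form_add_apply {P Q : 𝔡} (hP : P ∈ S.fSpace R) (hQ : Q ∈ S.fSpace R) (X Y : 𝔡) :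
    S.form (P + A X) (Q + A Y) = S.form X Y + S.form P (A Y) + S.form Q (A X) := by
  rw [map_add, map_add, LinearMap.add_apply, LinearMap.add_apply, form_fSpace_fSpace hP hQ,
    S.symm.eq Q, h.form_apply]
  ring

theorem form_sub_apply {P Q L : 𝔡} (hP : P ∈ S.fSpace R) (hQ : Q ∈ S.fSpace R)
    (hL : L ∈ S.fSpace R) (X : 𝔡) :
    S.form (A L - P) (Q + A X) = S.form L X - S.form P (A X) := by
  rw [map_add, map_sub, LinearMap.sub_apply, LinearMap.sub_apply, form_fSpace_fSpace hP hQ,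
    form_fSpace_fSpace (h.apply_mem_fSpace hL) hQ, h.form_apply]
  ring

theorem add_apply_mem_fPerp {P X : 𝔡} (hP : P ∈ S.fSpace R) (hX : X ∈ S.fPerp R) :
    P + A X ∈ S.fPerp R :=
  add_mem (fun _ hY => form_fSpace_fSpace hY hP) (h.apply_mem_fPerp hX)

theorem K_add_apply {P X : 𝔡} (hP : P ∈ S.fSpace R) (hX : X ∈ S.fPerp R) :
    S.K R (P + A X) = S.K R X :=
  (K_add_of_mem_fSpace (h.apply_mem_fPerp hX) hP).trans (h.K_apply hX)

end DoubleAlgebra.IsDressingPair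

section GaugeHomotopy

variable {m : ℕ} {D : Type*} [TopologicalSpace D] [ChartedSpace (EuclideanSpace ℝ (Fin m)) D]
  [Group D] [LieGroup (𝓡 m) ∞ D] {E : Type*} [NormedAddCommGroup E] [NormedSpace ℝ E]
  {S : DoubleAlgebra (GroupLieAlgebra (𝓡 m) D)}
  {b : D → LinearMap.BilinForm ℝ (GroupLieAlgebra (𝓡 m) D)} {h l : E → D}

theorem gaugeTwoForm_comp {E' : Type*} [NormedAddCommGroup E'] [NormedSpace ℝ E'] {g : E' → E}
    (hh : ContMDiff 𝓘(ℝ, E) (𝓡 m) ∞ h) (hl : ContMDiff 𝓘(ℝ, E) (𝓡 m) ∞ l)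
    (hg : ContDiff ℝ ∞ g) (x u v : E') :
    gaugeTwoForm S b (fun y => h (g y)) (fun y => l (g y)) x u v =
      gaugeTwoForm S b h l (g x) (fderiv ℝ g x u) (fderiv ℝ g x v) := by
  have hhl : ContMDiff 𝓘(ℝ, E) (𝓡 m) ∞ fun y => h y * l y := hh.mul hl
  have hgx : DifferentiableAt ℝ g x := hg.differentiable (by simp) x
  rw [gaugeTwoForm_apply (h := fun y => h (g y)) (l := fun y => l (g y)) (hh.comp hg.contMDiff)
      (hl.comp hg.contMDiff), gaugeTwoForm_apply hh hl,
    pullTwoForm_comp (hl.mdifferentiableAt (by simp)) hgx,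
    pullTwoForm_comp (Φ := fun y => h y * l y) (hhl.mdifferentiableAt (by simp)) hgx,
    mcForm_comp (hh.mdifferentiableAt (by simp)) hgx,
    mcForm_comp (hl.mdifferentiableAt (by simp)) hgx]
  rfl

theorem gaugeTwoForm_eq_zero_of_notMem_mulTSupport (hh : ContMDiff 𝓘(ℝ, E) (𝓡 m) ∞ h)
    (hl : ContMDiff 𝓘(ℝ, E) (𝓡 m) ∞ l) {x : E} (hx : x ∉ mulTSupport h) :
    gaugeTwoForm S b h l x = 0 := by
  have hhl : ContMDiff 𝓘(ℝ, E) (𝓡 m) ∞ fun y => h y * l y := hh.mul hl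
  have hone : h =ᶠ[𝓝 x] fun _ => 1 := notMem_mulTSupport_iff_eventuallyEq.1 hx
  have heq : (fun y => h y * l y) =ᶠ[𝓝 x] l := by
    filter_upwards [hone] with y hy
    rw [hy, one_mul]
  ext u v
  rw [gaugeTwoForm_apply hh hl, pullTwoForm_congr heq (hhl.mdifferentiableAt (by simp)),
    mcForm_congr hone (hh.mdifferentiableAt (by simp)), mcForm_const]
  simp

theorem gaugeTwoForm_const (hh : ContMDiff 𝓘(ℝ, E) (𝓡 m) ∞ h) (d : D) (x u v : E) :
    gaugeTwoForm S b h (fun _ => d) x u v = pullTwoForm b (fun y => h y * d) x u v := by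
  rw [gaugeTwoForm_apply hh contMDiff_const, mcForm_const, pullTwoForm_const]
  simp

theorem maurerCartan_gaugeField {h l : ℝ × ℝ → D} (hh : ContMDiff 𝓘(ℝ, ℝ × ℝ) (𝓡 m) ∞ h)
    (hl : ContMDiff 𝓘(ℝ, ℝ × ℝ) (𝓡 m) ∞ l) (x v : ℝ × ℝ) :
    maurerCartan (m := m) (gaugeField h l) x v =
      maurerCartan h x v + Ad (h x) (maurerCartan l x v) :=
  DFunLike.congr_fun (mcForm_mul (hh.mdifferentiableAt (x := x) (by simp))
    (hl.mdifferentiableAt (x := x) (by simp))) v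

theorem gaugeTwoForm_apply_dSigma_dTau {h l : ℝ × ℝ → D}
    (hh : ContMDiff 𝓘(ℝ, ℝ × ℝ) (𝓡 m) ∞ h) (hl : ContMDiff 𝓘(ℝ, ℝ × ℝ) (𝓡 m) ∞ l) (x : ℝ × ℝ) :
    gaugeTwoForm S b h l x (1, 0) (0, 1) =
      b (gaugeField h l x) (dSigma (gaugeField h l) x) (dTau (gaugeField h l) x)
      - b (l x) (dSigma l x) (dTau l x)
      + 6 * (S.form (dSigma h x) (Ad (h x) (dTau l x))
        - S.form (dTau h x) (Ad (h x) (dSigma l x))) :=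
  gaugeTwoForm_apply hh hl x (1, 0) (0, 1)

end GaugeHomotopy

section GaugeInvariance

variable {m k : ℕ} {D F : Type*} [TopologicalSpace D]
  [ChartedSpace (EuclideanSpace ℝ (Fin m)) D] [Group D] [LieGroup (𝓡 m) ∞ D] [TopologicalSpace F]
  [ChartedSpace (EuclideanSpace ℝ (Fin k)) F] [Group F]

/-- A smooth homomorphism into the double whose differential takes values in `ℱ` and whose adjoint
action satisfies the dressing condition: the part of the notion of a gauge group of a dressing coset
that gauge invariance rests on. -/
structure IsDressingHom (S : DoubleAlgebra (GroupLieAlgebra (𝓡 m) D)) (R : S.GHat →ₗ[ℝ] S.G)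
    (ι : F →* D) : Prop where
  smooth : ContMDiff (𝓡 k) (𝓡 m) ∞ ι
  lieDifferential_mem : ∀ X, lieDifferential (m := m) (k := k) ι X ∈ S.fSpace R
  dressing : ∀ f : F, S.DressingCondition R (Ad (ι f))

variable {S : DoubleAlgebra (GroupLieAlgebra (𝓡 m) D)} {R : S.GHat →ₗ[ℝ] S.G}
  {b : D → LinearMap.BilinForm ℝ (GroupLieAlgebra (𝓡 m) D)}

theorem lagrangian_eq_unconstrainedDensity_add {l : ℝ × ℝ → D}
    {Λ : ℝ × ℝ → GroupLieAlgebra (𝓡 m) D} (h : IsWorldSheetField S R l Λ)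
    (hc : IsConstrained S R l) (x : ℝ × ℝ) :
    lagrangian S R b l Λ x = unconstrainedDensity S b l Λ x + (1 / 2) * S.K R (dSigma l x) := by
  have hΛ : S.form (Λ x) (dSigma l x) = 0 := hc x _ (h.mem x)
  rw [lagrangian, unconstrainedDensity, hΛ]
  ring

variable [LieGroup (𝓡 k) ∞ F] {ι : F →* D}

namespace IsDressingHom

variable (hι : IsDressingHom (k := k) S R ι)

include hι

theorem formCLM_bracketCLM_eq_zero (X Y Z : Vec k) :
    formCLM S (lieDifferentialCLM ι X)
      (bracketCLM D (lieDifferentialCLM ι Y) (lieDifferentialCLM ι Z)) = 0 := by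
  rw [← lieDifferentialCLM_bracketCLM hι.smooth]
  exact S.form_fSpace_fSpace (𝔡 := GroupLieAlgebra (𝓡 m) D) (hι.lieDifferential_mem X)
    (hι.lieDifferential_mem _)

theorem maurerCartan_mem_fSpace {f : ℝ × ℝ → F} (hf : ContMDiff 𝓘(ℝ, ℝ × ℝ) (𝓡 k) ∞ f)
    (x v : ℝ × ℝ) : maurerCartan (m := m) (ι ∘ f) x v ∈ S.fSpace R := by
  have hcomp : maurerCartan (m := m) (ι ∘ f) x v = lieDifferential ι (maurerCartan f x v) :=
    DFunLike.congr_fun (mcForm_hom_comp hι.smooth (hf.mdifferentiableAt (by simp))) v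
  exact hcomp ▸ hι.lieDifferential_mem _

variable [ConnectedSpace F]

theorem isDressingPair (f : F) : S.IsDressingPair R (Ad (ι f)) (Ad (ι f⁻¹)) where
  apply_mem_rSpace _ hX := DoubleAlgebra.DressingCondition.apply_mem_rSpace S (hι.dressing f) hX
  inv_apply_mem_rSpace _ hX :=
    DoubleAlgebra.DressingCondition.apply_mem_rSpace S (hι.dressing f⁻¹) hX
  apply_inv X := by
    rw [map_inv]
    exact adCLM_apply_inv (ι f) X
  inv_apply X := by
    rw [map_inv]
    exact adCLM_inv_apply (ι f) X
  form_apply X Y := formCLM_adCLM S hι.smooth f X Y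

theorem isClosedTwoForm_gaugeTwoForm {E : Type*} [NormedAddCommGroup E] [NormedSpace ℝ E]
    [FiniteDimensional ℝ E] (hb : IsPotential S b) {f : E → F}
    (hf : ContMDiff 𝓘(ℝ, E) (𝓡 k) ∞ f) {l : E → D} (hl : ContMDiff 𝓘(ℝ, E) (𝓡 m) ∞ l) :
    IsClosedTwoForm (gaugeTwoForm S b (ι ∘ f) l) := by
  refine _root_.isClosedTwoForm_gaugeTwoForm hb (hι.smooth.comp hf) hl (fun x u v w => ?_)
    fun x X Y => formCLM_adCLM S hι.smooth (f x) X Y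
  have hcomp : mcForm (m := m) (ι ∘ f) x = _ :=
    mcForm_hom_comp hι.smooth (hf.mdifferentiableAt (x := x) (by simp))
  rw [hcomp]
  exact hι.formCLM_bracketCLM_eq_zero _ _ _

-- The homotopy `(t, x) ↦ l (t x)` contracts `l` to a constant, for which `gaugeTwoForm` is the
-- pullback of `b` by a translate of `ι ∘ f`.
theorem integral_gaugeTwoForm_eq_zero (hb : IsPotential S b) {f : ℝ × ℝ → F}
    (hf : ContMDiff 𝓘(ℝ, ℝ × ℝ) (𝓡 k) ∞ f) (hsupport : HasCompactMulSupport f) {l : ℝ × ℝ → D}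
    (hl : ContMDiff 𝓘(ℝ, ℝ × ℝ) (𝓡 m) ∞ l) :
    ∫ x, gaugeTwoForm S b (ι ∘ f) l x (1, 0) (0, 1) = 0 := by
  let h (p : ℝ × (ℝ × ℝ)) : F := f p.2
  let L (p : ℝ × (ℝ × ℝ)) : D := l (p.1 • p.2)
  have hh : ContMDiff 𝓘(ℝ, ℝ × (ℝ × ℝ)) (𝓡 k) ∞ h := hf.comp contDiff_snd.contMDiff
  have hL : ContMDiff 𝓘(ℝ, ℝ × (ℝ × ℝ)) (𝓡 m) ∞ L :=
    hl.comp (contDiff_fst.smul contDiff_snd).contMDiff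
  have hclosed : IsClosedTwoForm (gaugeTwoForm S b (ι ∘ h) L) :=
    hι.isClosedTwoForm_gaugeTwoForm hb hh hL
  have hzero (t : ℝ) (x : ℝ × ℝ) (hx : x ∉ mulTSupport f) :
      gaugeTwoForm S b (ι ∘ h) L (t, x) = 0 :=
    gaugeTwoForm_eq_zero_of_notMem_mulTSupport (hι.smooth.comp hh) hL fun hmem =>
      hx (mulTSupport_comp_subset_preimage f continuous_snd
        (mulTSupport_comp_subset (map_one ι) h hmem))
  have hslice (t : ℝ) (x u v : ℝ × ℝ) :
      gaugeTwoForm S b (ι ∘ h) L (t, x) (0, u) (0, v) =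
        gaugeTwoForm S b (ι ∘ f) (fun x => l (t • x)) x u v := by
    have hcomp := gaugeTwoForm_comp (S := S) (b := b) (hι.smooth.comp hh) hL
      (contDiff_prodMk_right t) x u v
    rw [(hasFDerivAt_prodMk_right t x).fderiv] at hcomp
    exact hcomp.symm
  have hhomotopy := hclosed.integral_one_eq_integral_zero hsupport hzero
  simp only [hslice, one_smul, zero_smul, gaugeTwoForm_const (hι.smooth.comp hf)] at hhomotopy
  rw [hhomotopy]
  exact hb.integral_pullTwoForm_eq_zero hι.smooth hι.formCLM_bracketCLM_eq_zero hf hsupport _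

theorem sameAction (hb : IsPotential S b) {f : ℝ × ℝ → F}
    (hf : ContMDiff 𝓘(ℝ, ℝ × ℝ) (𝓡 k) ∞ f) (hsupport : HasCompactMulSupport f) {l : ℝ × ℝ → D}
    (hl : ContMDiff 𝓘(ℝ, ℝ × ℝ) (𝓡 m) ∞ l) {W : Set (ℝ × ℝ)} (hW : mulTSupport f ⊆ W)
    {L L' : ℝ × ℝ → ℝ}
    (hLL' : ∀ x, L' x = L x + (1 / 12) * gaugeTwoForm S b (ι ∘ f) l x (1, 0) (0, 1)) :
    SameAction W L L' := by
  intro hL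
  let G (x : ℝ × ℝ) : ℝ := gaugeTwoForm S b (ι ∘ f) l x (1, 0) (0, 1)
  have hzero (x : ℝ × ℝ) (hx : x ∉ mulTSupport f) : G x = 0 := by
    have hgauge := gaugeTwoForm_eq_zero_of_notMem_mulTSupport (S := S) (b := b) (hι.smooth.comp hf)
      hl fun hmem => hx (mulTSupport_comp_subset (map_one ι) f hmem)
    simp only [G, hgauge, zero_apply]
  have hcont : Continuous G :=
    ((hι.isClosedTwoForm_gaugeTwoForm hb hf hl).contDiff.continuous.clm_apply
      continuous_const).clm_apply continuous_const
  have hG : Integrable G :=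
    hcont.integrable_of_hasCompactSupport (HasCompactSupport.intro hsupport hzero)
  have hGW : ∫ x in W, G x = 0 := by
    rw [setIntegral_eq_integral_of_forall_compl_eq_zero fun x hx => hzero x fun hx' => hx (hW hx')]
    exact hι.integral_gaugeTwoForm_eq_zero hb hf hsupport hl
  have hG12 : IntegrableOn (fun x => (1 / 12) * G x) W := (hG.const_mul _).integrableOn
  rw [funext hLL']
  refine ⟨hL.add hG12, ?_⟩
  unfold action
  rw [integral_add hL hG12, integral_const_mul, hGW, mul_zero, add_zero]

variable {f : ℝ × ℝ → F} (hf : ContMDiff 𝓘(ℝ, ℝ × ℝ) (𝓡 k) ∞ f) {l : ℝ × ℝ → D}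
  {Λ : ℝ × ℝ → GroupLieAlgebra (𝓡 m) D}

include hf

theorem isWorldSheetField (h : IsWorldSheetField S R l Λ) :
    IsWorldSheetField S R (gaugeField (ι ∘ f) l) (gaugeMultiplier (ι ∘ f) Λ) where
  smooth_l := (hι.smooth.comp hf).mul h.smooth_l
  smooth_Λ := ((contDiff_adCLM (hι.smooth.comp hf)).clm_apply h.smooth_Λ).sub
    ((contDiff_mcForm (hι.smooth.comp hf)).clm_apply contDiff_const)
  mem x := sub_mem ((hι.isDressingPair (f x)).apply_mem_fSpace (h.mem x))
    (hι.maurerCartan_mem_fSpace hf x (0, 1))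

theorem isConstrained (hl : ContMDiff 𝓘(ℝ, ℝ × ℝ) (𝓡 m) ∞ l) (h : IsConstrained S R l) :
    IsConstrained S R (gaugeField (ι ∘ f) l) := fun x => by
  rw [dSigma, maurerCartan_gaugeField (hι.smooth.comp hf) hl]
  exact (hι.isDressingPair (f x)).add_apply_mem_fPerp (hι.maurerCartan_mem_fSpace hf x (1, 0)) (h x)

theorem unconstrainedDensity_gauge (h : IsWorldSheetField S R l Λ) (x : ℝ × ℝ) :
    unconstrainedDensity S b (gaugeField (ι ∘ f) l) (gaugeMultiplier (ι ∘ f) Λ) x =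
      unconstrainedDensity S b l Λ x + (1 / 12) * gaugeTwoForm S b (ι ∘ f) l x (1, 0) (0, 1) := by
  have hpair := hι.isDressingPair (f x)
  have hsigma : dSigma (m := m) (ι ∘ f) x ∈ S.fSpace R := hι.maurerCartan_mem_fSpace hf x (1, 0)
  have htau : dTau (m := m) (ι ∘ f) x ∈ S.fSpace R := hι.maurerCartan_mem_fSpace hf x (0, 1)
  have hmc := maurerCartan_gaugeField (m := m) (hι.smooth.comp hf) h.smooth_l x
  have hsigma_mul : dSigma (m := m) (gaugeField (ι ∘ f) l) x =
    dSigma (ι ∘ f) x + Ad (ι (f x)) (dSigma l x) := hmc (1, 0)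
  have htau_mul : dTau (m := m) (gaugeField (ι ∘ f) l) x =
    dTau (ι ∘ f) x + Ad (ι (f x)) (dTau l x) := hmc (0, 1)
  have hkinetic := hpair.form_add_apply htau hsigma (dTau l x) (dSigma l x)
  have hmultiplier := hpair.form_sub_apply htau hsigma (h.mem x) (dSigma l x)
  rw [← hsigma_mul, ← htau_mul] at hkinetic
  rw [← hsigma_mul] at hmultiplier
  rw [gaugeTwoForm_apply_dSigma_dTau (hι.smooth.comp hf) h.smooth_l]
  simp only [unconstrainedDensity, wzwDensity, gaugeMultiplier, Function.comp_apply]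
  linarith

theorem lagrangian_gauge (h : IsWorldSheetField S R l Λ) (hc : IsConstrained S R l) (x : ℝ × ℝ) :
    lagrangian S R b (gaugeField (ι ∘ f) l) (gaugeMultiplier (ι ∘ f) Λ) x =
      lagrangian S R b l Λ x + (1 / 12) * gaugeTwoForm S b (ι ∘ f) l x (1, 0) (0, 1) := by
  have hK : S.K R (dSigma (gaugeField (ι ∘ f) l) x) = S.K R (dSigma l x) := by
    rw [dSigma, maurerCartan_gaugeField (hι.smooth.comp hf) h.smooth_l]
    exact (hι.isDressingPair (f x)).K_add_apply (hι.maurerCartan_mem_fSpace hf x (1, 0)) (hc x)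
  rw [lagrangian_eq_unconstrainedDensity_add h hc, lagrangian_eq_unconstrainedDensity_add
    (hι.isWorldSheetField hf h) (hι.isConstrained hf h.smooth_l hc), hK,
    hι.unconstrainedDensity_gauge hf h]
  ring

end IsDressingHom

end GaugeInvariance

end

theorem theorem3_general {m k : ℕ}
    {D : Type*} [TopologicalSpace D] [ChartedSpace (EuclideanSpace ℝ (Fin m)) D]
    [Group D] [LieGroup (𝓡 m) ∞ D]
    (S : DoubleAlgebra (GroupLieAlgebra (𝓡 m) D)) (R : S.GHat →ₗ[ℝ] S.G)
    {F : Type*} [TopologicalSpace F] [ChartedSpace (EuclideanSpace ℝ (Fin k)) F]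
    [Group F] [LieGroup (𝓡 k) ∞ F] [ConnectedSpace F]
    (ι : F →* D) (hsmooth : ContMDiff (𝓡 k) (𝓡 m) ∞ ι)
    (hmem : ∀ X, lieDifferential (m := m) (k := k) ι X ∈ S.fSpace R)
    (hcond : ∀ f : F, S.DressingCondition R (Ad (ι f))) :
    (∀ f : F, (S.rSpace R).map (Ad (ι f)) = S.rSpace R ∧
      (S.rPerp R).map (Ad (ι f)) = S.rPerp R) ∧
    (∀ f : F, ∀ X ∈ S.fPerp R, Ad (ι f) X ∈ S.fPerp R ∧ S.K R (Ad (ι f) X) = S.K R X) ∧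
    (∀ f : ℝ × ℝ → F, ContMDiff 𝓘(ℝ, ℝ × ℝ) (𝓡 k) ∞ f →
      ∀ (l : ℝ × ℝ → D) (Λ : ℝ × ℝ → GroupLieAlgebra (𝓡 m) D),
        IsWorldSheetField S R l Λ →
        IsWorldSheetField S R (gaugeField (ι ∘ f) l) (gaugeMultiplier (ι ∘ f) Λ) ∧
        (IsConstrained S R l → IsConstrained S R (gaugeField (ι ∘ f) l)) ∧
        ∀ b : D → LinearMap.BilinForm ℝ (GroupLieAlgebra (𝓡 m) D), IsPotential S b →
        HasCompactMulSupport f →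
        ∀ W : Set (ℝ × ℝ), mulTSupport f ⊆ W →
          (IsConstrained S R l →
            SameAction W (lagrangian S R b l Λ)
              (lagrangian S R b (gaugeField (ι ∘ f) l) (gaugeMultiplier (ι ∘ f) Λ))) ∧
          SameAction W (unconstrainedDensity S b l Λ)
            (unconstrainedDensity S b (gaugeField (ι ∘ f) l) (gaugeMultiplier (ι ∘ f) Λ))) := by
  have hι : IsDressingHom (k := k) S R ι := ⟨hsmooth, hmem, hcond⟩
  refine ⟨fun f => ⟨(hι.isDressingPair f).map_rSpace, (hι.isDressingPair f).map_rPerp⟩,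
    fun f X hX => ⟨(hι.isDressingPair f).apply_mem_fPerp hX, (hι.isDressingPair f).K_apply hX⟩,
    fun f hf l Λ h => ⟨hι.isWorldSheetField hf h, hι.isConstrained hf h.smooth_l,
      fun b hb hsupport W hW => ⟨fun hc => ?_, ?_⟩⟩⟩
  · exact hι.sameAction hb hf hsupport h.smooth_l hW (hι.lagrangian_gauge hf h hc)
  · exact hι.sameAction hb hf hsupport h.smooth_l hW (hι.unconstrainedDensity_gauge hf h)

theorem theorem3 {n k : ℕ}
    {D : Type*} [TopologicalSpace D] [ChartedSpace (EuclideanSpace ℝ (Fin (2 * n))) D]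
    [Group D] [LieGroup (𝓡 (2 * n)) ∞ D]
    (S : DoubleAlgebra (GroupLieAlgebra (𝓡 (2 * n)) D)) (R : S.GHat →ₗ[ℝ] S.G)
    (hR : LinearMap.ker R = ⊥) (hRs : LinearMap.ker (S.adjoint R) = ⊥)
    (hF : ∀ X ∈ S.fSpace R, ∀ Y ∈ S.fSpace R, ⁅X, Y⁆ ∈ S.fSpace R)
    {F : Type*} [TopologicalSpace F] [ChartedSpace (EuclideanSpace ℝ (Fin k)) F]
    [Group F] [LieGroup (𝓡 k) ∞ F] [ConnectedSpace F]
    (ι : F →* D) (hι : IsLieSubgroup (m := 2 * n) (k := k) ι (S.fSpace R))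
    (hcond : ∀ f : F, S.DressingCondition R (Ad (ι f))) :
    (∀ f : F, (S.rSpace R).map (Ad (ι f)) = S.rSpace R ∧
      (S.rPerp R).map (Ad (ι f)) = S.rPerp R) ∧
    (∀ f : F, ∀ X ∈ S.fPerp R, Ad (ι f) X ∈ S.fPerp R ∧ S.K R (Ad (ι f) X) = S.K R X) ∧
    (∀ f : ℝ × ℝ → F, ContMDiff 𝓘(ℝ, ℝ × ℝ) (𝓡 k) ∞ f →
      ∀ (l : ℝ × ℝ → D) (Λ : ℝ × ℝ → GroupLieAlgebra (𝓡 (2 * n)) D),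
        IsWorldSheetField S R l Λ →
        IsWorldSheetField S R (gaugeField (ι ∘ f) l) (gaugeMultiplier (ι ∘ f) Λ) ∧
        (IsConstrained S R l → IsConstrained S R (gaugeField (ι ∘ f) l)) ∧
        ∀ b : D → LinearMap.BilinForm ℝ (GroupLieAlgebra (𝓡 (2 * n)) D), IsPotential S b →
        HasCompactMulSupport f →
        ∀ W : Set (ℝ × ℝ), MeasurableSet W → mulTSupport f ⊆ W →
          (IsConstrained S R l →
            SameAction W (lagrangian S R b l Λ)
              (lagrangian S R b (gaugeField (ι ∘ f) l) (gaugeMultiplier (ι ∘ f) Λ))) ∧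
          SameAction W (unconstrainedDensity S b l Λ)
            (unconstrainedDensity S b (gaugeField (ι ∘ f) l) (gaugeMultiplier (ι ∘ f) Λ))) := by
  obtain ⟨hspaces, hK, haction⟩ := theorem3_general S R ι hι.smooth
    (fun X => hι.range_eq ▸ LinearMap.mem_range_self _ X) hcond
  exact ⟨hspaces, hK, fun f hf l Λ h => (haction f hf l Λ h).imp_right
    (.imp_right fun hS b hb hsupport W _ => hS b hb hsupport W)⟩
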